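/- **Theorem (multi-determinant functors are 2-functorial in the triangulated categories).** Let $\mathcal P=(\mathcal P,+,0)$ be a Picard groupoid (a symmetric monoidal groupoid in which $x+(\cdot)$ is an equivalence for every object $x$). *Multiexact functors.* A functor $F\colon \mathcal T_1\times\dots\times\mathcal T_n\to\mathcal T$ ($n\ge 0$) of small triangulated categories is *multiexact* if it is a triangulated functor in each variable (additive, preserving distinguished triangles, with isomorphisms $F(\dots,\Sigma x_i,\dots)\cong\Sigma F(\dots,x_i,\dots)$ natural in all variables), such that for $i\ne j$ the two isomorphisms $F(\dots,\Sigma x_i,\dots,\Sigma x_j,\dots)\cong\Sigma^2F(\dots,x_i,\dots,x_j,\dots)$ differ by the sign $-1$. A distinguished triangle in the $i$-th variable and one in the $j$-th variable ($i\neq j$, the other variables fixed) give a $3\times 3$ diagram with distinguished rows and columns $x'\xrightarrow{f'}y'\xrightarrow{g'}z'\xrightarrow{h'}\Sigma x'$, $x\xrightarrow{f}y\xrightarrow{g}z\xrightarrow{h}\Sigma x$, $x''\xrightarrow{f''}y''\xrightarrow{g''}z''\xrightarrow{h''}\Sigma x''$ and $x'\xrightarrow{p'}x\xrightarrow{p}x''\xrightarrow{p''}\Sigma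 x'$, and likewise $(q',q,q'')$, $(r',r,r'')$, all squares commuting except the last one, which anticommutes. $F$ *admits Verdier structures* if for each such diagram there are an object $A$, a distinguished triangle $x'\xrightarrow{fp'}y\to A\to\Sigma x'$ and octahedra over the compositions $fp'$ and $q'f'=fp'$ with fourth triangles $x''\xrightarrow{\varepsilon}A\xrightarrow{\eta}z\to\Sigma x''$ and $z'\xrightarrow{\beta}A\xrightarrow{\gamma}y''\xrightarrow{\delta}\Sigma z'$, such that $\gamma\varepsilon=f''$, $\eta\beta=r'$, and such that $(z\xrightarrow{r}z''\xrightarrow{r''}\Sigma z'\xrightarrow{-\Sigma r'}\Sigma z)$ is the fourth triangle of an octahedron over $f''=\gamma\varepsilon$ on the triangles $(\varepsilon,\eta,\cdot)$, $(\gamma,\delta,-\Sigma\beta)$ and $(f'',g'',h'')$. *The 2-category $\mathrm{TrCat}_{\mathcal V}^{\times}$.* Objects are finite lists $\underline{\mathcal T}=(\mathcal T_1,\dots,\mathcal T_n)$, $n\ge0$, of small triangulated categories. A 1-morphism $(\mathcal S_1,\dots,\mathcal S_m)\to(\mathcal T_1,\dots,\mathcal T_n)$ is a map $\varphi\colon\{1,\dots,m\}\to\{1,\dots,n\}$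 together with, for each $j$, a multiexact functor $F_j\colon\prod_{i\in\varphi^{-1}(j)}\mathcal S_i\to\mathcal T_j$ admitting Verdier structures. A 2-morphism $(\varphi,F_j)\Rightarrow(\varphi,F'_j)$ is a family of natural isomorphisms $F_j\cong F'_j$ compatible with the translation isomorphisms in every variable. Compositions are the evident ones (multiexact functors admitting Verdier structures are closed under composition). *Multi-determinant functors.* A multi-determinant functor $D\colon\underline{\mathcal T}\to\mathcal P$ is a functor $D\colon \mathrm{isom}(\mathcal T_1)\times\dots\times\mathrm{isom}(\mathcal T_n)\to\mathcal P$ with, for each $i$ and each distinguished triangle $\Delta\colon x\to y\to z\to\Sigma x$ of $\mathcal T_i$ (the other variables being fixed), a morphism $D(\Delta)\colon D(z)+D(x)\to D(y)$, natural with respect to isomorphisms of triangles in the $i$-th variable and isomorphisms in the other variables, which satisfies, in each variable, the commutativity axiom for the two triangles $x\to x\oplus y\to y$ and $y\to x\oplus y\to x$ and the associativity axiom for octahedra, and such that for $i\ne j$ and triangles $\Delta_i$ in $\mathcal T_i$, $\Delta_j$ in $\mathcal T_j$ the two morphisms $$(D(z_i,z_j)+D(x_i,z_j))+(D(z_i,x_j)+D(x_i,x_j))\longrightarrow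 D(y_i,y_j)$$ built from $D(\Delta_i)$ twice and then $D(\Delta_j)$, respectively from $D(\Delta_j)$ twice and then $D(\Delta_i)$ after exchanging the two middle terms, are equal. Morphisms of multi-determinant functors are the natural transformations compatible with all the $D(\Delta)$. Let $\mathrm{Det}(\underline{\mathcal T};\mathcal P)$ be the groupoid of multi-determinant functors. *Claim.* 1. Multi-determinant functors are closed under pointwise sum and contain the constant unit functor, and $\mathrm{Det}(\underline{\mathcal T};\mathcal P)$ is a Picard groupoid for the pointwise sum. 2. For each 1-morphism $F=(\varphi,F_j)\colon\underline{\mathcal S}\to\underline{\mathcal T}$ and each $D\in\mathrm{Det}(\underline{\mathcal T};\mathcal P)$, the composite $D\circ(F_1,\dots,F_n)$ with the induced additivity data is a multi-determinant functor; and for each 2-morphism $\alpha\colon F\Rightarrow F'$ the transformation $D*\alpha\colon D\circ F\Rightarrow D\circ F'$ is a morphism of multi-determinant functors. 3. The assignments $\underline{\mathcal T}\mapsto\mathrm{Det}(\underline{\mathcal T};\mathcal P)$, $F\mapsto F^*=(D\mapsto D\circ F,\ \eta\mapsto\eta*F)$ (a symmetric monoidal functor, strictly preserving the pointwise sums), $\alpha\mapsto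 (D*\alpha)_D$ form a (strict) 2-functor $$\mathrm{Det}(-;\mathcal P)\colon(\mathrm{TrCat}_{\mathcal V}^{\times})^{\mathrm{op}}\longrightarrow\mathrm{Pic},$$ where $\mathrm{Pic}$ is the 2-category of Picard groupoids, symmetric monoidal functors and monoidal natural transformations. -/

import Mathlib

open CategoryTheory CategoryTheory.Limits CategoryTheory.Pretriangulated
open CategoryTheory.Triangulated CategoryTheory.MonoidalCategory

universe u v w

namespace DetFunctor

noncomputable section

set_option linter.unusedVariables false

/-! ### Triangulated categories and nine-term diagrams -/

/-- A small triangulated category. -/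
structure TriCat : Type (u + 1) where
  carrier : Type u
  [cat : Category.{u} carrier]
  [zero : HasZeroObject carrier]
  [shift : HasShift carrier ℤ]
  [preadd : Preadditive carrier]
  [shiftAdd : ∀ n : ℤ, (shiftFunctor carrier n).Additive]
  [pretri : Pretriangulated carrier]
  [tri : IsTriangulated carrier]

instance : CoeSort TriCat.{u} (Type u) := ⟨TriCat.carrier⟩

attribute [instance] TriCat.cat TriCat.zero TriCat.shift TriCat.preadd TriCat.shiftAdd
  TriCat.pretri TriCat.tri

/-- A nine-term diagram in a triangulated category `C`, with rows `(f', g', h')`, `(f, g, h)`,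
`(f'', g'', h'')` and columns `(p', p, p'')`, `(q', q, q'')`, `(r', r, r'')`. All rows and columns
are distinguished triangles, and all squares of the diagram commute, except for the bottom right
one, which anticommutes. -/
structure NineDiagram (C : TriCat.{u}) where
  {x' y' z' x y z x'' y'' z'' : C}
  f' : x' ⟶ y'
  g' : y' ⟶ z'
  h' : z' ⟶ x'⟦(1 : ℤ)⟧
  f : x ⟶ y
  g : y ⟶ z
  h : z ⟶ x⟦(1 : ℤ)⟧
  f'' : x'' ⟶ y''
  g'' : y'' ⟶ z''
  h'' : z'' ⟶ x''⟦(1 : ℤ)⟧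
  p' : x' ⟶ x
  p : x ⟶ x''
  p'' : x'' ⟶ x'⟦(1 : ℤ)⟧
  q' : y' ⟶ y
  q : y ⟶ y''
  q'' : y'' ⟶ y'⟦(1 : ℤ)⟧
  r' : z' ⟶ z
  r : z ⟶ z''
  r'' : z'' ⟶ z'⟦(1 : ℤ)⟧
  row' : Triangle.mk f' g' h' ∈ distTriang C
  row : Triangle.mk f g h ∈ distTriang C
  row'' : Triangle.mk f'' g'' h'' ∈ distTriang C
  colx : Triangle.mk p' p p'' ∈ distTriang C
  coly : Triangle.mk q' q q'' ∈ distTriang C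
  colz : Triangle.mk r' r r'' ∈ distTriang C
  comm_f' : f' ≫ q' = p' ≫ f
  comm_g' : g' ≫ r' = q' ≫ g
  comm_h' : h' ≫ p'⟦(1 : ℤ)⟧' = r' ≫ h
  comm_f : f ≫ q = p ≫ f''
  comm_g : g ≫ r = q ≫ g''
  comm_h : h ≫ p⟦(1 : ℤ)⟧' = r ≫ h''
  comm_f'' : f'' ≫ q'' = p'' ≫ f'⟦(1 : ℤ)⟧'
  comm_g'' : g'' ≫ r'' = q'' ≫ g'⟦(1 : ℤ)⟧'
  anticomm_h'' : h'' ≫ p''⟦(1 : ℤ)⟧' = -(r'' ≫ h'⟦(1 : ℤ)⟧')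

/-- A Verdier structure on a nine-term diagram: an object `A` sitting in a distinguished triangle
`x' ⟶ y ⟶ A ⟶ x'⟦1⟧` on the diagonal of the upper left square, and three octahedra. With
`ε = o₁.m₁ : x'' ⟶ A`, `η = o₁.m₃ : A ⟶ z`, `β = o₂.m₁ : z' ⟶ A`, `γ = o₂.m₃ : A ⟶ y''`, they are
the octahedra over the compositions `x' ⟶ x ⟶ y`, `x' ⟶ y' ⟶ y` and `f'' = ε ≫ γ`. The triangle on
`γ` in the third one is the rotation `(γ, δ, -β⟦1⟧)` of the triangle `(β, γ, δ)` given by the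
second one, and the fourth triangle of the third octahedron is `(r, r'', -r'⟦1⟧)`. -/
structure VerdierStructure {C : TriCat.{u}} (d : NineDiagram C) where
  A : C
  α : d.y ⟶ A
  v : A ⟶ d.x'⟦(1 : ℤ)⟧
  dist : Triangle.mk (d.p' ≫ d.f) α v ∈ distTriang C
  o₁ : Octahedron (rfl : d.p' ≫ d.f = d.p' ≫ d.f) d.colx d.row dist
  o₂ : Octahedron d.comm_f' d.row' d.coly dist
  εγ : o₁.m₁ ≫ o₂.m₃ = d.f''
  βη : o₂.m₁ ≫ o₁.m₃ = d.r'
  o₃ : Octahedron εγ o₁.mem (rot_of_distTriang _ o₂.mem) d.row''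
  o₃_m₁ : o₃.m₁ = d.r
  o₃_m₃ : o₃.m₃ = d.r''

/-- The transpose of a nine-term diagram. -/
def NineDiagram.transpose {C : TriCat.{u}} (d : NineDiagram C) : NineDiagram C where
  f' := d.p'
  g' := d.p
  h' := d.p''
  f := d.q'
  g := d.q
  h := d.q''
  f'' := d.r'
  g'' := d.r
  h'' := d.r''
  p' := d.f'
  p := d.g'
  p'' := d.h'
  q' := d.f
  q := d.g
  q'' := d.h
  r' := d.f''
  r := d.g''
  r'' := d.h''
  row' := d.colx
  row := d.coly
  row'' := d.colz
  colx := d.row'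
  coly := d.row
  colz := d.row''
  comm_f' := d.comm_f'.symm
  comm_g' := d.comm_f.symm
  comm_h' := d.comm_f''.symm
  comm_f := d.comm_g'.symm
  comm_g := d.comm_g.symm
  comm_h := d.comm_g''.symm
  comm_f'' := d.comm_h'.symm
  comm_g'' := d.comm_h.symm
  anticomm_h'' := by rw [d.anticomm_h'', neg_neg]

/-- The transpose of a nine-term diagram with a Verdier structure has a Verdier structure. -/
def VerdierStructure.transpose {C : TriCat.{u}} {d : NineDiagram C} (s : VerdierStructure d) :
    VerdierStructure d.transpose where
  A := s.A
  α := s.α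
  v := s.v
  dist := by
    have := s.dist
    rw [← d.comm_f'] at this
    exact this
  o₁ := { m₁ := s.o₂.m₁, m₃ := s.o₂.m₃, comm₁ := s.o₂.comm₁, comm₂ := s.o₂.comm₂
          comm₃ := s.o₂.comm₃, comm₄ := s.o₂.comm₄, mem := s.o₂.mem }
  o₂ := { m₁ := s.o₁.m₁, m₃ := s.o₁.m₃, comm₁ := s.o₁.comm₁, comm₂ := s.o₁.comm₂
          comm₃ := s.o₁.comm₃, comm₄ := s.o₁.comm₄, mem := s.o₁.mem }
  εγ := s.βη
  βη := s.εγ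
  o₃ :=
    { m₁ := d.g''
      m₃ := d.h''
      comm₁ := by
        have := s.o₃.comm₁
        rw [s.o₃_m₁] at this
        exact this.symm
      comm₂ := by
        have := s.o₃.comm₃
        rw [s.o₃_m₃] at this
        exact this
      comm₃ := by
        have := s.o₃.comm₂
        rw [s.o₃_m₁] at this
        exact this
      comm₄ := by
        have := s.o₃.comm₄
        rw [s.o₃_m₃] at this
        change d.r'' ≫ s.o₂.m₁⟦(1 : ℤ)⟧' = d.h'' ≫ (-s.o₁.m₁⟦(1 : ℤ)⟧')
        change d.h'' ≫ s.o₁.m₁⟦(1 : ℤ)⟧' = d.r'' ≫ (-s.o₂.m₁⟦(1 : ℤ)⟧') at this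
        rw [Preadditive.comp_neg] at this ⊢
        rw [this, neg_neg]
      mem := by
        have h₁ := rot_of_distTriang _ d.row''
        have h₂ : (-s.o₁.m₁⟦(1 : ℤ)⟧') ≫ s.o₂.m₃⟦(1 : ℤ)⟧' = -d.f''⟦(1 : ℤ)⟧' := by
          rw [Preadditive.neg_comp, ← Functor.map_comp, s.εγ]
        change Triangle.mk d.g'' d.h'' ((-s.o₁.m₁⟦(1 : ℤ)⟧') ≫ s.o₂.m₃⟦(1 : ℤ)⟧') ∈ _
        rw [h₂]
        exact h₁ }
  o₃_m₁ := rfl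
  o₃_m₃ := rfl

/-! ### Functors of several variables -/

section MultiExact

variable {ι : Type} {T : ι → TriCat.{u}}

/-- For objects `Z`, `X` of the product of the `T j`, a morphism from `Z` to the object
`(…, X i⟦1⟧, …)` obtained from `X` by translating its `i`-th entry. -/
@[ext]
structure ShiftHom (i : ι) (Z X : ∀ j, T j) where
  self : Z i ⟶ (X i)⟦(1 : ℤ)⟧
  off : ∀ j, j ≠ i → (Z j ⟶ X j)

/-- Composition of a morphism `W ⟶ Z` with a morphism `Z ⟶ (…, X i⟦1⟧, …)`. -/
@[simps]
def ShiftHom.precomp {i : ι} {W Z X : ∀ j, T j} (f : W ⟶ Z) (u : ShiftHom i Z X) :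
    ShiftHom i W X where
  self := f i ≫ u.self
  off j hj := f j ≫ u.off j hj

/-- Composition of a morphism `Z ⟶ (…, X i⟦1⟧, …)` with the translate in the `i`-th variable of a
morphism `X ⟶ Y`. -/
@[simps]
def ShiftHom.postcomp {i : ι} {Z X Y : ∀ j, T j} (u : ShiftHom i Z X) (f : X ⟶ Y) :
    ShiftHom i Z Y where
  self := u.self ≫ (f i)⟦(1 : ℤ)⟧'
  off j hj := u.off j hj ≫ f j

/-- A distinguished triangle `X i ⟶ Y i ⟶ Z i ⟶ X i⟦1⟧` in the `i`-th variable, all the other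
variables `a j = X j = Y j = Z j` being held fixed. -/
structure IsDistTri (i : ι) {X Y Z : ∀ j, T j} (f : X ⟶ Y) (g : Y ⟶ Z) (h : ShiftHom i Z X) :
    Prop where
  dist : Triangle.mk (f i) (g i) h.self ∈ distTriang (T i)
  f_off : ∀ j, j ≠ i → ∃ e : X j = Y j, f j = eqToHom e
  g_off : ∀ j, j ≠ i → ∃ e : Y j = Z j, g j = eqToHom e
  h_off : ∀ j (hj : j ≠ i), ∃ e : Z j = X j, h.off j hj = eqToHom e

/-- A multiexact functor `T₁ × ⋯ × Tₙ ⟶ S`: a functor which is triangulated in each variable, such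
that the translation isomorphisms in any two variables anticommute.

The isomorphism `F(…, X i⟦1⟧, …) ≅ F(X)⟦1⟧`, natural in all variables, is recorded through the maps
which it induces from morphisms `Z ⟶ (…, X i⟦1⟧, …)` to morphisms `F(Z) ⟶ F(X)⟦1⟧`. -/
structure MultiExact (T : ι → TriCat.{u}) (S : TriCat.{u}) where
  functor : (∀ j, T j) ⥤ S
  shiftMap : ∀ {i : ι} {Z X : ∀ j, T j}, ShiftHom i Z X →
    (functor.obj Z ⟶ (functor.obj X)⟦(1 : ℤ)⟧)
  shiftMap_precomp : ∀ {i : ι} {W Z X : ∀ j, T j} (f : W ⟶ Z) (u : ShiftHom i Z X),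
    shiftMap (u.precomp f) = functor.map f ≫ shiftMap u
  shiftMap_postcomp : ∀ {i : ι} {Z X Y : ∀ j, T j} (u : ShiftHom i Z X) (f : X ⟶ Y),
    shiftMap (u.postcomp f) = shiftMap u ≫ (functor.map f)⟦(1 : ℤ)⟧'
  isIso_shiftMap : ∀ {i : ι} {Z X : ∀ j, T j} (u : ShiftHom i Z X),
    IsIso u.self → (∀ j hj, IsIso (u.off j hj)) → IsIso (shiftMap u)
  /-- additivity in each variable -/
  map_add : ∀ (i : ι) {X Y : ∀ j, T j} (f g h : X ⟶ Y), h i = f i + g i →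
    (∀ j, j ≠ i → f j = h j ∧ g j = h j) → functor.map h = functor.map f + functor.map g
  /-- distinguished triangles in each variable are preserved -/
  map_dist : ∀ {i : ι} {X Y Z : ∀ j, T j} {f : X ⟶ Y} {g : Y ⟶ Z} {h : ShiftHom i Z X},
    IsDistTri i f g h → Triangle.mk (functor.map f) (functor.map g) (shiftMap h) ∈ distTriang S
  /-- For `i ≠ j`, the two ways `F(…, X i⟦1⟧, …, X j⟦1⟧, …) ⟶ F(X)⟦1⟧⟦1⟧` of commuting `F` with the
  translations differ by a sign. The hypotheses say that `u`, `v` and `v'`, `u'` have the same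
  composite `W ⟶ (…, X i⟦1⟧, …, X j⟦1⟧, …)`. -/
  anticomm : ∀ {i j : ι} (hij : i ≠ j) {W Y Z X : ∀ j, T j}
    (u : ShiftHom i W Y) (v : ShiftHom j Y X) (v' : ShiftHom j W Z) (u' : ShiftHom i Z X),
    u.self ≫ (v.off i hij)⟦(1 : ℤ)⟧' = v'.off i hij ≫ u'.self →
    u.off j hij.symm ≫ v.self = v'.self ≫ (u'.off j hij.symm)⟦(1 : ℤ)⟧' →
    (∀ k (hi : k ≠ i) (hj : k ≠ j), u.off k hi ≫ v.off k hj = v'.off k hj ≫ u'.off k hi) →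
    shiftMap u ≫ (shiftMap v)⟦(1 : ℤ)⟧' = -(shiftMap v' ≫ (shiftMap u')⟦(1 : ℤ)⟧')

/-- The `3 × 3` grid in the product of the `T k` made of a distinguished triangle in the `i`-th
variable (the rows) and a distinguished triangle in the `j`-th variable (the columns), all the other
variables being held fixed. -/
structure Grid (T : ι → TriCat.{u}) (i j : ι) (hij : i ≠ j) where
  {x' y' z' x y z x'' y'' z'' : ∀ k, T k}
  f' : x' ⟶ y'
  g' : y' ⟶ z'
  h' : ShiftHom i z' x'
  f : x ⟶ y
  g : y ⟶ z
  h : ShiftHom i z x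
  f'' : x'' ⟶ y''
  g'' : y'' ⟶ z''
  h'' : ShiftHom i z'' x''
  p' : x' ⟶ x
  p : x ⟶ x''
  p'' : ShiftHom j x'' x'
  q' : y' ⟶ y
  q : y ⟶ y''
  q'' : ShiftHom j y'' y'
  r' : z' ⟶ z
  r : z ⟶ z''
  r'' : ShiftHom j z'' z'
  row' : IsDistTri i f' g' h'
  row : IsDistTri i f g h
  row'' : IsDistTri i f'' g'' h''
  colx : IsDistTri j p' p p''
  coly : IsDistTri j q' q q''
  colz : IsDistTri j r' r r''
  comm_f' : f' ≫ q' = p' ≫ f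
  comm_g' : g' ≫ r' = q' ≫ g
  comm_h' : h'.postcomp p' = h.precomp r'
  comm_f : f ≫ q = p ≫ f''
  comm_g : g ≫ r = q ≫ g''
  comm_h : h.postcomp p = h''.precomp r
  comm_f'' : q''.precomp f'' = p''.postcomp f'
  comm_g'' : r''.precomp g'' = q''.postcomp g'
  comm_h''_i : h''.self ≫ (p''.off i hij)⟦(1 : ℤ)⟧' = r''.off i hij ≫ h'.self
  comm_h''_j : h''.off j hij.symm ≫ p''.self = r''.self ≫ (h'.off j hij.symm)⟦(1 : ℤ)⟧'
  comm_h''_off : ∀ k (hi : k ≠ i) (hj : k ≠ j),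
    h''.off k hi ≫ p''.off k hj = r''.off k hj ≫ h'.off k hi

/-- The nine-term diagram which a multiexact functor induces from distinguished triangles in two of
its variables. -/
@[simps]
def MultiExact.nine {S : TriCat.{u}} (F : MultiExact T S) {i j : ι} {hij : i ≠ j}
    (d : Grid T i j hij) : NineDiagram S where
  f' := F.functor.map d.f'
  g' := F.functor.map d.g'
  h' := F.shiftMap d.h'
  f := F.functor.map d.f
  g := F.functor.map d.g
  h := F.shiftMap d.h
  f'' := F.functor.map d.f''
  g'' := F.functor.map d.g''
  h'' := F.shiftMap d.h''
  p' := F.functor.map d.p'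
  p := F.functor.map d.p
  p'' := F.shiftMap d.p''
  q' := F.functor.map d.q'
  q := F.functor.map d.q
  q'' := F.shiftMap d.q''
  r' := F.functor.map d.r'
  r := F.functor.map d.r
  r'' := F.shiftMap d.r''
  row' := F.map_dist d.row'
  row := F.map_dist d.row
  row'' := F.map_dist d.row''
  colx := F.map_dist d.colx
  coly := F.map_dist d.coly
  colz := F.map_dist d.colz
  comm_f' := by rw [← F.functor.map_comp, d.comm_f', F.functor.map_comp]
  comm_g' := by rw [← F.functor.map_comp, d.comm_g', F.functor.map_comp]
  comm_h' := by rw [← F.shiftMap_postcomp, d.comm_h', F.shiftMap_precomp]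
  comm_f := by rw [← F.functor.map_comp, d.comm_f, F.functor.map_comp]
  comm_g := by rw [← F.functor.map_comp, d.comm_g, F.functor.map_comp]
  comm_h := by rw [← F.shiftMap_postcomp, d.comm_h, F.shiftMap_precomp]
  comm_f'' := by rw [← F.shiftMap_postcomp, ← d.comm_f'', F.shiftMap_precomp]
  comm_g'' := by rw [← F.shiftMap_postcomp, ← d.comm_g'', F.shiftMap_precomp]
  anticomm_h'' := F.anticomm hij _ _ _ _ d.comm_h''_i d.comm_h''_j d.comm_h''_off

/-- A multiexact functor admits a Verdier structure if all the nine-term diagrams induced by a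
distinguished triangle in the `i`-th variable and one in the `j`-th variable, `i < j`, admit one. -/
def MultiExact.AdmitsVerdier [LinearOrder ι] {S : TriCat.{u}} (F : MultiExact T S) : Prop :=
  ∀ (i j : ι) (hij : i < j) (d : Grid T i j hij.ne), Nonempty (VerdierStructure (F.nine d))

/-- Transformations of multiexact functors: natural isomorphisms compatible with the translation
isomorphisms in every variable. -/
@[ext]
structure MultiExact.Hom {S : TriCat.{u}} (F G : MultiExact T S) where
  iso : F.functor ≅ G.functor
  shift : ∀ {i : ι} {Z X : ∀ j, T j} (u : ShiftHom i Z X),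
    F.shiftMap u ≫ (iso.hom.app X)⟦(1 : ℤ)⟧' = iso.hom.app Z ≫ G.shiftMap u

@[simps]
instance {S : TriCat.{u}} : Category (MultiExact T S) where
  Hom F G := MultiExact.Hom F G
  id F := { iso := Iso.refl _, shift := fun u => by simp }
  comp a b :=
    { iso := a.iso ≪≫ b.iso
      shift := fun u => by
        simp only [Iso.trans_hom, NatTrans.comp_app, Functor.map_comp]
        rw [← Category.assoc, a.shift, Category.assoc, b.shift, Category.assoc] }

@[ext]
theorem MultiExact.hom_ext {S : TriCat.{u}} {F G : MultiExact T S} (a b : F ⟶ G)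
    (h : ∀ X, a.iso.hom.app X = b.iso.hom.app X) : a = b := by
  apply MultiExact.Hom.ext
  ext X
  exact h X

end MultiExact

/-! ### Composition of multiexact functors -/

section Comp

/-- In the variable `i`, any two objects can be joined by a morphism which is a given one in the
`i`-th entry and the identity in all the others. -/
theorem exists_hom {ι : Type} {T : ι → TriCat.{u}} {i : ι} {X Y : ∀ j, T j}
    (h : ∀ j, j ≠ i → X j = Y j) (t : X i ⟶ Y i) :
    ∃ f : X ⟶ Y, f i = t ∧ ∀ j, j ≠ i → ∃ e : X j = Y j, f j = eqToHom e := by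
  classical
  exact ⟨fun j => if hj : j = i then Eq.rec (motive := fun a _ => X a ⟶ Y a) t hj.symm
    else eqToHom (h j hj), by simp, fun j hj => ⟨h j hj, by simp [hj]⟩⟩

theorem exists_obj {ι : Type} {T : ι → TriCat.{u}} (i : ι) (X : ∀ j, T j) (A : T i) :
    ∃ Y : ∀ j, T j, Y i = A ∧ ∀ j, j ≠ i → X j = Y j := by
  classical
  exact ⟨Function.update X i A, by simp, fun j hj => by simp [hj]⟩

theorem MultiExact.map_eq_neg_id {ι : Type} {T : ι → TriCat.{u}} {S : TriCat.{u}}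
    (F : MultiExact T S) {i : ι} {X : ∀ j, T j} (n : X ⟶ X) (hn : n i = -𝟙 _)
    (hn' : ∀ j, j ≠ i → n j = 𝟙 _) : F.functor.map n = -𝟙 _ := by
  obtain ⟨o, ho, ho'⟩ := exists_hom (X := X) (Y := X) (i := i) (fun _ _ => rfl) 0
  have ho'' : ∀ j, j ≠ i → o j = 𝟙 _ := fun j hj => by
    obtain ⟨_, h⟩ := ho' j hj
    simpa using h
  have h0 : F.functor.map o = 0 := by
    have := F.map_add i o o o (by rw [ho, add_zero]) (fun _ _ => ⟨rfl, rfl⟩)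
    simpa using this
  have := F.map_add i (𝟙 X) n o (by rw [ho, hn]; simp)
    (fun j hj => ⟨by rw [ho'' j hj]; rfl, by rw [hn' j hj, ho'' j hj]⟩)
  rw [h0, F.functor.map_id] at this
  exact (neg_eq_of_add_eq_zero_right this.symm).symm

theorem MultiExact.shiftMap_eq_neg {ι : Type} {T : ι → TriCat.{u}} {S : TriCat.{u}}
    (F : MultiExact T S) {i : ι} {Z X : ∀ j, T j} (a b : ShiftHom i Z X)
    (hself : a.self = -b.self) (hoff : ∀ k hk, a.off k hk = b.off k hk) :
    F.shiftMap a = -F.shiftMap b := by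
  obtain ⟨n, hn, hn'⟩ := exists_hom (X := Z) (Y := Z) (i := i) (fun _ _ => rfl) (-𝟙 _)
  have hn'' : ∀ j, j ≠ i → n j = 𝟙 _ := fun j hj => by
    obtain ⟨_, h⟩ := hn' j hj
    simpa using h
  have : a = b.precomp n := by
    apply ShiftHom.ext
    · simp [hn, hself]
    · funext k hk
      simp [hn'' k hk, hoff k hk]
  rw [this, F.shiftMap_precomp, F.map_eq_neg_id n hn hn'', Preadditive.neg_comp, Category.id_comp]

/-- Variant of the anticommutativity, for morphisms which translate the same variable twice. -/
theorem MultiExact.anticomm_self {ι : Type} {T : ι → TriCat.{u}} {S : TriCat.{u}}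
    (F : MultiExact T S) {i : ι} {W Y Z X : ∀ j, T j}
    (u : ShiftHom i W Y) (v : ShiftHom i Y X) (v' : ShiftHom i W Z) (u' : ShiftHom i Z X)
    (hself : u.self ≫ v.self⟦(1 : ℤ)⟧' = -(v'.self ≫ u'.self⟦(1 : ℤ)⟧'))
    (hoff : ∀ k (hk : k ≠ i), u.off k hk ≫ v.off k hk = v'.off k hk ≫ u'.off k hk) :
    F.shiftMap u ≫ (F.shiftMap v)⟦(1 : ℤ)⟧' = -(F.shiftMap v' ≫ (F.shiftMap u')⟦(1 : ℤ)⟧') := by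
  obtain ⟨X₁, hX₁, hX₁'⟩ := exists_obj i X ((X i)⟦(1 : ℤ)⟧)
  obtain ⟨e, he, he'⟩ : ∃ e : ShiftHom i X₁ X, IsIso e.self ∧ ∀ j hj, IsIso (e.off j hj) :=
    ⟨⟨eqToHom hX₁, fun j hj => eqToHom (hX₁' j hj).symm⟩, by dsimp; infer_instance,
      fun j hj => by dsimp; infer_instance⟩
  have key : ∀ {V : ∀ j, T j} (b : ShiftHom i V X), ∃ c : V ⟶ X₁, e.precomp c = b := by
    classical
    intro V b
    refine ⟨fun j => if hj : j = i then
      Eq.rec (motive := fun a _ => V a ⟶ X₁ a) (b.self ≫ inv e.self) hj.symm else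
        b.off j hj ≫ inv (e.off j hj), ?_⟩
    apply ShiftHom.ext
    · simp
    · funext j hj
      simp [hj]
  obtain ⟨c, rfl⟩ := key v
  obtain ⟨c', rfl⟩ := key u'
  have h2 : F.shiftMap (u.postcomp c) = -F.shiftMap (v'.postcomp c') := by
    apply F.shiftMap_eq_neg
    · simp only [ShiftHom.precomp_self, Functor.map_comp] at hself
      rw [← Category.assoc, ← Category.assoc, ← Preadditive.neg_comp, cancel_mono] at hself
      exact hself
    · intro k hk
      have := hoff k hk
      simp only [ShiftHom.precomp_off] at this
      have := he' k hk
      rwa [← Category.assoc, ← Category.assoc, cancel_mono] at *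
  rw [F.shiftMap_precomp, F.shiftMap_precomp, Functor.map_comp, Functor.map_comp,
    ← Category.assoc, ← Category.assoc, ← F.shiftMap_postcomp, ← F.shiftMap_postcomp, h2,
    Preadditive.neg_comp]

variable {ι κ : Type} {S : ι → TriCat.{u}} {T : κ → TriCat.{u}} {φ : ι → κ}
  (F : ∀ j, MultiExact (fun i : {i // φ i = j} => S i.1) (T j))

/-- Restriction of a tuple of objects to a fibre of `φ`. -/
abbrev resObj {q : κ → Prop} (X : ∀ i : {i // q (φ i)}, S i.1) (j : {j // q j}) :
    ∀ i : {i // φ i = j.1}, S i.1 :=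
  fun i => X ⟨i.1, i.2.symm ▸ j.2⟩

/-- Restriction of a tuple of morphisms to a fibre of `φ`. -/
abbrev resHom {q : κ → Prop} {X Y : ∀ i : {i // q (φ i)}, S i.1} (f : X ⟶ Y) (j : {j // q j}) :
    resObj X j ⟶ resObj Y j :=
  fun i => f ⟨i.1, i.2.symm ▸ j.2⟩

/-- The functor between the products over `{i // q (φ i)}` and `{j // q j}` given by the family
`F`. -/
@[simps]
def imageFunctor (q : κ → Prop) :
    (∀ i : {i // q (φ i)}, S i.1) ⥤ (∀ j : {j // q j}, T j.1) where
  obj X := fun j => (F j.1).functor.obj (resObj X j)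
  map f := fun j => (F j.1).functor.map (resHom f j)
  map_id X := by
    funext j
    exact (F j.1).functor.map_id _
  map_comp f g := by
    funext j
    exact (F j.1).functor.map_comp _ _

/-- Restriction to the fibre containing `i`. -/
abbrev resShift {q : κ → Prop} {i : {i // q (φ i)}} {Z X : ∀ i : {i // q (φ i)}, S i.1}
    (u : ShiftHom i Z X) (l : {j // q j}) (hl : φ i.1 = l.1) :
    ShiftHom (⟨i.1, hl⟩ : {i // φ i = l.1}) (resObj Z l) (resObj X l) where
  self := u.self
  off i' hi' := u.off ⟨i'.1, i'.2.symm ▸ l.2⟩ (fun h => hi' (Subtype.ext (congrArg (·.1) h)))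

/-- The image under the family `F` of a morphism which translates the `i`-th variable; it
translates the variable `l = φ i`. -/
@[simps]
def imageShift {q : κ → Prop} {i : {i // q (φ i)}} {Z X : ∀ i : {i // q (φ i)}, S i.1}
    (u : ShiftHom i Z X) (l : {j // q j}) (hl : φ i.1 = l.1) :
    ShiftHom l ((imageFunctor F q).obj Z) ((imageFunctor F q).obj X) where
  self := (F l.1).shiftMap (resShift u l hl)
  off j hj := (F j.1).functor.map (fun i' => u.off ⟨i'.1, i'.2.symm ▸ j.2⟩
    (fun h => hj (Subtype.ext (i'.2.symm.trans ((congrArg (fun a => φ a.1) h).trans hl)))))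

theorem functor_map_eqToHom {ι : Type} {T : ι → TriCat.{u}} {S : TriCat.{u}}
    (G : (∀ j, T j) ⥤ S) {X Y : ∀ j, T j} (f : X ⟶ Y)
    (hf : ∀ j, ∃ e : X j = Y j, f j = eqToHom e) :
    ∃ e : G.obj X = G.obj Y, G.map f = eqToHom e := by
  have h : X = Y := funext fun j => (hf j).1
  subst h
  have : f = 𝟙 X := by
    funext j
    obtain ⟨_, h⟩ := hf j
    simpa using h
  exact ⟨rfl, by rw [this]; simp⟩

variable {q : κ → Prop}

theorem res_dist {i : {i // q (φ i)}} {X Y Z : ∀ i : {i // q (φ i)}, S i.1}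
    {f : X ⟶ Y} {g : Y ⟶ Z} {h : ShiftHom i Z X} (d : IsDistTri i f g h)
    (l : {j // q j}) (hl : φ i.1 = l.1) :
    IsDistTri (⟨i.1, hl⟩ : {i // φ i = l.1}) (resHom f l) (resHom g l) (resShift h l hl) where
  dist := d.dist
  f_off j hj := d.f_off _ (fun h => hj (Subtype.ext (congrArg (·.1) h)))
  g_off j hj := d.g_off _ (fun h => hj (Subtype.ext (congrArg (·.1) h)))
  h_off j hj := d.h_off _ _

theorem image_dist {i : {i // q (φ i)}} {X Y Z : ∀ i : {i // q (φ i)}, S i.1}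
    {f : X ⟶ Y} {g : Y ⟶ Z} {h : ShiftHom i Z X} (d : IsDistTri i f g h)
    (l : {j // q j}) (hl : φ i.1 = l.1) :
    IsDistTri l ((imageFunctor F q).map f) ((imageFunctor F q).map g) (imageShift F h l hl) where
  dist := (F l.1).map_dist (res_dist d l hl)
  f_off j hj := functor_map_eqToHom _ _ fun i' => d.f_off _
    (fun h => hj (Subtype.ext (i'.2.symm.trans ((congrArg (fun a => φ a.1) h).trans hl))))
  g_off j hj := functor_map_eqToHom _ _ fun i' => d.g_off _
    (fun h => hj (Subtype.ext (i'.2.symm.trans ((congrArg (fun a => φ a.1) h).trans hl))))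
  h_off j hj := functor_map_eqToHom _ _ fun i' => d.h_off _ _

theorem imageShift_precomp {i : {i // q (φ i)}} {W Z X : ∀ i : {i // q (φ i)}, S i.1}
    (f : W ⟶ Z) (u : ShiftHom i Z X) (l : {j // q j}) (hl : φ i.1 = l.1) :
    imageShift F (u.precomp f) l hl = (imageShift F u l hl).precomp ((imageFunctor F q).map f) := by
  apply ShiftHom.ext
  · exact (F l.1).shiftMap_precomp (resHom f l) (resShift u l hl)
  · funext j hj
    exact (F j.1).functor.map_comp _ _

theorem imageShift_postcomp {i : {i // q (φ i)}} {Z X Y : ∀ i : {i // q (φ i)}, S i.1}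
    (u : ShiftHom i Z X) (f : X ⟶ Y) (l : {j // q j}) (hl : φ i.1 = l.1) :
    imageShift F (u.postcomp f) l hl =
      (imageShift F u l hl).postcomp ((imageFunctor F q).map f) := by
  apply ShiftHom.ext
  · exact (F l.1).shiftMap_postcomp (resShift u l hl) (resHom f l)
  · funext j hj
    exact (F j.1).functor.map_comp _ _

theorem isIso_pi {ι : Type} {T : ι → TriCat.{u}} {X Y : ∀ j, T j} (f : X ⟶ Y)
    (h : ∀ j, IsIso (f j)) : IsIso f :=
  ⟨⟨fun j => inv (f j), by funext j; exact IsIso.hom_inv_id (f j),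
    by funext j; exact IsIso.inv_hom_id (f j)⟩⟩

/-- The composite of a multiexact functor `G` with the family of multiexact functors `F`. -/
@[simps]
def MultiExact.comp {V : TriCat.{u}} (G : MultiExact (fun j : {j // q j} => T j.1) V) :
    MultiExact (fun i : {i // q (φ i)} => S i.1) V where
  functor := imageFunctor F q ⋙ G.functor
  shiftMap {i Z X} u := G.shiftMap (imageShift F u ⟨φ i.1, i.2⟩ rfl)
  shiftMap_precomp f u := by
    rw [imageShift_precomp, G.shiftMap_precomp]
    rfl
  shiftMap_postcomp u f := by
    rw [imageShift_postcomp, G.shiftMap_postcomp]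
    rfl
  isIso_shiftMap {i Z X} u hu hu' := by
    apply G.isIso_shiftMap
    · exact (F _).isIso_shiftMap _ hu (fun _ _ => hu' _ _)
    · intro j hj
      have : IsIso (fun i' => u.off ⟨i'.1, i'.2.symm ▸ j.2⟩
          (fun h => hj (Subtype.ext (i'.2.symm.trans ((congrArg (fun a => φ a.1) h))))) :
          resObj Z j ⟶ resObj X j) := isIso_pi _ fun _ => hu' _ _
      exact Functor.map_isIso (F j.1).functor _
  map_add i X Y f g h hi hoff := by
    apply G.map_add ⟨φ i.1, i.2⟩
    · exact (F _).map_add ⟨i.1, rfl⟩ _ _ _ hi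
        (fun j hj => hoff _ (fun h => hj (Subtype.ext (congrArg (·.1) h))))
    · intro j hj
      have hne : ∀ i' : {i' // φ i' = j.1},
          (⟨i'.1, i'.2.symm ▸ j.2⟩ : {i // q (φ i)}) ≠ i := fun i' h =>
        hj (Subtype.ext (i'.2.symm.trans (congrArg (fun a => φ a.1) h)))
      constructor
      · exact congrArg (F j.1).functor.map (funext fun i' => (hoff _ (hne i')).1)
      · exact congrArg (F j.1).functor.map (funext fun i' => (hoff _ (hne i')).2)
  map_dist d := G.map_dist (image_dist F d _ rfl)
  anticomm {i j} hij {W Y Z X} u v v' u' hi hj hk := by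
    by_cases hφ : φ i.1 = φ j.1
    · have hv : ∀ {Z X : ∀ i : {i // q (φ i)}, S i.1} (v : ShiftHom j Z X),
          G.shiftMap (imageShift F v ⟨φ j.1, j.2⟩ rfl) =
            G.shiftMap (imageShift F v ⟨φ i.1, i.2⟩ hφ.symm) := by
        intro Z X v
        have : ∀ (l : {j // q j}) (hl : φ j.1 = l.1),
            G.shiftMap (imageShift F v ⟨φ j.1, j.2⟩ rfl) = G.shiftMap (imageShift F v l hl) := by
          rintro ⟨l, hl'⟩ hl
          dsimp only at hl
          subst hl
          rfl
        exact this _ _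
      rw [hv, hv]
      apply G.anticomm_self
      · exact (F _).anticomm (i := ⟨i.1, rfl⟩) (j := ⟨j.1, hφ.symm⟩)
          (fun h => hij (Subtype.ext (congrArg (·.1) h))) _ _ _ _ hi hj
          (fun k h₁ h₂ => hk _ _ _)
      · intro k hk'
        change (F k.1).functor.map _ ≫ (F k.1).functor.map _ =
          (F k.1).functor.map _ ≫ (F k.1).functor.map _
        rw [← Functor.map_comp, ← Functor.map_comp]
        exact congrArg (F k.1).functor.map
          (funext fun i' => hk ⟨i'.1, i'.2.symm ▸ k.2⟩ _ _)
    · apply G.anticomm (fun h => hφ (congrArg (·.1) h))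
      · change (F (φ i.1)).shiftMap _ ≫ ((F (φ i.1)).functor.map _)⟦(1 : ℤ)⟧' =
          (F (φ i.1)).functor.map _ ≫ (F (φ i.1)).shiftMap _
        rw [← MultiExact.shiftMap_postcomp, ← MultiExact.shiftMap_precomp]
        congr 1
        apply ShiftHom.ext
        · exact hi
        · funext k hk'
          exact hk _ _ _
      · change (F (φ j.1)).functor.map _ ≫ (F (φ j.1)).shiftMap _ =
          (F (φ j.1)).shiftMap _ ≫ ((F (φ j.1)).functor.map _)⟦(1 : ℤ)⟧'
        rw [← MultiExact.shiftMap_postcomp, ← MultiExact.shiftMap_precomp]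
        congr 1
        apply ShiftHom.ext
        · exact hj
        · funext k hk'
          exact hk _ _ _
      · intro k h₁ h₂
        change (F k.1).functor.map _ ≫ (F k.1).functor.map _ =
          (F k.1).functor.map _ ≫ (F k.1).functor.map _
        rw [← Functor.map_comp, ← Functor.map_comp]
        exact congrArg (F k.1).functor.map
          (funext fun i' => hk ⟨i'.1, i'.2.symm ▸ k.2⟩ _ _)

end Comp

section Verdier

theorem hom_ext_off {ι : Type} {T : ι → TriCat.{u}} {l : ι} {X Y : ∀ j, T j} {f g : X ⟶ Y}
    (h : f l = g l) (hf : ∀ j, j ≠ l → ∃ e : X j = Y j, f j = eqToHom e)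
    (hg : ∀ j, j ≠ l → ∃ e : X j = Y j, g j = eqToHom e) : f = g := by
  funext j
  by_cases hj : j = l
  · subst hj
    exact h
  · obtain ⟨_, h₁⟩ := hf j hj
    obtain ⟨_, h₂⟩ := hg j hj
    rw [h₁, h₂]

theorem shiftHom_ext_off {ι : Type} {T : ι → TriCat.{u}} {l : ι} {X Y : ∀ j, T j}
    {f g : ShiftHom l X Y} (h : f.self = g.self)
    (hf : ∀ j hj, ∃ e : X j = Y j, f.off j hj = eqToHom e)
    (hg : ∀ j hj, ∃ e : X j = Y j, g.off j hj = eqToHom e) : f = g := by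
  apply ShiftHom.ext
  · exact h
  · funext j hj
    obtain ⟨_, h₁⟩ := hf j hj
    obtain ⟨_, h₂⟩ := hg j hj
    rw [h₁, h₂]

theorem exists_eqToHom_comp {C : TriCat.{u}} {X Y Z : C} {f : X ⟶ Y} {g : Y ⟶ Z}
    (hf : ∃ e : X = Y, f = eqToHom e) (hg : ∃ e : Y = Z, g = eqToHom e) :
    ∃ e : X = Z, f ≫ g = eqToHom e := by
  obtain ⟨e, rfl⟩ := hf
  obtain ⟨e', rfl⟩ := hg
  exact ⟨e.trans e', by simp⟩

/-- A nine-term diagram in the single variable `l`, the other variables being held fixed. -/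
structure NineAt {ι : Type} (T : ι → TriCat.{u}) (l : ι) where
  {x' y' z' x y z x'' y'' z'' : ∀ k, T k}
  f' : x' ⟶ y'
  g' : y' ⟶ z'
  h' : ShiftHom l z' x'
  f : x ⟶ y
  g : y ⟶ z
  h : ShiftHom l z x
  f'' : x'' ⟶ y''
  g'' : y'' ⟶ z''
  h'' : ShiftHom l z'' x''
  p' : x' ⟶ x
  p : x ⟶ x''
  p'' : ShiftHom l x'' x'
  q' : y' ⟶ y
  q : y ⟶ y''
  q'' : ShiftHom l y'' y'
  r' : z' ⟶ z
  r : z ⟶ z''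
  r'' : ShiftHom l z'' z'
  row' : IsDistTri l f' g' h'
  row : IsDistTri l f g h
  row'' : IsDistTri l f'' g'' h''
  colx : IsDistTri l p' p p''
  coly : IsDistTri l q' q q''
  colz : IsDistTri l r' r r''
  comm_f' : f' ≫ q' = p' ≫ f
  comm_g' : g' ≫ r' = q' ≫ g
  comm_h' : h'.postcomp p' = h.precomp r'
  comm_f : f ≫ q = p ≫ f''
  comm_g : g ≫ r = q ≫ g''
  comm_h : h.postcomp p = h''.precomp r
  comm_f'' : q''.precomp f'' = p''.postcomp f'
  comm_g'' : r''.precomp g'' = q''.postcomp g'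
  anticomm_h'' : h''.self ≫ p''.self⟦(1 : ℤ)⟧' = -(r''.self ≫ h'.self⟦(1 : ℤ)⟧')
  comm_h''_off : ∀ k hk, h''.off k hk ≫ p''.off k hk = r''.off k hk ≫ h'.off k hk

variable {ι : Type} {T : ι → TriCat.{u}} {l : ι}

/-- The `l`-th entry of a nine-term diagram in the variable `l`. -/
@[simps]
def NineAt.eval (d : NineAt T l) : NineDiagram (T l) where
  f' := d.f' l
  g' := d.g' l
  h' := d.h'.self
  f := d.f l
  g := d.g l
  h := d.h.self
  f'' := d.f'' l
  g'' := d.g'' l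
  h'' := d.h''.self
  p' := d.p' l
  p := d.p l
  p'' := d.p''.self
  q' := d.q' l
  q := d.q l
  q'' := d.q''.self
  r' := d.r' l
  r := d.r l
  r'' := d.r''.self
  row' := d.row'.dist
  row := d.row.dist
  row'' := d.row''.dist
  colx := d.colx.dist
  coly := d.coly.dist
  colz := d.colz.dist
  comm_f' := congrFun d.comm_f' l
  comm_g' := congrFun d.comm_g' l
  comm_h' := congrArg ShiftHom.self d.comm_h'
  comm_f := congrFun d.comm_f l
  comm_g := congrFun d.comm_g l
  comm_h := congrArg ShiftHom.self d.comm_h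
  comm_f'' := congrArg ShiftHom.self d.comm_f''
  comm_g'' := congrArg ShiftHom.self d.comm_g''
  anticomm_h'' := d.anticomm_h''

/-- The image under a multiexact functor of a nine-term diagram in the variable `l`. -/
@[simps]
def MultiExact.nineAt {S : TriCat.{u}} (F : MultiExact T S) (d : NineAt T l) : NineDiagram S where
  f' := F.functor.map d.f'
  g' := F.functor.map d.g'
  h' := F.shiftMap d.h'
  f := F.functor.map d.f
  g := F.functor.map d.g
  h := F.shiftMap d.h
  f'' := F.functor.map d.f''
  g'' := F.functor.map d.g''
  h'' := F.shiftMap d.h''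
  p' := F.functor.map d.p'
  p := F.functor.map d.p
  p'' := F.shiftMap d.p''
  q' := F.functor.map d.q'
  q := F.functor.map d.q
  q'' := F.shiftMap d.q''
  r' := F.functor.map d.r'
  r := F.functor.map d.r
  r'' := F.shiftMap d.r''
  row' := F.map_dist d.row'
  row := F.map_dist d.row
  row'' := F.map_dist d.row''
  colx := F.map_dist d.colx
  coly := F.map_dist d.coly
  colz := F.map_dist d.colz
  comm_f' := by rw [← F.functor.map_comp, d.comm_f', F.functor.map_comp]
  comm_g' := by rw [← F.functor.map_comp, d.comm_g', F.functor.map_comp]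
  comm_h' := by rw [← F.shiftMap_postcomp, d.comm_h', F.shiftMap_precomp]
  comm_f := by rw [← F.functor.map_comp, d.comm_f, F.functor.map_comp]
  comm_g := by rw [← F.functor.map_comp, d.comm_g, F.functor.map_comp]
  comm_h := by rw [← F.shiftMap_postcomp, d.comm_h, F.shiftMap_precomp]
  comm_f'' := by rw [← F.shiftMap_postcomp, ← d.comm_f'', F.shiftMap_precomp]
  comm_g'' := by rw [← F.shiftMap_postcomp, ← d.comm_g'', F.shiftMap_precomp]
  anticomm_h'' := F.anticomm_self _ _ _ _ d.anticomm_h'' d.comm_h''_off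

/-- Multiexact functors preserve Verdier structures in each variable. -/
theorem MultiExact.nonempty_verdierStructure {S : TriCat.{u}} (F : MultiExact T S)
    (d : NineAt T l) (s : VerdierStructure d.eval) : Nonempty (VerdierStructure (F.nineAt d)) := by
  obtain ⟨A, α, v, dist, o₁, o₂, εγ, βη, o₃, o₃_m₁, o₃_m₃⟩ := s
  obtain ⟨Y, rfl, hY⟩ := exists_obj l d.y A
  have xy : ∀ j, j ≠ l → d.x j = d.y j := fun j hj => (d.row.f_off j hj).1
  have yz : ∀ j, j ≠ l → d.y j = d.z j := fun j hj => (d.row.g_off j hj).1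
  have xx' : ∀ j, j ≠ l → d.x' j = d.x j := fun j hj => (d.colx.f_off j hj).1
  have xx'' : ∀ j, j ≠ l → d.x j = d.x'' j := fun j hj => (d.colx.g_off j hj).1
  have yy' : ∀ j, j ≠ l → d.y' j = d.y j := fun j hj => (d.coly.f_off j hj).1
  have yy'' : ∀ j, j ≠ l → d.y j = d.y'' j := fun j hj => (d.coly.g_off j hj).1
  have zz' : ∀ j, j ≠ l → d.z' j = d.z j := fun j hj => (d.colz.f_off j hj).1
  obtain ⟨a, ha, ha'⟩ := exists_hom (X := d.y) (Y := Y) hY α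
  obtain ⟨ε, hε, hε'⟩ := exists_hom (X := d.x'') (Y := Y)
    (fun j hj => ((xx'' j hj).symm.trans (xy j hj)).trans (hY j hj)) o₁.m₁
  obtain ⟨η, hη, hη'⟩ := exists_hom (X := Y) (Y := d.z)
    (fun j hj => (hY j hj).symm.trans (yz j hj)) o₁.m₃
  obtain ⟨β, hβ, hβ'⟩ := exists_hom (X := d.z') (Y := Y)
    (fun j hj => ((zz' j hj).trans (yz j hj).symm).trans (hY j hj)) o₂.m₁
  obtain ⟨γ, hγ, hγ'⟩ := exists_hom (X := Y) (Y := d.y'')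
    (fun j hj => (hY j hj).symm.trans (yy'' j hj)) o₂.m₃
  have hw : ∀ j, j ≠ l → Y j = d.x' j := fun j hj =>
    ((hY j hj).symm.trans (xy j hj).symm).trans (xx' j hj).symm
  let w : ShiftHom l Y d.x' := ⟨v, fun j hj => eqToHom (hw j hj)⟩
  have hw' : ∀ j hj, ∃ e : Y j = d.x' j, w.off j hj = eqToHom e := fun j hj => ⟨hw j hj, rfl⟩
  have hA : IsDistTri l (d.p' ≫ d.f) a w :=
    { dist := by rw [ha]; exact dist
      f_off := fun j hj => exists_eqToHom_comp (d.colx.f_off j hj) (d.row.f_off j hj)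
      g_off := ha'
      h_off := hw' }
  have hε₁ : IsDistTri l ε η (d.h.postcomp d.p) :=
    { dist := by rw [hε, hη]; exact o₁.mem
      f_off := hε'
      g_off := hη'
      h_off := fun j hj => exists_eqToHom_comp (d.row.h_off j hj) (d.colx.g_off j hj) }
  have hβ₁ : IsDistTri l β γ (d.q''.postcomp d.g') :=
    { dist := by rw [hβ, hγ]; exact o₂.mem
      f_off := hβ'
      g_off := hγ'
      h_off := fun j hj => exists_eqToHom_comp (d.coly.h_off j hj) (d.row'.g_off j hj) }
  have e₁ : F.functor.map ε ≫ F.functor.map γ = F.functor.map d.f'' := by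
    rw [← F.functor.map_comp]
    congr 1
    refine hom_ext_off ?_ (fun j hj => exists_eqToHom_comp (hε' j hj) (hγ' j hj)) d.row''.f_off
    rw [Pi.comp_apply, hε, hγ]
    exact εγ
  have e₂ : F.functor.map β ≫ F.functor.map η = F.functor.map d.r' := by
    rw [← F.functor.map_comp]
    congr 1
    refine hom_ext_off ?_ (fun j hj => exists_eqToHom_comp (hβ' j hj) (hη' j hj)) d.colz.f_off
    rw [Pi.comp_apply, hβ, hη]
    exact βη
  refine ⟨{
    A := F.functor.obj Y
    α := F.functor.map a
    v := F.shiftMap w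
    dist := by
      have := F.map_dist hA
      rw [F.functor.map_comp] at this
      exact this
    o₁ :=
      { m₁ := F.functor.map ε
        m₃ := F.functor.map η
        comm₁ := ?_
        comm₂ := ?_
        comm₃ := ?_
        comm₄ := ?_
        mem := ?_ }
    o₂ :=
      { m₁ := F.functor.map β
        m₃ := F.functor.map γ
        comm₁ := ?_
        comm₂ := ?_
        comm₃ := ?_
        comm₄ := ?_
        mem := ?_ }
    εγ := e₁
    βη := e₂
    o₃ :=
      { m₁ := F.functor.map d.r
        m₃ := F.shiftMap d.r''
        comm₁ := ?_
        comm₂ := (F.nineAt d).comm_h.symm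
        comm₃ := (F.nineAt d).comm_g''
        comm₄ := ?_
        mem := ?_ }
    o₃_m₁ := rfl
    o₃_m₃ := rfl }⟩
  · change F.functor.map d.p ≫ F.functor.map ε = F.functor.map d.f ≫ F.functor.map a
    rw [← F.functor.map_comp, ← F.functor.map_comp]
    congr 1
    refine hom_ext_off ?_ (fun j hj => exists_eqToHom_comp (d.colx.g_off j hj) (hε' j hj))
      (fun j hj => exists_eqToHom_comp (d.row.f_off j hj) (ha' j hj))
    rw [Pi.comp_apply, Pi.comp_apply, hε, ha]
    exact o₁.comm₁
  · change F.functor.map ε ≫ F.shiftMap w = F.shiftMap d.p''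
    rw [← F.shiftMap_precomp]
    congr 1
    refine shiftHom_ext_off ?_ (fun j hj => exists_eqToHom_comp (hε' j hj) (hw' j hj)) d.colx.h_off
    rw [ShiftHom.precomp_self, hε]
    exact o₁.comm₂
  · change F.functor.map a ≫ F.functor.map η = F.functor.map d.g
    rw [← F.functor.map_comp]
    congr 1
    refine hom_ext_off ?_ (fun j hj => exists_eqToHom_comp (ha' j hj) (hη' j hj)) d.row.g_off
    rw [Pi.comp_apply, ha, hη]
    exact o₁.comm₃
  · change F.shiftMap w ≫ (F.functor.map d.p')⟦(1 : ℤ)⟧' = F.functor.map η ≫ F.shiftMap d.h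
    rw [← F.shiftMap_postcomp, ← F.shiftMap_precomp]
    congr 1
    refine shiftHom_ext_off ?_ (fun j hj => exists_eqToHom_comp (hw' j hj) (d.colx.f_off j hj))
      (fun j hj => exists_eqToHom_comp (hη' j hj) (d.row.h_off j hj))
    rw [ShiftHom.precomp_self, hη]
    exact o₁.comm₄
  · have := F.map_dist hε₁
    rw [F.shiftMap_postcomp] at this
    exact this
  · change F.functor.map d.g' ≫ F.functor.map β = F.functor.map d.q' ≫ F.functor.map a
    rw [← F.functor.map_comp, ← F.functor.map_comp]
    congr 1
    refine hom_ext_off ?_ (fun j hj => exists_eqToHom_comp (d.row'.g_off j hj) (hβ' j hj))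
      (fun j hj => exists_eqToHom_comp (d.coly.f_off j hj) (ha' j hj))
    rw [Pi.comp_apply, Pi.comp_apply, hβ, ha]
    exact o₂.comm₁
  · change F.functor.map β ≫ F.shiftMap w = F.shiftMap d.h'
    rw [← F.shiftMap_precomp]
    congr 1
    refine shiftHom_ext_off ?_ (fun j hj => exists_eqToHom_comp (hβ' j hj) (hw' j hj)) d.row'.h_off
    rw [ShiftHom.precomp_self, hβ]
    exact o₂.comm₂
  · change F.functor.map a ≫ F.functor.map γ = F.functor.map d.q
    rw [← F.functor.map_comp]
    congr 1
    refine hom_ext_off ?_ (fun j hj => exists_eqToHom_comp (ha' j hj) (hγ' j hj)) d.coly.g_off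
    rw [Pi.comp_apply, ha, hγ]
    exact o₂.comm₃
  · change F.shiftMap w ≫ (F.functor.map d.f')⟦(1 : ℤ)⟧' = F.functor.map γ ≫ F.shiftMap d.q''
    rw [← F.shiftMap_postcomp, ← F.shiftMap_precomp]
    congr 1
    refine shiftHom_ext_off ?_ (fun j hj => exists_eqToHom_comp (hw' j hj) (d.row'.f_off j hj))
      (fun j hj => exists_eqToHom_comp (hγ' j hj) (d.coly.h_off j hj))
    rw [ShiftHom.precomp_self, hγ]
    exact o₂.comm₄
  · have := F.map_dist hβ₁
    rw [F.shiftMap_postcomp] at this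
    exact this
  · change F.functor.map η ≫ F.functor.map d.r = F.functor.map γ ≫ F.functor.map d.g''
    rw [← F.functor.map_comp, ← F.functor.map_comp]
    congr 1
    refine hom_ext_off ?_ (fun j hj => exists_eqToHom_comp (hη' j hj) (d.colz.g_off j hj))
      (fun j hj => exists_eqToHom_comp (hγ' j hj) (d.row''.g_off j hj))
    rw [Pi.comp_apply, Pi.comp_apply, hη, hγ]
    have := o₃.comm₁
    rw [o₃_m₁] at this
    exact this
  · change F.shiftMap d.h'' ≫ (F.functor.map ε)⟦(1 : ℤ)⟧' =
      F.shiftMap d.r'' ≫ (-(F.functor.map β)⟦(1 : ℤ)⟧')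
    rw [Preadditive.comp_neg, ← F.shiftMap_postcomp, ← F.shiftMap_postcomp]
    apply F.shiftMap_eq_neg
    · rw [ShiftHom.postcomp_self, ShiftHom.postcomp_self, hε, hβ]
      have := o₃.comm₄
      rw [o₃_m₃] at this
      exact this.trans (Preadditive.comp_neg _ _)
    · intro j hj
      obtain ⟨_, h₁⟩ := exists_eqToHom_comp (d.row''.h_off j hj) (hε' j hj)
      obtain ⟨_, h₂⟩ := exists_eqToHom_comp (d.colz.h_off j hj) (hβ' j hj)
      exact h₁.trans h₂.symm
  · have h₁ := rot_of_distTriang _ (F.nineAt d).colz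
    have h₂ : (-(F.functor.map β)⟦(1 : ℤ)⟧') ≫ (F.functor.map η)⟦(1 : ℤ)⟧' =
        -(F.functor.map d.r')⟦(1 : ℤ)⟧' := by
      rw [Preadditive.neg_comp, ← Functor.map_comp, e₂]
    change Triangle.mk (F.functor.map d.r) (F.shiftMap d.r'')
      ((-(F.functor.map β)⟦(1 : ℤ)⟧') ≫ (F.functor.map η)⟦(1 : ℤ)⟧') ∈ _
    rw [h₂]
    exact h₁

end Verdier

section CompVerdier

variable {ι κ : Type} {S : ι → TriCat.{u}} {T : κ → TriCat.{u}} {φ : ι → κ}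
  (F : ∀ j, MultiExact (fun i : {i // φ i = j} => S i.1) (T j)) {q : κ → Prop}

theorem comp_shiftMap_eq {V : TriCat.{u}} (G : MultiExact (fun j : {j // q j} => T j.1) V)
    {j : {i // q (φ i)}} {Z X : ∀ i : {i // q (φ i)}, S i.1} (v : ShiftHom j Z X)
    (l : {j // q j}) (hl : φ j.1 = l.1) :
    (G.comp F).shiftMap v = G.shiftMap (imageShift F v l hl) := by
  obtain ⟨l, hl'⟩ := l
  dsimp only at hl
  subst hl
  rfl

/-- The image of a grid under the family `F`, when its two variables go to different ones. -/
def imageGrid {i j : {i // q (φ i)}} {hij : i ≠ j} (d : Grid (fun i : {i // q (φ i)} => S i.1) i j hij)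
    (hφ : (⟨φ i.1, i.2⟩ : {j // q j}) ≠ ⟨φ j.1, j.2⟩) :
    Grid (fun j : {j // q j} => T j.1) ⟨φ i.1, i.2⟩ ⟨φ j.1, j.2⟩ hφ where
  f' := (imageFunctor F q).map d.f'
  g' := (imageFunctor F q).map d.g'
  h' := imageShift F d.h' ⟨φ i.1, i.2⟩ rfl
  f := (imageFunctor F q).map d.f
  g := (imageFunctor F q).map d.g
  h := imageShift F d.h ⟨φ i.1, i.2⟩ rfl
  f'' := (imageFunctor F q).map d.f''
  g'' := (imageFunctor F q).map d.g''
  h'' := imageShift F d.h'' ⟨φ i.1, i.2⟩ rfl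
  p' := (imageFunctor F q).map d.p'
  p := (imageFunctor F q).map d.p
  p'' := imageShift F d.p'' ⟨φ j.1, j.2⟩ rfl
  q' := (imageFunctor F q).map d.q'
  q := (imageFunctor F q).map d.q
  q'' := imageShift F d.q'' ⟨φ j.1, j.2⟩ rfl
  r' := (imageFunctor F q).map d.r'
  r := (imageFunctor F q).map d.r
  r'' := imageShift F d.r'' ⟨φ j.1, j.2⟩ rfl
  row' := image_dist F d.row' _ _
  row := image_dist F d.row _ _
  row'' := image_dist F d.row'' _ _
  colx := image_dist F d.colx _ _
  coly := image_dist F d.coly _ _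
  colz := image_dist F d.colz _ _
  comm_f' := by rw [← Functor.map_comp, ← Functor.map_comp, d.comm_f']
  comm_g' := by rw [← Functor.map_comp, ← Functor.map_comp, d.comm_g']
  comm_h' := by rw [← imageShift_postcomp, ← imageShift_precomp, d.comm_h']
  comm_f := by rw [← Functor.map_comp, ← Functor.map_comp, d.comm_f]
  comm_g := by rw [← Functor.map_comp, ← Functor.map_comp, d.comm_g]
  comm_h := by rw [← imageShift_postcomp, ← imageShift_precomp, d.comm_h]
  comm_f'' := by rw [← imageShift_postcomp, ← imageShift_precomp, d.comm_f'']
  comm_g'' := by rw [← imageShift_postcomp, ← imageShift_precomp, d.comm_g'']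
  comm_h''_i := by
    change (F (φ i.1)).shiftMap _ ≫ ((F (φ i.1)).functor.map _)⟦(1 : ℤ)⟧' =
      (F (φ i.1)).functor.map _ ≫ (F (φ i.1)).shiftMap _
    rw [← MultiExact.shiftMap_postcomp, ← MultiExact.shiftMap_precomp]
    congr 1
    apply ShiftHom.ext
    · exact d.comm_h''_i
    · funext k hk'
      exact d.comm_h''_off _ _ _
  comm_h''_j := by
    change (F (φ j.1)).functor.map _ ≫ (F (φ j.1)).shiftMap _ =
      (F (φ j.1)).shiftMap _ ≫ ((F (φ j.1)).functor.map _)⟦(1 : ℤ)⟧'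
    rw [← MultiExact.shiftMap_postcomp, ← MultiExact.shiftMap_precomp]
    congr 1
    apply ShiftHom.ext
    · exact d.comm_h''_j
    · funext k hk'
      exact d.comm_h''_off _ _ _
  comm_h''_off k h₁ h₂ := by
    change (F k.1).functor.map _ ≫ (F k.1).functor.map _ =
      (F k.1).functor.map _ ≫ (F k.1).functor.map _
    rw [← Functor.map_comp, ← Functor.map_comp]
    exact congrArg (F k.1).functor.map
      (funext fun i' => d.comm_h''_off ⟨i'.1, i'.2.symm ▸ k.2⟩ _ _)

/-- The restriction of a grid to a fibre of `φ` containing both of its variables. -/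
def resGrid {i j : {i // q (φ i)}} {hij : i ≠ j} (d : Grid (fun i : {i // q (φ i)} => S i.1) i j hij)
    (l : {j // q j}) (hi : φ i.1 = l.1) (hj : φ j.1 = l.1) :
    Grid (fun i : {i // φ i = l.1} => S i.1) ⟨i.1, hi⟩ ⟨j.1, hj⟩
      (fun h => hij (Subtype.ext (congrArg (·.1) h))) where
  f' := resHom d.f' l
  g' := resHom d.g' l
  h' := resShift d.h' l hi
  f := resHom d.f l
  g := resHom d.g l
  h := resShift d.h l hi
  f'' := resHom d.f'' l
  g'' := resHom d.g'' l
  h'' := resShift d.h'' l hi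
  p' := resHom d.p' l
  p := resHom d.p l
  p'' := resShift d.p'' l hj
  q' := resHom d.q' l
  q := resHom d.q l
  q'' := resShift d.q'' l hj
  r' := resHom d.r' l
  r := resHom d.r l
  r'' := resShift d.r'' l hj
  row' := res_dist d.row' l hi
  row := res_dist d.row l hi
  row'' := res_dist d.row'' l hi
  colx := res_dist d.colx l hj
  coly := res_dist d.coly l hj
  colz := res_dist d.colz l hj
  comm_f' := congrArg (resHom · l) d.comm_f'
  comm_g' := congrArg (resHom · l) d.comm_g'
  comm_h' := congrArg (resShift · l hi) d.comm_h'
  comm_f := congrArg (resHom · l) d.comm_f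
  comm_g := congrArg (resHom · l) d.comm_g
  comm_h := congrArg (resShift · l hi) d.comm_h
  comm_f'' := congrArg (resShift · l hj) d.comm_f''
  comm_g'' := congrArg (resShift · l hj) d.comm_g''
  comm_h''_i := d.comm_h''_i
  comm_h''_j := d.comm_h''_j
  comm_h''_off k h₁ h₂ := d.comm_h''_off _ _ _

/-- The image of a grid under the family `F`, when its two variables go to the same one. -/
def imageNineAt {i j : {i // q (φ i)}} {hij : i ≠ j}
    (d : Grid (fun i : {i // q (φ i)} => S i.1) i j hij)
    (l : {j // q j}) (hi : φ i.1 = l.1) (hj : φ j.1 = l.1) :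
    NineAt (fun j : {j // q j} => T j.1) l where
  f' := (imageFunctor F q).map d.f'
  g' := (imageFunctor F q).map d.g'
  h' := imageShift F d.h' l hi
  f := (imageFunctor F q).map d.f
  g := (imageFunctor F q).map d.g
  h := imageShift F d.h l hi
  f'' := (imageFunctor F q).map d.f''
  g'' := (imageFunctor F q).map d.g''
  h'' := imageShift F d.h'' l hi
  p' := (imageFunctor F q).map d.p'
  p := (imageFunctor F q).map d.p
  p'' := imageShift F d.p'' l hj
  q' := (imageFunctor F q).map d.q'
  q := (imageFunctor F q).map d.q
  q'' := imageShift F d.q'' l hj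
  r' := (imageFunctor F q).map d.r'
  r := (imageFunctor F q).map d.r
  r'' := imageShift F d.r'' l hj
  row' := image_dist F d.row' _ _
  row := image_dist F d.row _ _
  row'' := image_dist F d.row'' _ _
  colx := image_dist F d.colx _ _
  coly := image_dist F d.coly _ _
  colz := image_dist F d.colz _ _
  comm_f' := by rw [← Functor.map_comp, ← Functor.map_comp, d.comm_f']
  comm_g' := by rw [← Functor.map_comp, ← Functor.map_comp, d.comm_g']
  comm_h' := by rw [← imageShift_postcomp, ← imageShift_precomp, d.comm_h']
  comm_f := by rw [← Functor.map_comp, ← Functor.map_comp, d.comm_f]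
  comm_g := by rw [← Functor.map_comp, ← Functor.map_comp, d.comm_g]
  comm_h := by rw [← imageShift_postcomp, ← imageShift_precomp, d.comm_h]
  comm_f'' := by rw [← imageShift_postcomp, ← imageShift_precomp, d.comm_f'']
  comm_g'' := by rw [← imageShift_postcomp, ← imageShift_precomp, d.comm_g'']
  anticomm_h'' := ((F l.1).nine (resGrid d l hi hj)).anticomm_h''
  comm_h''_off k hk := by
    change (F k.1).functor.map _ ≫ (F k.1).functor.map _ =
      (F k.1).functor.map _ ≫ (F k.1).functor.map _
    rw [← Functor.map_comp, ← Functor.map_comp]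
    exact congrArg (F k.1).functor.map
      (funext fun i' => d.comm_h''_off ⟨i'.1, i'.2.symm ▸ k.2⟩ _ _)

/-- The transpose of a grid. -/
def Grid.transpose {i j : ι} {hij : i ≠ j} (d : Grid S i j hij) : Grid S j i hij.symm where
  f' := d.p'
  g' := d.p
  h' := d.p''
  f := d.q'
  g := d.q
  h := d.q''
  f'' := d.r'
  g'' := d.r
  h'' := d.r''
  p' := d.f'
  p := d.g'
  p'' := d.h'
  q' := d.f
  q := d.g
  q'' := d.h
  r' := d.f''
  r := d.g''
  r'' := d.h''
  row' := d.colx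
  row := d.coly
  row'' := d.colz
  colx := d.row'
  coly := d.row
  colz := d.row''
  comm_f' := d.comm_f'.symm
  comm_g' := d.comm_f.symm
  comm_h' := d.comm_f''.symm
  comm_f := d.comm_g'.symm
  comm_g := d.comm_g.symm
  comm_h := d.comm_g''.symm
  comm_f'' := d.comm_h'.symm
  comm_g'' := d.comm_h.symm
  comm_h''_i := d.comm_h''_j.symm
  comm_h''_j := d.comm_h''_i.symm
  comm_h''_off k hi hj := (d.comm_h''_off k hj hi).symm

theorem MultiExact.AdmitsVerdier.of_ne [LinearOrder ι] {V : TriCat.{u}} {G : MultiExact S V}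
    (hG : G.AdmitsVerdier) {i j : ι} (hij : i ≠ j) (d : Grid S i j hij) :
    Nonempty (VerdierStructure (G.nine d)) := by
  rcases lt_or_gt_of_ne hij with h | h
  · exact hG i j h d
  · exact (hG j i h d.transpose).map fun s => s.transpose

/-- Multiexact functors admitting Verdier structures are stable under composition. -/
theorem MultiExact.AdmitsVerdier.comp [LinearOrder ι] [LinearOrder κ] {V : TriCat.{u}}
    {G : MultiExact (fun j : {j // q j} => T j.1) V} (hG : G.AdmitsVerdier)
    (hF : ∀ j, (F j).AdmitsVerdier) : (G.comp F).AdmitsVerdier := by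
  intro i j hij d
  by_cases hφ : φ j.1 = φ i.1
  · obtain ⟨s⟩ := hF (φ i.1) ⟨i.1, rfl⟩ ⟨j.1, hφ⟩ hij (resGrid d ⟨φ i.1, i.2⟩ rfl hφ)
    have : (G.comp F).nine d = G.nineAt (imageNineAt F d ⟨φ i.1, i.2⟩ rfl hφ) := by
      have h₁ := comp_shiftMap_eq F G d.p'' ⟨φ i.1, i.2⟩ hφ
      have h₂ := comp_shiftMap_eq F G d.q'' ⟨φ i.1, i.2⟩ hφ
      have h₃ := comp_shiftMap_eq F G d.r'' ⟨φ i.1, i.2⟩ hφ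
      unfold MultiExact.nine MultiExact.nineAt
      congr 1
    rw [this]
    exact G.nonempty_verdierStructure _ s
  · exact hG.of_ne (fun h => hφ (congrArg (·.1) h).symm) (imageGrid F d _)

end CompVerdier

/-! ### Transformations and whiskering -/

section Whisker

variable {ι κ : Type} {S : ι → TriCat.{u}} {T : κ → TriCat.{u}} {φ : ι → κ}
  {F F' : ∀ j, MultiExact (fun i : {i // φ i = j} => S i.1) (T j)} {q : κ → Prop}

/-- The isomorphism of product functors induced by a family of transformations. -/
@[simps!]
def imageIso (a : ∀ j, F j ⟶ F' j) (q : κ → Prop) : imageFunctor F q ≅ imageFunctor F' q :=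
  NatIso.ofComponents (fun X => Pi.isoMk fun j => (a j.1).iso.app (resObj X j)) (by
    intro X Y f
    funext j
    exact (a j.1).iso.hom.naturality (resHom f j))

/-- Whiskering of a family of transformations with a multiexact functor. -/
@[simps]
def MultiExact.whiskerRight (a : ∀ j, F j ⟶ F' j) {V : TriCat.{u}}
    (G : MultiExact (fun j : {j // q j} => T j.1) V) : G.comp F ⟶ G.comp F' where
  iso := Functor.isoWhiskerRight (imageIso a q) G.functor
  shift {i Z X} u := by
    change G.shiftMap _ ≫ (G.functor.map _)⟦(1 : ℤ)⟧' = G.functor.map _ ≫ G.shiftMap _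
    rw [← G.shiftMap_postcomp, ← G.shiftMap_precomp]
    congr 1
    apply ShiftHom.ext
    · exact (a _).shift _
    · funext j hj
      exact (a j.1).iso.hom.naturality _

/-- Whiskering of a transformation with a family of multiexact functors. -/
@[simps]
def MultiExact.whiskerLeft (F : ∀ j, MultiExact (fun i : {i // φ i = j} => S i.1) (T j))
    {V : TriCat.{u}} {G G' : MultiExact (fun j : {j // q j} => T j.1) V} (b : G ⟶ G') :
    G.comp F ⟶ G'.comp F where
  iso := Functor.isoWhiskerLeft (imageFunctor F q) b.iso
  shift u := b.shift _

/-- The identity of a triangulated category, as a multiexact functor in one variable. -/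
@[simps functor]
def MultiExact.id (S : ι → TriCat.{u}) (j : ι) :
    MultiExact (fun i : {i // i = j} => S i.1) (S j) where
  functor := { obj := fun X => X ⟨j, rfl⟩, map := fun f => f ⟨j, rfl⟩ }
  shiftMap {i} Z X u := match i, u with
    | ⟨_, rfl⟩, u => u.self
  shiftMap_precomp {i} _ _ _ f u := by
    obtain ⟨i, rfl⟩ := i
    rfl
  shiftMap_postcomp {i} _ _ _ u f := by
    obtain ⟨i, rfl⟩ := i
    rfl
  isIso_shiftMap {i} _ _ u h _ := by
    obtain ⟨i, rfl⟩ := i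
    exact h
  map_add i _ _ f g h hi _ := by
    obtain ⟨i, rfl⟩ := i
    exact hi
  map_dist {i} _ _ _ f g h d := by
    obtain ⟨i, rfl⟩ := i
    exact d.dist
  anticomm {i j'} hij _ _ _ _ _ _ _ _ _ _ _ := by
    obtain ⟨i, rfl⟩ := i
    obtain ⟨i', rfl⟩ := j'
    exact (hij rfl).elim

end Whisker


/-! ### The bicategory of tuples of triangulated categories -/

/-- A finite list of triangulated categories. -/
structure TriTuple : Type (u + 1) where
  n : ℕ
  T : Fin n → TriCat.{u}

/-- A morphism of lists of triangulated categories: a map `φ` of the index sets, and for each `j`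
a multiexact functor admitting Verdier structures, with source the categories indexed by the fibre
of `φ` over `j`, and target the `j`-th category. -/
structure TupleHom (S T : TriTuple.{u}) where
  φ : Fin S.n → Fin T.n
  F : ∀ j, MultiExact (fun i : {i // φ i = j} => S.T i.1) (T.T j)
  verdier : ∀ j, (F j).AdmitsVerdier

/-- The 2-cells between morphisms with the same map `φ` of the index sets are the families of
transformations of multiexact functors; there are no 2-cells between the other morphisms. -/
inductive TupleHom₂ {S T : TriTuple.{u}} : TupleHom S T → TupleHom S T → Type u
  | mk {φ : Fin S.n → Fin T.n}
      {F F' : ∀ j, MultiExact (fun i : {i // φ i = j} => S.T i.1) (T.T j)}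
      {h : ∀ j, (F j).AdmitsVerdier} {h' : ∀ j, (F' j).AdmitsVerdier}
      (a : ∀ j, F j ⟶ F' j) : TupleHom₂ ⟨φ, F, h⟩ ⟨φ, F', h'⟩

instance (S T : TriTuple.{u}) : Category (TupleHom S T) where
  Hom f g := TupleHom₂ f g
  id f := .mk fun _ => 𝟙 _
  comp a b := match a, b with
    | .mk a, .mk b => .mk fun j => a j ≫ b j
  id_comp a := by
    obtain ⟨a⟩ := a
    exact congrArg TupleHom₂.mk (funext fun j => Category.id_comp _)
  comp_id a := by
    obtain ⟨a⟩ := a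
    exact congrArg TupleHom₂.mk (funext fun j => Category.comp_id _)
  assoc a b c := by
    obtain ⟨a⟩ := a
    obtain ⟨b⟩ := b
    obtain ⟨c⟩ := c
    exact congrArg TupleHom₂.mk (funext fun j => Category.assoc _ _ _)

/-- The identity of a list of triangulated categories. -/
@[simps]
def TupleHom.id (T : TriTuple.{u}) : TupleHom T T where
  φ := _root_.id
  F j := MultiExact.id T.T j
  verdier _ := by
    rintro ⟨i, rfl⟩ ⟨j, hj⟩ hij
    exact absurd (Subtype.ext hj.symm) hij.ne

/-- The composition of morphisms of lists of triangulated categories. -/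
@[simps]
def TupleHom.comp {S T U : TriTuple.{u}} (f : TupleHom S T) (g : TupleHom T U) :
    TupleHom S U where
  φ i := g.φ (f.φ i)
  F k := (g.F k).comp f.F
  verdier k := (g.verdier k).comp f.F f.verdier

instance : CategoryStruct TriTuple.{u} where
  Hom S T := TupleHom S T
  id T := TupleHom.id T
  comp f g := f.comp g

instance (S T : TriTuple.{u}) : Category (S ⟶ T) :=
  inferInstanceAs (Category (TupleHom S T))

/-- Left whiskering of 2-cells. -/
def TriTuple.whiskerLeft {S T U : TriTuple.{u}} (f : S ⟶ T) {g g' : T ⟶ U} (b : g ⟶ g') :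
    f ≫ g ⟶ f ≫ g' := match b with
  | .mk b => .mk fun k => MultiExact.whiskerLeft f.F (b k)

/-- Right whiskering of 2-cells. -/
def TriTuple.whiskerRight {S T U : TriTuple.{u}} {f f' : S ⟶ T} (a : f ⟶ f') (g : T ⟶ U) :
    f ≫ g ⟶ f' ≫ g := match a with
  | .mk a => .mk fun k => MultiExact.whiskerRight a (g.F k)

/-- The right unitor for multiexact functors. -/
@[simps]
def MultiExact.rightUnitor {ι κ : Type} {S : ι → TriCat.{u}} {T : κ → TriCat.{u}} {φ : ι → κ}
    (F : ∀ j, MultiExact (fun i : {i // φ i = j} => S i.1) (T j)) (k : κ) :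
    (MultiExact.id T k).comp F (q := fun j => j = k) ≅ F k where
  hom :=
    { iso := Iso.refl (F k).functor
      shift := by
        rintro ⟨i, rfl⟩ Z X u
        change (F (φ i)).shiftMap u ≫ (𝟙 ((F (φ i)).functor.obj X))⟦(1 : ℤ)⟧' =
          𝟙 _ ≫ (F (φ i)).shiftMap u
        simp }
  inv :=
    { iso := Iso.refl (F k).functor
      shift := by
        rintro ⟨i, rfl⟩ Z X u
        change (F (φ i)).shiftMap u ≫ (𝟙 ((F (φ i)).functor.obj X))⟦(1 : ℤ)⟧' =
          𝟙 _ ≫ (F (φ i)).shiftMap u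
        simp }
  hom_inv_id := MultiExact.hom_ext _ _ fun X => Category.comp_id _
  inv_hom_id := MultiExact.hom_ext _ _ fun X => Category.comp_id _

/-- The right unitor for morphisms of lists of triangulated categories. -/
@[simps]
def TupleHom.rightUnitor {S T : TriTuple.{u}} (f : TupleHom S T) :
    f.comp (TupleHom.id T) ≅ f where
  hom := .mk fun k => (MultiExact.rightUnitor f.F k).hom
  inv := .mk fun k => (MultiExact.rightUnitor f.F k).inv
  hom_inv_id := congrArg TupleHom₂.mk (funext fun k => (MultiExact.rightUnitor f.F k).hom_inv_id)
  inv_hom_id := congrArg TupleHom₂.mk (funext fun k => (MultiExact.rightUnitor f.F k).inv_hom_id)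

theorem TupleHom₂.mk_congr {S T : TriTuple.{u}} {φ : Fin S.n → Fin T.n}
    {F F' : ∀ j, MultiExact (fun i : {i // φ i = j} => S.T i.1) (T.T j)}
    {h : ∀ j, (F j).AdmitsVerdier} {h' : ∀ j, (F' j).AdmitsVerdier} {a b : ∀ j, F j ⟶ F' j}
    (hab : ∀ j X, (a j).iso.hom.app X = (b j).iso.hom.app X) :
    (TupleHom₂.mk a : TupleHom₂ ⟨φ, F, h⟩ ⟨φ, F', h'⟩) = TupleHom₂.mk b :=
  congrArg TupleHom₂.mk (funext fun j => MultiExact.hom_ext _ _ (hab j))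

/-- The bicategory of lists of triangulated categories. -/
instance : Bicategory TriTuple.{u} where
  homCategory S T := inferInstanceAs (Category (TupleHom S T))
  whiskerLeft := TriTuple.whiskerLeft
  whiskerRight := TriTuple.whiskerRight
  associator f g h := Iso.refl (f ≫ g ≫ h)
  leftUnitor f := Iso.refl f
  rightUnitor f := TupleHom.rightUnitor f
  whiskerLeft_id f g := TupleHom₂.mk_congr fun j X => rfl
  whiskerLeft_comp f _ _ _ a b := by
    obtain ⟨a⟩ := a
    obtain ⟨b⟩ := b
    exact TupleHom₂.mk_congr fun j X => rfl
  id_whiskerLeft a := by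
    obtain ⟨a⟩ := a
    exact TupleHom₂.mk_congr fun j X => ((Category.id_comp _).trans (Category.comp_id _)).symm
  comp_whiskerLeft f g _ _ a := by
    obtain ⟨a⟩ := a
    exact TupleHom₂.mk_congr fun j X => ((Category.id_comp _).trans (Category.comp_id _)).symm
  id_whiskerRight f g := TupleHom₂.mk_congr fun j X => (g.F j).functor.map_id _
  comp_whiskerRight a b g := by
    obtain ⟨a⟩ := a
    obtain ⟨b⟩ := b
    exact TupleHom₂.mk_congr fun j X => (g.F j).functor.map_comp _ _
  whiskerRight_id a := by
    obtain ⟨a⟩ := a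
    exact TupleHom₂.mk_congr fun j X => ((Category.id_comp _).trans (Category.comp_id _)).symm
  whiskerRight_comp a g h := by
    obtain ⟨a⟩ := a
    exact TupleHom₂.mk_congr fun j X => ((Category.id_comp _).trans (Category.comp_id _)).symm
  whisker_assoc f _ _ a h := by
    obtain ⟨a⟩ := a
    exact TupleHom₂.mk_congr fun j X => ((Category.id_comp _).trans (Category.comp_id _)).symm
  whisker_exchange a b := by
    obtain ⟨a⟩ := a
    obtain ⟨b⟩ := b
    exact TupleHom₂.mk_congr fun j X => ((b j).iso.hom.naturality _).symm
  pentagon f g h i := TupleHom₂.mk_congr fun j X =>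
    ((congrArg (fun t => t ≫ 𝟙 _ ≫ 𝟙 _) ((i.F j).functor.map_id _)).trans (Category.id_comp _))
  triangle f g := TupleHom₂.mk_congr fun j X =>
    (Category.id_comp _).trans ((g.F j).functor.map_id _).symm

/-! ### The bicategory of Picard groupoids -/

/-- A Picard groupoid: a symmetric monoidal groupoid in which tensoring with any object is an
equivalence. -/
structure PicGpd : Type (max (v + 1) (w + 1)) where
  carrier : Type w
  [cat : Category.{v} carrier]
  [groupoid : IsGroupoid carrier]
  [monoidal : MonoidalCategory carrier]
  [symmetric : SymmetricCategory carrier]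
  [isEquivalence : ∀ x : carrier, (tensorLeft x).IsEquivalence]

instance : CoeSort PicGpd.{v, w} (Type w) := ⟨PicGpd.carrier⟩

attribute [instance] PicGpd.cat PicGpd.groupoid PicGpd.monoidal PicGpd.symmetric
  PicGpd.isEquivalence

/-- A morphism of Picard groupoids: a symmetric monoidal functor. -/
structure PicHom (P Q : PicGpd.{v, w}) where
  functor : P ⥤ Q
  [braided : functor.Braided]

attribute [instance] PicHom.braided

/-- A 2-morphism of Picard groupoids: a monoidal natural transformation. -/
@[ext]
structure PicHom₂ {P Q : PicGpd.{v, w}} (F G : PicHom P Q) where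
  natTrans : F.functor ⟶ G.functor
  [isMonoidal : NatTrans.IsMonoidal natTrans]

attribute [instance] PicHom₂.isMonoidal

@[simps]
instance (P Q : PicGpd.{v, w}) : Category (PicHom P Q) where
  Hom F G := PicHom₂ F G
  id F := { natTrans := 𝟙 F.functor }
  comp a b := { natTrans := a.natTrans ≫ b.natTrans }

@[simps]
instance : CategoryStruct PicGpd.{v, w} where
  Hom P Q := PicHom P Q
  id P := { functor := 𝟭 P }
  comp F G := { functor := F.functor ⋙ G.functor }

/-- The 2-isomorphism given by a monoidal natural isomorphism. -/
@[simps]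
def PicHom₂.isoMk {P Q : PicGpd.{v, w}} {F G : PicHom P Q} (e : F.functor ≅ G.functor)
    [NatTrans.IsMonoidal e.hom] : F ≅ G where
  hom := { natTrans := e.hom }
  inv := { natTrans := e.inv }
  hom_inv_id := PicHom₂.ext e.hom_inv_id
  inv_hom_id := PicHom₂.ext e.inv_hom_id

/-- The bicategory of Picard groupoids. -/
instance : Bicategory PicGpd.{v, w} where
  homCategory P Q := inferInstanceAs (Category (PicHom P Q))
  whiskerLeft F _ _ a := { natTrans := Functor.whiskerLeft F.functor a.natTrans }
  whiskerRight a G := { natTrans := Functor.whiskerRight a.natTrans G.functor }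
  associator F G H := PicHom₂.isoMk (Functor.associator F.functor G.functor H.functor)
  leftUnitor F := PicHom₂.isoMk F.functor.leftUnitor
  rightUnitor F := PicHom₂.isoMk F.functor.rightUnitor
  whiskerLeft_id F G := PicHom₂.ext (Functor.whiskerLeft_id _)
  whiskerLeft_comp F _ _ _ a b := PicHom₂.ext (Functor.whiskerLeft_comp _ _ _)
  id_whiskerLeft a := PicHom₂.ext (by ext; exact ((Category.id_comp _).trans (Category.comp_id _)).symm)
  comp_whiskerLeft F G _ _ a := PicHom₂.ext (by ext; exact ((Category.id_comp _).trans (Category.comp_id _)).symm)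
  id_whiskerRight F G := PicHom₂.ext (Functor.whiskerRight_id _)
  comp_whiskerRight a b G := PicHom₂.ext (Functor.whiskerRight_comp _ _ _)
  whiskerRight_id a := PicHom₂.ext (by ext; exact ((Category.id_comp _).trans (Category.comp_id _)).symm)
  whiskerRight_comp a G H := PicHom₂.ext (by ext; exact ((Category.id_comp _).trans (Category.comp_id _)).symm)
  whisker_assoc F _ _ a H := PicHom₂.ext (by ext; exact ((Category.id_comp _).trans (Category.comp_id _)).symm)
  whisker_exchange a b := PicHom₂.ext (by ext; exact (b.natTrans.naturality _).symm)
  pentagon F G H I := PicHom₂.ext (Functor.pentagon _ _ _ _)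
  triangle F G := PicHom₂.ext (Functor.triangle _ _)

/-! ### Multi-determinant functors -/

section Det

variable {ι : Type} (T : ι → TriCat.{u}) (P : PicGpd.{v, w})

/-- A functor on the isomorphisms of the product of the `T i`, together with additivity data: for
each distinguished triangle `X ⟶ Y ⟶ Z ⟶ X⟦1⟧` in one of the variables, the others being held
fixed, a morphism `D(Z) ⊗ D(X) ⟶ D(Y)`. -/
structure PreDet where
  functor : Core (∀ i, T i) ⥤ P
  add : ∀ {i : ι} {X Y Z : ∀ j, T j} {f : X ⟶ Y} {g : Y ⟶ Z} {h : ShiftHom i Z X},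
    IsDistTri i f g h → (functor.obj ⟨Z⟩ ⊗ functor.obj ⟨X⟩ ⟶ functor.obj ⟨Y⟩)

variable {T P}

/-- The morphism attached to an isomorphism in the product of the `T i`. -/
def PreDet.mapIso (D : PreDet T P) {X Y : ∀ j, T j} (e : X ≅ Y) :
    D.functor.obj ⟨X⟩ ⟶ D.functor.obj ⟨Y⟩ :=
  D.functor.map ⟨e⟩

/-- A multi-determinant functor: a determinant functor in each variable, compatible in any two
variables. -/
structure PreDet.IsMultiDet (D : PreDet T P) : Prop where
  /-- naturality with respect to isomorphisms of triangles in the `i`-th variable and to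
  isomorphisms in the other variables -/
  naturality : ∀ {i : ι} {X Y Z X' Y' Z' : ∀ j, T j} {f : X ⟶ Y} {g : Y ⟶ Z} {h : ShiftHom i Z X}
    {f' : X' ⟶ Y'} {g' : Y' ⟶ Z'} {h' : ShiftHom i Z' X'}
    (Δ : IsDistTri i f g h) (Δ' : IsDistTri i f' g' h') (a : X ≅ X') (b : Y ≅ Y') (c : Z ≅ Z'),
    f ≫ b.hom = a.hom ≫ f' → g ≫ c.hom = b.hom ≫ g' → h.postcomp a.hom = h'.precomp c.hom →
    D.add Δ ≫ D.mapIso b = (D.mapIso c ⊗ₘ D.mapIso a) ≫ D.add Δ'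
  /-- commutativity axiom, for the triangles `X ⟶ W ⟶ Y` and `Y ⟶ W ⟶ X` of a direct sum -/
  commutativity : ∀ {i : ι} {X W Y : ∀ j, T j} {f : X ⟶ W} {g : W ⟶ Y} {h : ShiftHom i Y X}
    {f' : Y ⟶ W} {g' : W ⟶ X} {h' : ShiftHom i X Y}
    (Δ₁ : IsDistTri i f g h) (Δ₂ : IsDistTri i f' g' h'),
    f i ≫ g' i = 𝟙 _ → f' i ≫ g i = 𝟙 _ → g' i ≫ f i + g i ≫ f' i = 𝟙 _ →
    (β_ (D.functor.obj ⟨X⟩) (D.functor.obj ⟨Y⟩)).hom ≫ D.add Δ₁ = D.add Δ₂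
  /-- octahedron axiom -/
  octahedron : ∀ {i : ι} {X Y Z X' Y' Z' : ∀ j, T j}
    {f : X ⟶ Y} {f' : Y ⟶ Z'} {f'' : ShiftHom i Z' X}
    {k : X ⟶ Z} {k' : Z ⟶ Y'} {k'' : ShiftHom i Y' X}
    {g : Y ⟶ Z} {g' : Z ⟶ X'} {g'' : ShiftHom i X' Y}
    {m : Z' ⟶ Y'} {m' : Y' ⟶ X'} {m'' : ShiftHom i X' Z'}
    (Δ₁ : IsDistTri i f f' f'') (Δ₂ : IsDistTri i k k' k'')
    (Δ₃ : IsDistTri i g g' g'') (Δ₄ : IsDistTri i m m' m''),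
    f ≫ g = k → f' ≫ m = g ≫ k' → f'' = k''.precomp m → k' ≫ m' = g' →
    g''.precomp m' = k''.postcomp f → g''.postcomp f' = m'' →
    (D.add Δ₄ ▷ D.functor.obj ⟨X⟩) ≫ D.add Δ₂ =
      (α_ (D.functor.obj ⟨X'⟩) (D.functor.obj ⟨Z'⟩) (D.functor.obj ⟨X⟩)).hom ≫
        (D.functor.obj ⟨X'⟩ ◁ D.add Δ₁) ≫ D.add Δ₃
  /-- two triangles axiom -/
  twoTriangles : ∀ {i j : ι} {hij : i ≠ j} (d : Grid T i j hij),
    (D.add d.row'' ⊗ₘ D.add d.row') ≫ D.add d.coly =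
      tensorμ _ _ _ _ ≫ (D.add d.colz ⊗ₘ D.add d.colx) ≫ D.add d.row

/-- A morphism of multi-determinant functors: a natural transformation compatible with the
additivity data in each variable. -/
@[ext]
structure PreDet.Hom (D E : PreDet T P) where
  natTrans : D.functor ⟶ E.functor
  comm : ∀ {i : ι} {X Y Z : ∀ j, T j} {f : X ⟶ Y} {g : Y ⟶ Z} {h : ShiftHom i Z X}
    (Δ : IsDistTri i f g h),
    D.add Δ ≫ natTrans.app ⟨Y⟩ = (natTrans.app ⟨Z⟩ ⊗ₘ natTrans.app ⟨X⟩) ≫ E.add Δ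

instance : Category (PreDet T P) where
  Hom D E := PreDet.Hom D E
  id D := { natTrans := 𝟙 _, comm := fun Δ => by simp }
  comp a b :=
    { natTrans := a.natTrans ≫ b.natTrans
      comm := fun Δ => by
        rw [NatTrans.comp_app, ← Category.assoc, a.comm, Category.assoc, b.comm, NatTrans.comp_app,
          NatTrans.comp_app, ← Category.assoc, tensorHom_comp_tensorHom] }

@[simp]
theorem PreDet.id_natTrans' (D : PreDet T P) : PreDet.Hom.natTrans (𝟙 D) = 𝟙 D.functor := rfl

@[simp]
theorem PreDet.comp_natTrans' {D E F : PreDet T P} (a : D ⟶ E) (b : E ⟶ F) :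
    PreDet.Hom.natTrans (a ≫ b) = PreDet.Hom.natTrans a ≫ PreDet.Hom.natTrans b := rfl

@[ext]
theorem PreDet.hom_ext {D E : PreDet T P} {a b : D ⟶ E} (h : a.natTrans = b.natTrans) : a = b :=
  PreDet.Hom.ext h

variable (T P) in
/-- The functor which forgets the additivity data. -/
@[simps]
def PreDet.forget : PreDet T P ⥤ (Core (∀ i, T i) ⥤ P) where
  obj D := D.functor
  map a := a.natTrans

instance : (PreDet.forget T P).Faithful where
  map_injective h := PreDet.hom_ext h

/-- The isomorphism given by a natural isomorphism compatible with the additivity data. -/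
@[simps]
def PreDet.isoMk {D E : PreDet T P} (e : D.functor ≅ E.functor)
    (he : ∀ {i : ι} {X Y Z : ∀ j, T j} {f : X ⟶ Y} {g : Y ⟶ Z} {h : ShiftHom i Z X}
      (Δ : IsDistTri i f g h),
      D.add Δ ≫ e.hom.app ⟨Y⟩ = (e.hom.app ⟨Z⟩ ⊗ₘ e.hom.app ⟨X⟩) ≫ E.add Δ) : D ≅ E where
  hom := { natTrans := e.hom, comm := he }
  inv :=
    { natTrans := e.inv
      comm := fun {i X Y Z f g h} Δ => by
        have := he Δ
        rw [← cancel_mono (e.hom.app ⟨Y⟩), Category.assoc, Category.assoc, he, ← Category.assoc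
          (f := _ ⊗ₘ _), tensorHom_comp_tensorHom]
        simp }
  hom_inv_id := PreDet.hom_ext e.hom_inv_id
  inv_hom_id := PreDet.hom_ext e.inv_hom_id

instance : IsGroupoid (PreDet T P) where
  all_isIso a := by
    have : IsIso a.natTrans := NatIso.isIso_of_isIso_app _
    exact (PreDet.isoMk (asIso a.natTrans) a.comm).isIso_hom

/-- The sum of two functors with additivity data is computed pointwise. -/
@[simps]
def PreDet.tensorObj (D E : PreDet T P) : PreDet T P where
  functor := D.functor ⊗ E.functor
  add Δ := tensorμ _ _ _ _ ≫ (D.add Δ ⊗ₘ E.add Δ)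

variable (T P) in
/-- The constant functor with value the unit. -/
@[simps]
def PreDet.tensorUnit : PreDet T P where
  functor := 𝟙_ _
  add Δ := (λ_ (𝟙_ P.carrier)).hom

theorem tensorμ_braiding {C : Type*} [Category* C] [MonoidalCategory C] [SymmetricCategory C]
    (X₁ X₂ Y₁ Y₂ : C) :
    tensorμ X₁ X₂ Y₁ Y₂ ≫ (β_ (X₁ ⊗ Y₁) (X₂ ⊗ Y₂)).hom =
      ((β_ X₁ X₂).hom ⊗ₘ (β_ Y₁ Y₂).hom) ≫ tensorμ X₂ X₁ Y₂ Y₁ := by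
  simp [tensorμ, SymmetricCategory.braiding_swap_eq_inv_braiding Y₁ X₂,
    MonoidalCategory.tensorHom_def]

/-- The sum of two morphisms. -/
@[simps]
def PreDet.tensorHom {D E D' E' : PreDet T P} (a : D ⟶ D') (b : E ⟶ E') :
    D.tensorObj E ⟶ D'.tensorObj E' where
  natTrans := a.natTrans ⊗ₘ b.natTrans
  comm {i X Y Z f g h} Δ := by
    change (tensorμ _ _ _ _ ≫ (D.add Δ ⊗ₘ E.add Δ)) ≫ (a.natTrans.app _ ⊗ₘ b.natTrans.app _) =
      ((a.natTrans.app _ ⊗ₘ b.natTrans.app _) ⊗ₘ (a.natTrans.app _ ⊗ₘ b.natTrans.app _)) ≫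
        tensorμ _ _ _ _ ≫ (D'.add Δ ⊗ₘ E'.add Δ)
    rw [Category.assoc, tensorHom_comp_tensorHom, a.comm, b.comm, ← tensorHom_comp_tensorHom,
      ← Category.assoc, ← Category.assoc, tensorμ_natural]

/-- The sum of an object and a morphism. -/
@[simps]
def PreDet.whiskerLeft (D : PreDet T P) {E E' : PreDet T P} (b : E ⟶ E') :
    D.tensorObj E ⟶ D.tensorObj E' where
  natTrans := D.functor ◁ b.natTrans
  comm Δ := by
    rw [← MonoidalCategory.id_tensorHom]
    exact (PreDet.tensorHom (𝟙 D) b).comm Δ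

/-- The sum of a morphism and an object. -/
@[simps]
def PreDet.whiskerRight {D D' : PreDet T P} (a : D ⟶ D') (E : PreDet T P) :
    D.tensorObj E ⟶ D'.tensorObj E where
  natTrans := a.natTrans ▷ E.functor
  comm Δ := by
    rw [← MonoidalCategory.tensorHom_id]
    exact (PreDet.tensorHom a (𝟙 E)).comm Δ

instance : MonoidalCategoryStruct (PreDet T P) where
  tensorObj D E := D.tensorObj E
  tensorUnit := PreDet.tensorUnit T P
  tensorHom a b := PreDet.tensorHom a b
  whiskerLeft D _ _ b := D.whiskerLeft b
  whiskerRight a E := PreDet.whiskerRight a E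
  associator D E F := PreDet.isoMk (α_ D.functor E.functor F.functor) fun {i X Y Z f g h} Δ => by
    change (tensorμ _ _ _ _ ≫ ((tensorμ _ _ _ _ ≫ (D.add Δ ⊗ₘ E.add Δ)) ⊗ₘ F.add Δ)) ≫
      (α_ _ _ _).hom = ((α_ _ _ _).hom ⊗ₘ (α_ _ _ _).hom) ≫ tensorμ _ _ _ _ ≫
        (D.add Δ ⊗ₘ (tensorμ _ _ _ _ ≫ (E.add Δ ⊗ₘ F.add Δ)))
    have h₁ : ∀ {A B C A' C' : P} (p : A ⟶ B) (q : B ⟶ C) (r : A' ⟶ C'),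
        ((p ≫ q) ⊗ₘ r) = p ▷ A' ≫ (q ⊗ₘ r) := by
      intros
      simp [MonoidalCategory.tensorHom_def]
    have h₂ : ∀ {A B C A' C' : P} (p : A ⟶ B) (q : B ⟶ C) (r : A' ⟶ C'),
        (r ⊗ₘ (p ≫ q)) = A' ◁ p ≫ (r ⊗ₘ q) := by
      intros
      simp [MonoidalCategory.tensorHom_def']
    rw [h₁, h₂, Category.assoc, Category.assoc, MonoidalCategory.associator_naturality,
      associator_monoidal_assoc]
  leftUnitor D := PreDet.isoMk (λ_ D.functor) fun {i X Y Z f g h} Δ => by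
    change (tensorμ _ _ _ _ ≫ ((λ_ (𝟙_ P.carrier)).hom ⊗ₘ D.add Δ)) ≫ (λ_ _).hom =
      ((λ_ _).hom ⊗ₘ (λ_ _).hom) ≫ D.add Δ
    rw [leftUnitor_monoidal]
    simp [MonoidalCategory.tensorHom_def]
  rightUnitor D := PreDet.isoMk (ρ_ D.functor) fun {i X Y Z f g h} Δ => by
    change (tensorμ _ _ _ _ ≫ (D.add Δ ⊗ₘ (λ_ (𝟙_ P.carrier)).hom)) ≫ (ρ_ _).hom =
      ((ρ_ _).hom ⊗ₘ (ρ_ _).hom) ≫ D.add Δ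
    rw [rightUnitor_monoidal]
    simp [MonoidalCategory.tensorHom_def']

instance : MonoidalCategory (PreDet T P) where
  tensorHom_def a b := PreDet.hom_ext (MonoidalCategory.tensorHom_def _ _)
  id_tensorHom_id D E := PreDet.hom_ext (MonoidalCategory.id_tensorHom_id _ _)
  tensorHom_comp_tensorHom a b c d :=
    PreDet.hom_ext (MonoidalCategory.tensorHom_comp_tensorHom _ _ _ _)
  whiskerLeft_id D E := PreDet.hom_ext (MonoidalCategory.whiskerLeft_id _ _)
  id_whiskerRight D E := PreDet.hom_ext (MonoidalCategory.id_whiskerRight _ _)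
  associator_naturality a b c := PreDet.hom_ext (MonoidalCategory.associator_naturality _ _ _)
  leftUnitor_naturality a := PreDet.hom_ext (MonoidalCategory.leftUnitor_naturality _)
  rightUnitor_naturality a := PreDet.hom_ext (MonoidalCategory.rightUnitor_naturality _)
  pentagon D E F G := PreDet.hom_ext (MonoidalCategory.pentagon _ _ _ _)
  triangle D E := PreDet.hom_ext (MonoidalCategory.triangle _ _)

instance : SymmetricCategory (PreDet T P) where
  braiding D E := PreDet.isoMk (β_ D.functor E.functor) fun {i X Y Z f g h} Δ => by
    change (tensorμ _ _ _ _ ≫ (D.add Δ ⊗ₘ E.add Δ)) ≫ (β_ _ _).hom =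
      ((β_ _ _).hom ⊗ₘ (β_ _ _).hom) ≫ tensorμ _ _ _ _ ≫ (E.add Δ ⊗ₘ D.add Δ)
    rw [Category.assoc, BraidedCategory.braiding_naturality, ← Category.assoc, tensorμ_braiding,
      Category.assoc]
  braiding_naturality_right D _ _ b :=
    PreDet.hom_ext (BraidedCategory.braiding_naturality_right _ _)
  braiding_naturality_left a E :=
    PreDet.hom_ext (BraidedCategory.braiding_naturality_left _ _)
  hexagon_forward D E F := PreDet.hom_ext (BraidedCategory.hexagon_forward _ _ _)
  hexagon_reverse D E F := PreDet.hom_ext (BraidedCategory.hexagon_reverse _ _ _)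
  symmetry D E := PreDet.hom_ext (SymmetricCategory.symmetry _ _)

end Det

/-! ### Functoriality of multi-determinant functors -/

section Precomp

variable {S T : TriTuple.{u}} (f : TupleHom S T) {P : PicGpd.{v, w}}

/-- The functor between products of triangulated categories given by a morphism of lists. -/
@[simps]
def TupleHom.image : (∀ i, S.T i) ⥤ (∀ j, T.T j) where
  obj X := fun j => (f.F j).functor.obj (fun i => X i.1)
  map a := fun j => (f.F j).functor.map (fun i => a i.1)
  map_id X := by
    funext j
    exact (f.F j).functor.map_id _
  map_comp a b := by
    funext j
    exact (f.F j).functor.map_comp _ _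

/-- The image under `f` of a morphism which translates the `i`-th variable; it translates the
variable `f.φ i`. -/
@[simps]
def TupleHom.imageShift {i : Fin S.n} {Z X : ∀ i, S.T i} (a : ShiftHom i Z X) :
    ShiftHom (f.φ i) (f.image.obj Z) (f.image.obj X) where
  self := (f.F (f.φ i)).shiftMap (i := ⟨i, rfl⟩)
    { self := a.self, off := fun i' hi' => a.off i'.1 (fun h => hi' (Subtype.ext h)) }
  off j hj := (f.F j).functor.map (fun i' => a.off i'.1 (fun h => hj (h ▸ i'.2.symm)))

theorem TupleHom.image_dist {i : Fin S.n} {X Y Z : ∀ i, S.T i} {a : X ⟶ Y} {b : Y ⟶ Z}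
    {c : ShiftHom i Z X} (Δ : IsDistTri i a b c) :
    IsDistTri (f.φ i) (f.image.map a) (f.image.map b) (f.imageShift c) where
  dist := (f.F (f.φ i)).map_dist (i := ⟨i, rfl⟩)
    { dist := Δ.dist
      f_off := fun i' hi' => Δ.f_off i'.1 (fun h => hi' (Subtype.ext h))
      g_off := fun i' hi' => Δ.g_off i'.1 (fun h => hi' (Subtype.ext h))
      h_off := fun _ _ => Δ.h_off _ _ }
  f_off j hj := functor_map_eqToHom _ _ fun i' => Δ.f_off i'.1 (fun h => hj (h ▸ i'.2.symm))
  g_off j hj := functor_map_eqToHom _ _ fun i' => Δ.g_off i'.1 (fun h => hj (h ▸ i'.2.symm))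
  h_off j hj := functor_map_eqToHom _ _ fun i' => Δ.h_off i'.1 (fun h => hj (h ▸ i'.2.symm))

/-- The composite of a functor with additivity data with a morphism of lists. -/
@[simps]
def PreDet.precomp (D : PreDet T.T P) : PreDet S.T P where
  functor := f.image.core ⋙ D.functor
  add Δ := D.add (f.image_dist Δ)

/-- Composition with `f`, as a functor. -/
@[simps]
def PreDet.precompFunctor (P : PicGpd.{v, w}) : PreDet T.T P ⥤ PreDet S.T P where
  obj D := D.precomp f
  map a :=
    { natTrans := Functor.whiskerLeft f.image.core a.natTrans
      comm := fun Δ => a.comm (f.image_dist Δ) }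

variable {f}

/-- The isomorphism of functors on the products given by a 2-cell. -/
def TupleHom₂.image {f g : TupleHom S T} (a : f ⟶ g) : f.image ≅ g.image :=
  match a with
  | .mk a => NatIso.ofComponents (fun X => Pi.isoMk fun j => (a j).iso.app (fun i => X i.1)) (by
      intro X Y b
      funext j
      exact (a j).iso.hom.naturality _)

/-- The natural transformation `D ∘ f ⟶ D ∘ g` given by a 2-cell `f ⟶ g`. -/
@[simps!]
def PreDet.whisker (D : PreDet T.T P) {f g : TupleHom S T} (a : f ⟶ g) :
    (D.precomp f).functor ⟶ (D.precomp g).functor :=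
  Functor.whiskerRight (TupleHom₂.image a).core.hom D.functor

end Precomp

section Functoriality

variable (P : PicGpd.{v, w})

/-- The property of being a multi-determinant functor. -/
def isMultiDet (T : TriTuple.{u}) : ObjectProperty (PreDet T.T P) := fun D => D.IsMultiDet

instance (T : TriTuple.{u}) : IsGroupoid (isMultiDet P T).FullSubcategory where
  all_isIso a := by
    have : IsIso ((isMultiDet P T).ι.map a) := inferInstanceAs (IsIso a.hom)
    exact isIso_of_reflects_iso a (isMultiDet P T).ι

/-- The groupoids of multi-determinant functors are Picard groupoids for the pointwise sum, and
they are preserved by the composition with morphisms of lists of triangulated categories and with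
their 2-cells. -/
structure DetWellDefined : Prop where
  /-- Multi-determinant functors are stable under the pointwise sum. -/
  isMonoidal : ∀ T : TriTuple.{u}, (isMultiDet P T).IsMonoidal
  /-- They form a Picard groupoid. -/
  isEquivalence : ∀ (T : TriTuple.{u}) (D : (isMultiDet P T).FullSubcategory),
    (tensorLeft D).IsEquivalence
  /-- The composite `D ∘ f` of a multi-determinant functor `D` is a multi-determinant functor. -/
  precomp : ∀ {S T : TriTuple.{u}} (f : S ⟶ T) (D : PreDet T.T P),
    D.IsMultiDet → (D.precomp f).IsMultiDet
  /-- The transformation `D ∘ f ⟶ D ∘ g` given by a 2-cell is a morphism of multi-determinant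
  functors. -/
  whisker : ∀ {S T : TriTuple.{u}} {f g : S ⟶ T} (a : f ⟶ g) (D : PreDet T.T P), D.IsMultiDet →
    ∀ {i : Fin S.n} {X Y Z : ∀ j, S.T j} {p : X ⟶ Y} {q : Y ⟶ Z} {r : ShiftHom i Z X}
      (Δ : IsDistTri i p q r),
      (D.precomp f).add Δ ≫ (D.whisker a).app ⟨Y⟩ =
        ((D.whisker a).app ⟨Z⟩ ⊗ₘ (D.whisker a).app ⟨X⟩) ≫ (D.precomp g).add Δ

variable {P}

/-- The Picard groupoid `Det(T;P)` of multi-determinant functors, with the pointwise sum. -/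
@[simps carrier]
def detObj (H : DetWellDefined.{u} P) (T : TriTuple.{u}) :
    PicGpd.{max u v, max u v w} :=
  have := H.isMonoidal T
  { carrier := (isMultiDet P T).FullSubcategory
    isEquivalence := H.isEquivalence T }

/-- Composition with a morphism of lists of triangulated categories, as a functor
`Det(T;P) ⥤ Det(S;P)`. -/
def detFunctor (H : DetWellDefined.{u} P) {S T : TriTuple.{u}} (f : S ⟶ T) :
    detObj H T ⥤ detObj H S :=
  (isMultiDet P S).lift ((isMultiDet P T).ι ⋙ PreDet.precompFunctor f P)
    (fun D => H.precomp f D.obj D.property)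

theorem detObj_hom_ext (H : DetWellDefined.{u} P) {T : TriTuple.{u}} {D E : detObj H T}
    {a b : D ⟶ E} (h : ∀ X, a.hom.natTrans.app X = b.hom.natTrans.app X) : a = b :=
  ObjectProperty.hom_ext _ (PreDet.hom_ext (NatTrans.ext (funext h)))

/-- The functor `detFunctor` strictly preserves the pointwise sums and the unit. -/
def detFunctorCoreMonoidal (H : DetWellDefined.{u} P) {S T : TriTuple.{u}} (f : S ⟶ T) :
    (detFunctor H f).CoreMonoidal where
  εIso := Iso.refl (𝟙_ (detObj H S))
  μIso := fun D E => Iso.refl ((detFunctor H f).obj (D ⊗ E))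
  μIso_hom_natural_left a E := detObj_hom_ext H fun X =>
    (Category.comp_id _).trans (Category.id_comp _).symm
  μIso_hom_natural_right D a := detObj_hom_ext H fun X =>
    (Category.comp_id _).trans (Category.id_comp _).symm
  associativity D E F := detObj_hom_ext H fun X => by
    have key : ∀ A B C : P, 𝟙 (A ⊗ B) ▷ C ≫ 𝟙 _ ≫ (α_ A B C).hom =
        (α_ A B C).hom ≫ A ◁ 𝟙 (B ⊗ C) ≫ 𝟙 _ := by simp
    exact key _ _ _
  left_unitality D := detObj_hom_ext H fun X => by
    have key : ∀ A : P, (λ_ A).hom = 𝟙 (𝟙_ P.carrier) ▷ A ≫ 𝟙 _ ≫ (λ_ A).hom := by simp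
    exact key _
  right_unitality D := detObj_hom_ext H fun X => by
    have key : ∀ A : P, (ρ_ A).hom = A ◁ 𝟙 (𝟙_ P.carrier) ≫ 𝟙 _ ≫ (ρ_ A).hom := by simp
    exact key _

instance (H : DetWellDefined.{u} P) {S T : TriTuple.{u}} (f : S ⟶ T) :
    (detFunctor H f).Braided where
  toMonoidal := (detFunctorCoreMonoidal H f).toMonoidal
  braided D E := detObj_hom_ext H fun X =>
    (Category.id_comp _).trans (Category.comp_id _).symm

/-- Composition with a morphism of lists of triangulated categories, as a morphism of Picard
groupoids. -/
def detMap (H : DetWellDefined.{u} P) {S T : TriTuple.{u}} (f : S ⟶ T) :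
    detObj H T ⟶ detObj H S :=
  { functor := detFunctor H f : PicHom _ _ }

/-- The morphism `D ∘ f ⟶ D ∘ g` of multi-determinant functors given by a 2-cell `f ⟶ g`. -/
def detWhisker (H : DetWellDefined.{u} P) {S T : TriTuple.{u}} {f g : S ⟶ T} (a : f ⟶ g)
    (D : detObj H T) : (detFunctor H f).obj D ⟶ (detFunctor H g).obj D :=
  ObjectProperty.homMk
    (X := (detFunctor H f).obj D) (Y := (detFunctor H g).obj D)
    (PreDet.Hom.mk (D.obj.whisker a) (H.whisker a D.obj D.property))

/-- The 2-morphism of Picard groupoids given by a 2-cell. -/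
def detMap₂ (H : DetWellDefined.{u} P) {S T : TriTuple.{u}} {f g : S ⟶ T} (a : f ⟶ g) :
    detMap H f ⟶ detMap H g :=
  { natTrans :=
      { app := detWhisker H a
        naturality := fun D E b => detObj_hom_ext H fun X => (b.hom.natTrans.naturality _).symm }
    isMonoidal :=
      { unit := detObj_hom_ext H fun X => Category.comp_id _
        tensor := fun D E => detObj_hom_ext H fun X =>
          (Category.id_comp _).trans (Category.comp_id _).symm } : PicHom₂ _ _ }

/-- The assignments `T ↦ Det(T;P)`, `f ↦ (D ↦ D ∘ f)` and `a ↦ (D ↦ D ∗ a)`. -/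
def detStruct (H : DetWellDefined.{u} P) :
    PrelaxFunctorStruct TriTuple.{u}ᵒᵖ PicGpd.{max u v, max u v w} where
  obj T := detObj H T.unop
  map f := detMap H f.unop
  map₂ a := detMap₂ H a.unop2

end Functoriality
end
end DetFunctor

open DetFunctor

/-! The axioms of a multi-determinant functor are equations between morphisms of `P`, and the sum of
`P` is functorial. Once the isomorphisms exchanging the middle summands are moved out of the way,
each axiom for `D + E` therefore becomes the sum of the axiom for `D` and the axiom for `E`
(`naturality_tensor`, `commutativity_tensor`, `octahedron_tensor`, `twoTriangles_tensor`). These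
reductions are equivalences. As adding a fixed object of `P` is faithful, they can also be read
backwards: if `D` and `D + E` satisfy the axioms, so does `E`. An inverse `E` of `D` can be built
without any axiom: choose an inverse of every value, and the remaining data are forced by the chosen
trivializations (`PreDet.exists_inverse`). Since `D + E` is isomorphic to the unit, `E` satisfies
the axioms, and `Det` is Picard.

For the composite of `D` with a 1-morphism, all axioms but the two triangles axiom follow from
exactness in each variable. The same holds for that axiom when the two variables go to different
ones. If they go to the same variable, the corresponding axiom of `D` says nothing, and one has to
treat a nine-term diagram for a determinant functor in one variable; this is the role of Verdier
structures (`OneDet.twoTriangles`). The two octahedra on the diagonal both pass through `D(A) +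
D(x')`, so it is enough to compare two ways of assembling `D(A)` from the values at `z''`, `x''` and
`z'`. The third octahedron compares them, but for the rotated triangles. Rotation is controlled by
`OneDet.exists_rotate`: it amounts to contracting with a pairing `D(Σx) + D(x) ⟶ 0` which depends
only on `x`. The rest is a computation with braidings (`whiskerRight_comp_eq_of_rotate`).

A 2-cell induces isomorphisms of triangles, so its compatibility with additivity data is the
naturality axiom. Finally, the functor is strict because composition of functors is, and all
constraint cells involved are of the form `eqToHom`. -/

namespace DetFunctor

/-! ### Exchanging the middle factors in a symmetric monoidal category. -/

section Interchange

variable {C : Type*} [Category* C] [MonoidalCategory C]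

section Braided

variable [BraidedCategory C]

instance isIso_tensorμ (X₁ X₂ Y₁ Y₂ : C) : IsIso (tensorμ X₁ X₂ Y₁ Y₂) :=
  ⟨tensorδ X₁ X₂ Y₁ Y₂, tensorμ_tensorδ _ _ _ _, tensorδ_tensorμ _ _ _ _⟩

/-- The square of a braided category is braided. -/
instance prodBraided : BraidedCategory (C × C) where
  braiding X Y := Iso.prod (β_ X.1 Y.1) (β_ X.2 Y.2)
  braiding_naturality_right _ _ _ _ := Prod.ext
    (BraidedCategory.braiding_naturality_right _ _) (BraidedCategory.braiding_naturality_right _ _)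
  braiding_naturality_left _ _ := Prod.ext
    (BraidedCategory.braiding_naturality_left _ _) (BraidedCategory.braiding_naturality_left _ _)
  hexagon_forward _ _ _ := Prod.ext
    (BraidedCategory.hexagon_forward _ _ _) (BraidedCategory.hexagon_forward _ _ _)
  hexagon_reverse _ _ _ := Prod.ext
    (BraidedCategory.hexagon_reverse _ _ _) (BraidedCategory.hexagon_reverse _ _ _)

end Braided

variable [SymmetricCategory C]

/-- By symmetry, exchanging the middle factors twice is the identity, so the exchanges in
`tensorμ_braiding` can be carried to the other sides. In this form the equation says that the
functor `⊗` from `C × C` to `C` is braided. -/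
theorem braiding_tensorμ (A B A' B' : C) :
    (β_ (A ⊗ B) (A' ⊗ B')).hom ≫ tensorμ A' B' A B =
      tensorμ A B A' B' ≫ ((β_ A A').hom ⊗ₘ (β_ B B').hom) := by
  have h : ∀ X₁ X₂ Y₁ Y₂ : C, tensorμ X₁ X₂ Y₁ Y₂ ≫ tensorμ X₁ Y₁ X₂ Y₂ = 𝟙 _ := by
    intro X₁ X₂ Y₁ Y₂
    have : tensorμ X₁ Y₁ X₂ Y₂ = tensorδ X₁ X₂ Y₁ Y₂ := by
      simp [tensorμ, tensorδ, SymmetricCategory.braiding_swap_eq_inv_braiding X₂ Y₁]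
    rw [this, tensorμ_tensorδ]
  rw [← cancel_epi (tensorμ A A' B B'), ← Category.assoc, tensorμ_braiding,
    Category.assoc, h, ← Category.assoc, h, Category.id_comp, Category.comp_id]

instance : (tensor C).LaxBraided where
  braided _ _ := (braiding_tensorμ _ _ _ _).symm

/-- A lax braided functor carries the exchange of its source to that of its target; here the functor
is `⊗` itself. This coherence is what the two triangles axiom for a sum requires. -/
theorem tensorμ_tensorμ (A A' B B' A₂ A₂' B₂ B₂' : C) :
    tensorμ (A ⊗ A') (B ⊗ B') (A₂ ⊗ A₂') (B₂ ⊗ B₂') ≫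
        (tensorμ A A' A₂ A₂' ⊗ₘ tensorμ B B' B₂ B₂') ≫
          tensorμ (A ⊗ A₂) (A' ⊗ A₂') (B ⊗ B₂) (B' ⊗ B₂') =
      (tensorμ A A' B B' ⊗ₘ tensorμ A₂ A₂' B₂ B₂') ≫
        tensorμ (A ⊗ B) (A' ⊗ B') (A₂ ⊗ B₂) (A₂' ⊗ B₂') ≫
          (tensorμ A B A₂ B₂ ⊗ₘ tensorμ A' B' A₂' B₂') :=
  tensorμ_comp_μ_tensorHom_μ_comp_μ (tensor C) (A, A') (B, B') (A₂, A₂') (B₂, B₂')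

end Interchange

/-! ### The axioms for a sum, in terms of the axioms for its summands. -/

section Tensor

variable {C : Type*} [Category* C] [MonoidalCategory C]

/-- In a groupoid the factor `p ▷ A'` of `p ⊗ₘ q` can be cancelled, and faithfulness of `B ⊗ -`
removes the other whiskering. -/
theorem tensorHom_eq_iff [IsGroupoid C] {A B A' B' : C} {p p' : A ⟶ B} {q q' : A' ⟶ B'}
    (hC : (tensorLeft B).Faithful) (h : p = p') : (p ⊗ₘ q = p' ⊗ₘ q') ↔ q = q' := by
  subst h
  refine ⟨fun h => ?_, fun h => by rw [h]⟩
  rw [MonoidalCategory.tensorHom_def, MonoidalCategory.tensorHom_def, cancel_epi] at h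
  exact hC.map_injective h

variable [SymmetricCategory C]

/-- Both sides begin with the same invertible exchange, which cancels. The equivalence is used in
both directions: from right to left for sums, and from left to right to deduce the axiom for one
summand from that for the other. The same applies to the three lemmas that follow. -/
theorem naturality_tensor {X Y Z X' Y' Z' U V W U' V' W' : C}
    (s : Z ⊗ X ⟶ Y) (t : W ⊗ U ⟶ V) (b : Y ⟶ Y') (b' : V ⟶ V') (s' : Z' ⊗ X' ⟶ Y')
    (t' : W' ⊗ U' ⟶ V') (a : X ⟶ X') (c : Z ⟶ Z') (a' : U ⟶ U') (c' : W ⟶ W') :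
    ((tensorμ Z W X U ≫ (s ⊗ₘ t)) ≫ (b ⊗ₘ b') =
      ((c ⊗ₘ c') ⊗ₘ (a ⊗ₘ a')) ≫ tensorμ Z' W' X' U' ≫ (s' ⊗ₘ t')) ↔
    (s ≫ b) ⊗ₘ (t ≫ b') = ((c ⊗ₘ a) ≫ s') ⊗ₘ ((c' ⊗ₘ a') ≫ t') := by
  rw [tensorμ_natural_assoc, Category.assoc, cancel_epi, tensorHom_comp_tensorHom,
    tensorHom_comp_tensorHom]

theorem commutativity_tensor {X Y W U V R : C} (s : Y ⊗ X ⟶ W) (t : V ⊗ U ⟶ R)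
    (s' : X ⊗ Y ⟶ W) (t' : U ⊗ V ⟶ R) :
    ((β_ (X ⊗ U) (Y ⊗ V)).hom ≫ tensorμ Y V X U ≫ (s ⊗ₘ t) = tensorμ X U Y V ≫ (s' ⊗ₘ t')) ↔
      ((β_ X Y).hom ≫ s) ⊗ₘ ((β_ U V).hom ≫ t) = s' ⊗ₘ t' := by
  rw [← Category.assoc, braiding_tensorμ, Category.assoc, cancel_epi, tensorHom_comp_tensorHom]

/-- Both composites factor through one isomorphism regrouping three pairs into two triples. That its
two bracketings agree up to associators is `tensor_associativity`. -/
theorem octahedron_tensor {X Y Z X' Y' Z' U V W U' V' W' : C}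
    (s₁ : Z' ⊗ X ⟶ Y) (s₂ : Y' ⊗ X ⟶ Z) (s₃ : X' ⊗ Y ⟶ Z) (s₄ : X' ⊗ Z' ⟶ Y')
    (t₁ : W' ⊗ U ⟶ V) (t₂ : V' ⊗ U ⟶ W) (t₃ : U' ⊗ V ⟶ W) (t₄ : U' ⊗ W' ⟶ V') :
    (((tensorμ _ _ _ _ ≫ (s₄ ⊗ₘ t₄)) ▷ (X ⊗ U)) ≫ tensorμ _ _ _ _ ≫ (s₂ ⊗ₘ t₂) =
      (α_ (X' ⊗ U') (Z' ⊗ W') (X ⊗ U)).hom ≫ ((X' ⊗ U') ◁ (tensorμ _ _ _ _ ≫ (s₁ ⊗ₘ t₁))) ≫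
        tensorμ _ _ _ _ ≫ (s₃ ⊗ₘ t₃)) ↔
    ((s₄ ▷ X) ≫ s₂) ⊗ₘ ((t₄ ▷ U) ≫ t₂) =
      ((α_ X' Z' X).hom ≫ (X' ◁ s₁) ≫ s₃) ⊗ₘ ((α_ U' W' U).hom ≫ (U' ◁ t₁) ≫ t₃) := by
  have h₁ : ((tensorμ X' U' Z' W' ≫ (s₄ ⊗ₘ t₄)) ▷ (X ⊗ U)) ≫ tensorμ _ _ _ _ ≫ (s₂ ⊗ₘ t₂) =
      (tensorμ X' U' Z' W' ▷ (X ⊗ U) ≫ tensorμ _ _ _ _) ≫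
        (((s₄ ▷ X) ≫ s₂) ⊗ₘ ((t₄ ▷ U) ≫ t₂)) := by
    rw [comp_whiskerRight, Category.assoc, ← tensorHom_comp_tensorHom, tensorμ_natural_left_assoc,
      Category.assoc]
  have h₂ : (α_ (X' ⊗ U') (Z' ⊗ W') (X ⊗ U)).hom ≫
      ((X' ⊗ U') ◁ (tensorμ _ _ _ _ ≫ (s₁ ⊗ₘ t₁))) ≫ tensorμ _ _ _ _ ≫ (s₃ ⊗ₘ t₃) =
      (tensorμ X' U' Z' W' ▷ (X ⊗ U) ≫ tensorμ _ _ _ _) ≫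
        (((α_ X' Z' X).hom ≫ (X' ◁ s₁) ≫ s₃) ⊗ₘ ((α_ U' W' U).hom ≫ (U' ◁ t₁) ≫ t₃)) := by
    rw [MonoidalCategory.whiskerLeft_comp, Category.assoc, tensorμ_natural_right_assoc,
      ← tensorHom_comp_tensorHom, ← tensorHom_comp_tensorHom, Category.assoc,
      tensor_associativity_assoc]
  rw [h₁, h₂, cancel_epi]

/-- The regroupings of four pairs which occur on the two sides differ by the exchanges of the axiom
itself; `tensorμ_tensorμ` identifies them, after which the common isomorphism cancels. -/
theorem twoTriangles_tensor {x' y' z' x y z x'' y'' z'' u' v' w' a b c u'' v'' w'' : C}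
    (s₁ : z'' ⊗ x'' ⟶ y'') (s₂ : z' ⊗ x' ⟶ y') (s₃ : y'' ⊗ y' ⟶ y)
    (s₄ : z'' ⊗ z' ⟶ z) (s₅ : x'' ⊗ x' ⟶ x) (s₆ : z ⊗ x ⟶ y)
    (t₁ : w'' ⊗ u'' ⟶ v'') (t₂ : w' ⊗ u' ⟶ v') (t₃ : v'' ⊗ v' ⟶ b)
    (t₄ : w'' ⊗ w' ⟶ c) (t₅ : u'' ⊗ u' ⟶ a) (t₆ : c ⊗ a ⟶ b) :
    (((tensorμ _ _ _ _ ≫ (s₁ ⊗ₘ t₁)) ⊗ₘ (tensorμ _ _ _ _ ≫ (s₂ ⊗ₘ t₂))) ≫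
        tensorμ _ _ _ _ ≫ (s₃ ⊗ₘ t₃) =
      tensorμ (z'' ⊗ w'') (x'' ⊗ u'') (z' ⊗ w') (x' ⊗ u') ≫
        ((tensorμ _ _ _ _ ≫ (s₄ ⊗ₘ t₄)) ⊗ₘ (tensorμ _ _ _ _ ≫ (s₅ ⊗ₘ t₅))) ≫
          tensorμ _ _ _ _ ≫ (s₆ ⊗ₘ t₆)) ↔
    ((s₁ ⊗ₘ s₂) ≫ s₃) ⊗ₘ ((t₁ ⊗ₘ t₂) ≫ t₃) =
      (tensorμ _ _ _ _ ≫ (s₄ ⊗ₘ s₅) ≫ s₆) ⊗ₘ (tensorμ _ _ _ _ ≫ (t₄ ⊗ₘ t₅) ≫ t₆) := by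
  rw [← tensorHom_comp_tensorHom, Category.assoc, tensorμ_natural_assoc,
    ← tensorHom_comp_tensorHom (tensorμ z'' w'' z' w'), Category.assoc, tensorμ_natural_assoc,
    reassoc_of% (tensorμ_tensorμ z'' w'' x'' u'' z' w' x' u')]
  simp only [tensorHom_comp_tensorHom]
  rw [← Category.assoc, ← Category.assoc, cancel_epi]

end Tensor

/-! ### Multi-determinant functors under sums, cancellation and isomorphisms. -/

section TensorDet

variable {ι : Type} {T : ι → TriCat.{u}} {P : PicGpd.{v, w}}

theorem PicGpd.tensorHom_congr_iff {A B A' B' : P} {p p' : A ⟶ B} {q q' : A' ⟶ B'} (h : p = p') :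
    p ⊗ₘ q = p' ⊗ₘ q' ↔ q = q' :=
  tensorHom_eq_iff inferInstance h

/-- The sum of multi-determinant functors is a multi-determinant functor. -/
theorem PreDet.IsMultiDet.tensorObj {D E : PreDet T P} (hD : D.IsMultiDet) (hE : E.IsMultiDet) :
    (D.tensorObj E).IsMultiDet where
  naturality Δ Δ' a b c h₁ h₂ h₃ :=
    (naturality_tensor _ _ _ _ _ _ _ _ _ _).2 (congrArg₂ _ (hD.naturality Δ Δ' a b c h₁ h₂ h₃)
      (hE.naturality Δ Δ' a b c h₁ h₂ h₃))
  commutativity Δ₁ Δ₂ h₁ h₂ h₃ :=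
    (commutativity_tensor _ _ _ _).2 (congrArg₂ _ (hD.commutativity Δ₁ Δ₂ h₁ h₂ h₃)
      (hE.commutativity Δ₁ Δ₂ h₁ h₂ h₃))
  octahedron Δ₁ Δ₂ Δ₃ Δ₄ h₁ h₂ h₃ h₄ h₅ h₆ :=
    (octahedron_tensor _ _ _ _ _ _ _ _).2
      (congrArg₂ _ (hD.octahedron Δ₁ Δ₂ Δ₃ Δ₄ h₁ h₂ h₃ h₄ h₅ h₆)
        (hE.octahedron Δ₁ Δ₂ Δ₃ Δ₄ h₁ h₂ h₃ h₄ h₅ h₆))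
  twoTriangles d :=
    (twoTriangles_tensor _ _ _ _ _ _ _ _ _ _ _ _).2
      (congrArg₂ _ (hD.twoTriangles d) (hE.twoTriangles d))

/-- If `D` and `D ⊗ E` are multi-determinant functors, then so is `E`. -/
theorem PreDet.IsMultiDet.of_tensorObj {D E : PreDet T P} (hD : D.IsMultiDet)
    (h : (D.tensorObj E).IsMultiDet) : E.IsMultiDet where
  naturality Δ Δ' a b c h₁ h₂ h₃ :=
    (PicGpd.tensorHom_congr_iff (hD.naturality Δ Δ' a b c h₁ h₂ h₃)).1
      ((naturality_tensor _ _ _ _ _ _ _ _ _ _).1 (h.naturality Δ Δ' a b c h₁ h₂ h₃))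
  commutativity Δ₁ Δ₂ h₁ h₂ h₃ :=
    (PicGpd.tensorHom_congr_iff (hD.commutativity Δ₁ Δ₂ h₁ h₂ h₃)).1
      ((commutativity_tensor _ _ _ _).1 (h.commutativity Δ₁ Δ₂ h₁ h₂ h₃))
  octahedron Δ₁ Δ₂ Δ₃ Δ₄ h₁ h₂ h₃ h₄ h₅ h₆ :=
    (PicGpd.tensorHom_congr_iff (hD.octahedron Δ₁ Δ₂ Δ₃ Δ₄ h₁ h₂ h₃ h₄ h₅ h₆)).1
      ((octahedron_tensor _ _ _ _ _ _ _ _).1 (h.octahedron Δ₁ Δ₂ Δ₃ Δ₄ h₁ h₂ h₃ h₄ h₅ h₆))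
  twoTriangles d :=
    (PicGpd.tensorHom_congr_iff (hD.twoTriangles d)).1
      ((twoTriangles_tensor _ _ _ _ _ _ _ _ _ _ _ _).1 (h.twoTriangles d))

variable (T P) in
theorem PreDet.isMultiDet_tensorUnit : (PreDet.tensorUnit T P).IsMultiDet where
  naturality Δ Δ' a b c h₁ h₂ h₃ := by
    have key : (λ_ (𝟙_ P.carrier)).hom ≫ 𝟙 _ = (𝟙 _ ⊗ₘ 𝟙 _) ≫ (λ_ (𝟙_ P.carrier)).hom := by simp
    exact key
  commutativity Δ₁ Δ₂ h₁ h₂ h₃ := by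
    have key : (β_ (𝟙_ P.carrier) (𝟙_ P.carrier)).hom ≫ (λ_ (𝟙_ P.carrier)).hom =
      (λ_ (𝟙_ P.carrier)).hom := by rw [braiding_leftUnitor, unitors_equal]
    exact key
  octahedron Δ₁ Δ₂ Δ₃ Δ₄ h₁ h₂ h₃ h₄ h₅ h₆ := by
    have key : ((λ_ (𝟙_ P.carrier)).hom ▷ 𝟙_ P.carrier) ≫ (λ_ (𝟙_ P.carrier)).hom =
      (α_ _ _ _).hom ≫ (𝟙_ P.carrier ◁ (λ_ (𝟙_ P.carrier)).hom) ≫ (λ_ (𝟙_ P.carrier)).hom := by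
      monoidal
    exact key
  twoTriangles d := by
    have key : ((λ_ (𝟙_ P.carrier)).hom ⊗ₘ (λ_ (𝟙_ P.carrier)).hom) ≫ (λ_ (𝟙_ P.carrier)).hom =
      tensorμ _ _ _ _ ≫ ((λ_ (𝟙_ P.carrier)).hom ⊗ₘ (λ_ (𝟙_ P.carrier)).hom) ≫
        (λ_ (𝟙_ P.carrier)).hom := by
      -- The only braiding in this exchange is that of the unit with itself, which is a composite of
      -- unitors; what remains is coherence in a monoidal category.
      rw [tensorμ, braiding_tensorUnit_left]
      monoidal
    exact key

/-- A functor with additivity data isomorphic to a multi-determinant functor is one. -/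
theorem PreDet.IsMultiDet.of_iso {D E : PreDet T P} (e : D ⟶ E) (h : D.IsMultiDet) :
    E.IsMultiDet := by
  have hc : ∀ X, IsIso (e.natTrans.app X) := inferInstance
  -- Precomposed with the components of `e` on its source, each axiom for `E` turns into the axiom
  -- for `D` followed by the component on the target. These components are invertible because `P` is
  -- a groupoid, so a mere morphism `e` suffices.
  have hE : ∀ {i : ι} {X Y Z : ∀ j, T j} {f : X ⟶ Y} {g : Y ⟶ Z} {h : ShiftHom i Z X}
      (Δ : IsDistTri i f g h), (e.natTrans.app ⟨Z⟩ ⊗ₘ e.natTrans.app ⟨X⟩) ≫ E.add Δ =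
        D.add Δ ≫ e.natTrans.app ⟨Y⟩ := fun Δ => (e.comm Δ).symm
  refine ⟨fun {i X Y Z X' Y' Z' f g k f' g' k'} Δ Δ' a b c h₁ h₂ h₃ => ?_,
    fun {i X W Y f g k f' g' k'} Δ₁ Δ₂ h₁ h₂ h₃ => ?_,
    fun {i X Y Z X' Y' Z'} _ _ _ _ _ _ _ _ _ _ _ _ Δ₁ Δ₂ Δ₃ Δ₄ h₁ h₂ h₃ h₄ h₅ h₆ => ?_, fun d => ?_⟩
  · have nat : ∀ {A B : ∀ j, T j} (p : A ≅ B), e.natTrans.app ⟨A⟩ ≫ E.mapIso p =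
        D.mapIso p ≫ e.natTrans.app ⟨B⟩ := fun p => (e.natTrans.naturality _).symm
    rw [← cancel_epi (e.natTrans.app ⟨Z⟩ ⊗ₘ e.natTrans.app ⟨X⟩), reassoc_of% (hE Δ), nat,
      tensorHom_comp_tensorHom_assoc, nat, nat, ← tensorHom_comp_tensorHom_assoc, hE,
      reassoc_of% (h.naturality Δ Δ' a b c h₁ h₂ h₃)]
  · rw [← cancel_epi (e.natTrans.app ⟨X⟩ ⊗ₘ e.natTrans.app ⟨Y⟩), hE,
      BraidedCategory.braiding_naturality_assoc, hE,
      reassoc_of% (h.commutativity Δ₁ Δ₂ h₁ h₂ h₃)]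
  · rw [← cancel_epi ((e.natTrans.app ⟨X'⟩ ⊗ₘ e.natTrans.app ⟨Z'⟩) ⊗ₘ e.natTrans.app ⟨X⟩),
      ← MonoidalCategory.tensorHom_id, ← MonoidalCategory.id_tensorHom,
      tensorHom_comp_tensorHom_assoc, associator_naturality_assoc, tensorHom_comp_tensorHom_assoc,
      hE, hE, Category.comp_id, Category.comp_id]
    have := h.octahedron Δ₁ Δ₂ Δ₃ Δ₄ h₁ h₂ h₃ h₄ h₅ h₆
    have h' : ∀ {A B C A' C' : P} (p : A ⟶ B) (q : B ⟶ C) (r : A' ⟶ C'),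
        ((p ≫ q) ⊗ₘ r) = p ▷ A' ≫ (q ⊗ₘ r) := by
      intros
      simp [MonoidalCategory.tensorHom_def]
    have h'' : ∀ {A B C A' C' : P} (p : A ⟶ B) (q : B ⟶ C) (r : A' ⟶ C'),
        (r ⊗ₘ (p ≫ q)) = A' ◁ p ≫ (r ⊗ₘ q) := by
      intros
      simp [MonoidalCategory.tensorHom_def']
    rw [h', h'', Category.assoc, Category.assoc, hE, hE, reassoc_of% this]
  · rw [← cancel_epi ((e.natTrans.app ⟨d.z''⟩ ⊗ₘ e.natTrans.app ⟨d.x''⟩) ⊗ₘ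
        (e.natTrans.app ⟨d.z'⟩ ⊗ₘ e.natTrans.app ⟨d.x'⟩)),
      tensorHom_comp_tensorHom_assoc, hE, hE, tensorμ_natural_assoc,
      tensorHom_comp_tensorHom_assoc, hE, hE, ← tensorHom_comp_tensorHom_assoc,
      ← tensorHom_comp_tensorHom_assoc, hE, hE, reassoc_of% (h.twoTriangles d)]

end TensorDet

/-! ### Inverses for the pointwise sum. -/

theorem isEquivalence_tensorLeft {C : Type*} [Category* C] [MonoidalCategory C]
    [SymmetricCategory C] {A B : C} (e : A ⊗ B ≅ 𝟙_ C) : (tensorLeft A).IsEquivalence :=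
  (CategoryTheory.Equivalence.mk (tensorLeft A) (tensorLeft B)
    ((leftUnitorNatIso C).symm ≪≫ (tensoringLeft C).mapIso (e.symm ≪≫ β_ A B) ≪≫
      tensorLeftTensor B A)
    ((tensorLeftTensor A B).symm ≪≫ (tensoringLeft C).mapIso e ≪≫
      leftUnitorNatIso C)).isEquivalence_functor

section Inverse

variable {P : PicGpd.{v, w}}

/-- Fullness of `A ⊗ -` lets one solve for `q`, while `tensorHom_comp_cancel` gives uniqueness.
Hence the morphisms of an inverse functor are determined by the trivializations `i` and `j`, and its
functoriality comes for free. -/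
theorem PicGpd.exists_tensorHom_comp {A B A' B' K L : P} (p : A ⟶ B) (i : A ⊗ A' ⟶ K)
    (j : B ⊗ B' ⟶ L) (k : K ⟶ L) : ∃ q : A' ⟶ B', (p ⊗ₘ q) ≫ j = i ≫ k := by
  obtain ⟨q, hq⟩ := (tensorLeft A).map_surjective (i ≫ k ≫ inv j ≫ inv p ▷ B')
  refine ⟨q, ?_⟩
  change A ◁ q = _ at hq
  rw [tensorHom_def', hq]
  simp

theorem PicGpd.tensorHom_comp_cancel {A B A' B' K : P} {p : A ⟶ B} {q q' : A' ⟶ B'}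
    {j : B ⊗ B' ⟶ K} (h : (p ⊗ₘ q) ≫ j = (p ⊗ₘ q') ≫ j) : q = q' := by
  rw [cancel_mono] at h
  exact (PicGpd.tensorHom_congr_iff rfl).1 h

theorem PicGpd.exists_inverse (A : P) : ∃ B : P, Nonempty (A ⊗ B ≅ 𝟙_ P.carrier) :=
  ⟨(tensorLeft A).objPreimage (𝟙_ _), ⟨(tensorLeft A).objObjPreimageIso (𝟙_ _)⟩⟩

variable {ι : Type} {T : ι → TriCat.{u}}

/-- Every functor with additivity data has an inverse for the pointwise sum. -/
theorem PreDet.exists_inverse (D : PreDet T P) :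
    ∃ E : PreDet T P, Nonempty (D ⊗ E ≅ 𝟙_ (PreDet T P)) := by
  choose e he using fun X => PicGpd.exists_inverse (D.functor.obj X)
  let i : ∀ X, D.functor.obj X ⊗ e X ≅ 𝟙_ P.carrier := fun X => (he X).some
  choose m hm using fun {X Y : Core (∀ j, T j)} (a : X ⟶ Y) =>
    PicGpd.exists_tensorHom_comp (D.functor.map a) (i X).hom (i Y).hom (𝟙 _)
  -- The additivity datum is chosen so that `i` will be compatible with triangles; the `tensorδ`
  -- cancels the exchange in the additivity datum of the sum.
  choose s hs using fun {k : ι} {X Y Z : ∀ j, T j} {f : X ⟶ Y} {g : Y ⟶ Z} {h : ShiftHom k Z X}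
      (Δ : IsDistTri k f g h) =>
    PicGpd.exists_tensorHom_comp (D.add Δ)
      (tensorδ _ _ _ _ ≫ ((i ⟨Z⟩).hom ⊗ₘ (i ⟨X⟩).hom) ≫ (λ_ _).hom) (i ⟨Y⟩).hom (𝟙 _)
  let E : PreDet T P :=
    { functor :=
        { obj := e
          map := m
          -- Both functoriality laws follow from uniqueness: the two candidates satisfy the equation
          -- characterizing `m`.
          map_id := fun X => PicGpd.tensorHom_comp_cancel (p := D.functor.map (𝟙 X))
            (j := (i X).hom) (by rw [hm]; simp)
          map_comp := fun {X Y Z} a b => PicGpd.tensorHom_comp_cancel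
            (p := D.functor.map (a ≫ b)) (j := (i Z).hom) (by
              rw [hm, Functor.map_comp, ← tensorHom_comp_tensorHom, Category.assoc, hm,
                Category.comp_id, Category.comp_id, hm, Category.comp_id]) }
      add := s }
  refine ⟨E, ⟨PreDet.isoMk (NatIso.ofComponents i fun a => hm a) fun {k X Y Z f g h} Δ => ?_⟩⟩
  change (tensorμ _ _ _ _ ≫ (D.add Δ ⊗ₘ s Δ)) ≫ (i ⟨Y⟩).hom =
    ((i ⟨Z⟩).hom ⊗ₘ (i ⟨X⟩).hom) ≫ (λ_ (𝟙_ P.carrier)).hom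
  rw [Category.assoc, hs, Category.comp_id, tensorμ_tensorδ_assoc]

end Inverse

section

variable (P : PicGpd.{v, w}) (T : TriTuple.{u})

instance : (isMultiDet P T).IsMonoidal where
  prop_unit := PreDet.isMultiDet_tensorUnit T.T P
  prop_tensor _ _ hD hE := hD.tensorObj hE

theorem isEquivalence_tensorLeft_isMultiDet (D : (isMultiDet P T).FullSubcategory) :
    (tensorLeft D).IsEquivalence := by
  obtain ⟨E, ⟨e⟩⟩ := D.obj.exists_inverse
  -- The inverse `E` comes without axioms. The sum satisfies them, being isomorphic to the unit, and
  -- then `D` is cancelled.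
  have hE : (D.obj.tensorObj E).IsMultiDet := (PreDet.isMultiDet_tensorUnit T.T P).of_iso e.inv
  exact isEquivalence_tensorLeft (A := D) (B := ⟨E, D.property.of_tensorObj hE⟩)
    ((isMultiDet P T).isoMk e)

end

/-! ### Coherence computations behind the two triangles axiom. -/

section Coherence

variable {C : Type*} [Category* C] [MonoidalCategory C] [SymmetricCategory C]

/-- By naturality in `e`, moving `a ⊗ b` across `X` and then contracting is the same as contracting
at once. The hexagon splits this passage into those of `b` and of `a`, and symmetry inverts that of
`b`. -/
theorem braiding_whiskerRight_contract (a b X : C) (e : a ⊗ b ⟶ 𝟙_ C) :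
    (α_ a X b).inv ≫ (β_ a X).hom ▷ b ≫ (α_ X a b).hom ≫ X ◁ e ≫ (ρ_ X).hom =
      a ◁ (β_ X b).hom ≫ (α_ a b X).inv ≫ e ▷ X ≫ (λ_ X).hom := by
  have h₁ : e ▷ X ≫ (λ_ X).hom = (β_ (a ⊗ b) X).hom ≫ X ◁ e ≫ (ρ_ X).hom := by
    rw [← BraidedCategory.braiding_naturality_left_assoc, braiding_rightUnitor]
  rw [h₁, BraidedCategory.braiding_tensor_left_hom]
  simp only [Category.assoc, Iso.inv_hom_id_assoc]
  rw [← MonoidalCategory.whiskerLeft_comp_assoc, SymmetricCategory.symmetry,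
    MonoidalCategory.whiskerLeft_id, Category.id_comp]

/-- The hexagon lets `a` cross `Z` and `X` separately. Instead of carrying `a` across `X`, one
carries `b` back across it by `braiding_whiskerRight_contract`, leaving only a contraction around
`Z`. -/
theorem braiding_tensor_contract (a b X Z : C) (e : a ⊗ b ⟶ 𝟙_ C) :
    (α_ a (Z ⊗ X) b).inv ≫ (β_ a (Z ⊗ X)).hom ▷ b ≫ (α_ (Z ⊗ X) a b).hom ≫ (Z ⊗ X) ◁ e ≫
        (ρ_ (Z ⊗ X)).hom =
      a ◁ ((α_ Z X b).hom ≫ Z ◁ (β_ X b).hom ≫ (α_ Z b X).inv) ≫ (α_ a (Z ⊗ b) X).inv ≫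
        ((α_ a Z b).inv ≫ (β_ a Z).hom ▷ b ≫ (α_ Z a b).hom ≫ Z ◁ e ≫ (ρ_ Z).hom) ▷ X := by
  rw [BraidedCategory.braiding_tensor_right_hom]
  calc
    _ = 𝟙 _ ⊗≫ (β_ a Z).hom ▷ (X ⊗ b) ⊗≫ Z ◁ ((α_ a X b).inv ≫ (β_ a X).hom ▷ b ≫
        (α_ X a b).hom ≫ X ◁ e ≫ (ρ_ X).hom) ⊗≫ 𝟙 _ := by monoidal
    _ = 𝟙 _ ⊗≫ ((β_ a Z).hom ▷ (X ⊗ b) ≫ (Z ⊗ a) ◁ (β_ X b).hom) ⊗≫ Z ◁ e ▷ X ⊗≫ 𝟙 _ := by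
      rw [braiding_whiskerRight_contract]
      monoidal
    _ = _ := by
      rw [← whisker_exchange]
      monoidal

/-- Comparison of the two ways to build an object out of three, from a pairing `e` of `a` and `b`
which is used to rotate the morphisms `s` and `k`. -/
theorem whiskerRight_comp_eq_of_rotate [IsGroupoid C] {a b X Y Z W A : C}
    [(tensorLeft a).Faithful] {e : a ⊗ b ⟶ 𝟙_ C}
    {s : Y ⊗ b ⟶ A} {t : W ⊗ X ⟶ A} {k : Z ⊗ b ⟶ W} {l : Z ⊗ X ⟶ Y} {s' : a ⊗ A ⟶ Y}
    {k' : a ⊗ W ⟶ Z}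
    (hs : (α_ a Y b).hom ≫ a ◁ s ≫ s' =
      (β_ a Y).hom ▷ b ≫ (α_ Y a b).hom ≫ Y ◁ e ≫ (ρ_ Y).hom)
    (hk : (α_ a Z b).hom ≫ a ◁ k ≫ k' =
      (β_ a Z).hom ▷ b ≫ (α_ Z a b).hom ≫ Z ◁ e ≫ (ρ_ Z).hom)
    (h : k' ▷ X ≫ l = (α_ a W X).hom ≫ a ◁ t ≫ s') :
    l ▷ b ≫ s = ((α_ Z X b).hom ≫ Z ◁ (β_ X b).hom ≫ (α_ Z b X).inv) ≫ k ▷ X ≫ t := by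
  -- After adding `a` and composing with the invertible `s'`, the left side involves only `l` and
  -- the pairing `e`, by `hs`; the right side is reached by trading `e` for `k` and `k'`, by `hk`,
  -- and then `k'` and `l` for `t` and `s'`, by `h`.
  apply (tensorLeft a).map_injective
  rw [← cancel_mono s']
  change a ◁ _ ≫ s' = a ◁ _ ≫ s'
  have hk' : a ◁ k ≫ k' =
      (α_ a Z b).inv ≫ (β_ a Z).hom ▷ b ≫ (α_ Z a b).hom ≫ Z ◁ e ≫ (ρ_ Z).hom := by
    rw [← hk, Iso.inv_hom_id_assoc]
  have hs' : a ◁ s ≫ s' =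
      (α_ a Y b).inv ≫ (β_ a Y).hom ▷ b ≫ (α_ Y a b).hom ≫ Y ◁ e ≫ (ρ_ Y).hom := by
    rw [← hs, Iso.inv_hom_id_assoc]
  have h' : a ◁ t ≫ s' = (α_ a W X).inv ≫ k' ▷ X ≫ l := by
    rw [h, Iso.inv_hom_id_assoc]
  calc
    _ = a ◁ l ▷ b ≫ a ◁ s ≫ s' := by rw [MonoidalCategory.whiskerLeft_comp, Category.assoc]
    _ = (α_ a (Z ⊗ X) b).inv ≫ ((a ◁ l ≫ (β_ a Y).hom) ▷ b) ≫ (α_ Y a b).hom ≫ Y ◁ e ≫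
        (ρ_ Y).hom := by
      rw [hs', associator_inv_naturality_middle_assoc, comp_whiskerRight, Category.assoc]
    -- Here `l` slides through the braiding and the contraction, so that `a` and `b` are contracted
    -- around `Z ⊗ X` instead of `Y`.
    _ = ((α_ a (Z ⊗ X) b).inv ≫ (β_ a (Z ⊗ X)).hom ▷ b ≫ (α_ (Z ⊗ X) a b).hom ≫ (Z ⊗ X) ◁ e ≫
        (ρ_ (Z ⊗ X)).hom) ≫ l := by
      rw [BraidedCategory.braiding_naturality_right]
      simp only [Category.assoc, comp_whiskerRight]
      rw [associator_naturality_left_assoc, ← whisker_exchange_assoc, rightUnitor_naturality]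
    _ = a ◁ ((α_ Z X b).hom ≫ Z ◁ (β_ X b).hom ≫ (α_ Z b X).inv) ≫ (α_ a (Z ⊗ b) X).inv ≫
        (a ◁ k ≫ k') ▷ X ≫ l := by
      rw [braiding_tensor_contract, hk', Category.assoc, Category.assoc]
    _ = a ◁ ((α_ Z X b).hom ≫ Z ◁ (β_ X b).hom ≫ (α_ Z b X).inv) ≫ a ◁ (k ▷ X) ≫ a ◁ t ≫ s' := by
      rw [h']
      simp
    _ = _ := by simp only [MonoidalCategory.whiskerLeft_comp, Category.assoc]

/-- Both sides pass through `A ⊗ x'`: the hypotheses `h₁` and `h₂`, coming from the octahedra on the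
diagonal, rewrite the outer sums by means of `d`, and `h` compares the two resulting morphisms to
`A`. -/
theorem twoTriangles_of_whiskerRight_comp_eq {x' y' z' x y z x'' y'' z'' A : C}
    {s : y'' ⊗ z' ⟶ A} {t : z ⊗ x'' ⟶ A} {k : z'' ⊗ z' ⟶ z} {l : z'' ⊗ x'' ⟶ y''}
    {r' : z' ⊗ x' ⟶ y'} {cy : y'' ⊗ y' ⟶ y} {cx : x'' ⊗ x' ⟶ x} {r : z ⊗ x ⟶ y} {d : A ⊗ x' ⟶ y}
    (h : l ▷ z' ≫ s = ((α_ z'' x'' z').hom ≫ z'' ◁ (β_ x'' z').hom ≫ (α_ z'' z' x'').inv) ≫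
      k ▷ x'' ≫ t)
    (h₁ : t ▷ x' ≫ d = (α_ z x'' x').hom ≫ z ◁ cx ≫ r)
    (h₂ : s ▷ x' ≫ d = (α_ y'' z' x').hom ≫ y'' ◁ r' ≫ cy) :
    (l ⊗ₘ r') ≫ cy = tensorμ _ _ _ _ ≫ (k ⊗ₘ cx) ≫ r := by
  have h₁' : z ◁ cx ≫ r = (α_ z x'' x').inv ≫ t ▷ x' ≫ d := by rw [h₁, Iso.inv_hom_id_assoc]
  have h₂' : y'' ◁ r' ≫ cy = (α_ y'' z' x').inv ≫ s ▷ x' ≫ d := by rw [h₂, Iso.inv_hom_id_assoc]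
  -- The exchange does not move `x'`, so it is the exchange appearing in `h`, whiskered by `x'`.
  have h₃ : tensorμ z'' x'' z' x' = (α_ (z'' ⊗ x'') z' x').inv ≫ ((α_ z'' x'' z').hom ≫
      z'' ◁ (β_ x'' z').hom ≫ (α_ z'' z' x'').inv) ▷ x' ≫ (α_ (z'' ⊗ z') x'' x').hom := by
    rw [tensorμ]
    monoidal
  calc
    _ = (α_ (z'' ⊗ x'') z' x').inv ≫ (l ▷ z' ≫ s) ▷ x' ≫ d := by
      rw [MonoidalCategory.tensorHom_def, Category.assoc, h₂']
      simp
    _ = _ := by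
      rw [h, MonoidalCategory.tensorHom_def, Category.assoc (k ▷ _), h₁', h₃]
      simp only [Category.assoc, comp_whiskerRight]
      simp

end Coherence

/-! ### Determinant functors in one variable: units, rotation, nine-term diagrams. -/

section OneVariable

open scoped ZeroObject

variable {C : TriCat.{u}} {P : PicGpd.{v, w}}

theorem distinguished_of_split {X W Y : C} (f : X ⟶ W) (g : W ⟶ Y) (f' : Y ⟶ W) (g' : W ⟶ X)
    (hf : f ≫ g' = 𝟙 _) (hg : f' ≫ g = 𝟙 _) (hfg : f ≫ g = 0) (hfg' : f' ≫ g' = 0)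
    (h : g' ≫ f + g ≫ f' = 𝟙 _) : Triangle.mk f g 0 ∈ distTriang C :=
  let e : W ≅ X ⊞ Y :=
    { hom := biprod.lift g' g
      inv := biprod.desc f f'
      hom_inv_id := by rw [biprod.lift_desc, h]
      inv_hom_id := by ext <;> simp [hf, hg, hfg, hfg'] }
  have h₁ : f ≫ e.hom = 𝟙 _ ≫ biprod.inl := by
    dsimp [e]
    ext <;> simp [hf, hfg]
  have h₂ : g ≫ 𝟙 _ = e.hom ≫ biprod.snd := by simp [e]
  isomorphic_distinguished _ (binaryBiproductTriangle_distinguished X Y) _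
    (Triangle.isoMk _ _ (Iso.refl _) e (Iso.refl _) h₁ h₂ (by
      exact zero_comp.trans comp_zero.symm))

variable (C P) in
/-- The additivity data and the axioms of a determinant functor in one variable, without its
functoriality. -/
structure OneDet where
  obj : C → P
  add : ∀ {X Y Z : C} {f : X ⟶ Y} {g : Y ⟶ Z} {h : Z ⟶ X⟦(1 : ℤ)⟧},
    Triangle.mk f g h ∈ distTriang C → (obj Z ⊗ obj X ⟶ obj Y)
  commutativity : ∀ {X W Y : C} {f : X ⟶ W} {g : W ⟶ Y} {h : Y ⟶ X⟦(1 : ℤ)⟧}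
    {f' : Y ⟶ W} {g' : W ⟶ X} {h' : X ⟶ Y⟦(1 : ℤ)⟧}
    (Δ₁ : Triangle.mk f g h ∈ distTriang C) (Δ₂ : Triangle.mk f' g' h' ∈ distTriang C),
    f ≫ g' = 𝟙 _ → f' ≫ g = 𝟙 _ → g' ≫ f + g ≫ f' = 𝟙 _ →
    (β_ (obj X) (obj Y)).hom ≫ add Δ₁ = add Δ₂
  octahedron : ∀ {X Y Z X' Y' Z' : C}
    {f : X ⟶ Y} {f' : Y ⟶ Z'} {f'' : Z' ⟶ X⟦(1 : ℤ)⟧}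
    {k : X ⟶ Z} {k' : Z ⟶ Y'} {k'' : Y' ⟶ X⟦(1 : ℤ)⟧}
    {g : Y ⟶ Z} {g' : Z ⟶ X'} {g'' : X' ⟶ Y⟦(1 : ℤ)⟧}
    {m : Z' ⟶ Y'} {m' : Y' ⟶ X'} {m'' : X' ⟶ Z'⟦(1 : ℤ)⟧}
    (Δ₁ : Triangle.mk f f' f'' ∈ distTriang C) (Δ₂ : Triangle.mk k k' k'' ∈ distTriang C)
    (Δ₃ : Triangle.mk g g' g'' ∈ distTriang C) (Δ₄ : Triangle.mk m m' m'' ∈ distTriang C),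
    f ≫ g = k → f' ≫ m = g ≫ k' → f'' = m ≫ k'' → k' ≫ m' = g' →
    m' ≫ g'' = k'' ≫ f⟦(1 : ℤ)⟧' → g'' ≫ f'⟦(1 : ℤ)⟧' = m'' →
    (add Δ₄ ▷ obj X) ≫ add Δ₂ =
      (α_ (obj X') (obj Z') (obj X)).hom ≫ (obj X' ◁ add Δ₁) ≫ add Δ₃

namespace OneDet

variable (D : OneDet C P)

/-- The triangle `0 ⟶ X ⟶ X` determines a trivialization of the value at `0`. -/
theorem exists_unit : ∃ i : D.obj 0 ⟶ 𝟙_ P.carrier, ∀ X : C,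
    D.add (contractible_distinguished₁ X) = D.obj X ◁ i ≫ (ρ_ _).hom := by
  -- The choice of `i` is forced by the case `X = 0`; the octahedron extends the formula to all `X`.
  obtain ⟨i, hi⟩ := (tensorLeft (D.obj 0)).map_surjective
    (D.add (contractible_distinguished₁ (0 : C)) ≫ (ρ_ _).inv)
  change D.obj 0 ◁ i = _ at hi
  rw [Iso.eq_comp_inv] at hi
  refine ⟨i, fun X => ?_⟩
  -- This octahedron lies over `0 ⟶ 0 ⟶ X`: three of its triangles are `0 ⟶ X ⟶ X`, and one
  -- additivity morphism cancels on each side.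
  have h := D.octahedron (contractible_distinguished₁ (0 : C)) (contractible_distinguished₁ X)
    (contractible_distinguished₁ X) (contractible_distinguished₁ X) (by simp) (by simp) (by simp)
    (by simp) (by simp) (by simp)
  rw [← Category.assoc, cancel_mono] at h
  rw [← cancel_epi (D.add (contractible_distinguished₁ X) ▷ D.obj 0), ← whisker_exchange_assoc,
    rightUnitor_naturality, ← Category.assoc, cancel_mono]
  rw [h, ← hi]
  simp

/-- The value on the rotation of a distinguished triangle. -/
theorem exists_rotate (X : C) : ∃ e : D.obj (X⟦(1 : ℤ)⟧) ⊗ D.obj X ⟶ 𝟙_ P.carrier,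
    ∀ {Y Z : C} {f : X ⟶ Y} {g : Y ⟶ Z} {h : Z ⟶ X⟦(1 : ℤ)⟧}
      (Δ : Triangle.mk f g h ∈ distTriang C) (Δ' : Triangle.mk g h (-f⟦(1 : ℤ)⟧') ∈ distTriang C),
      (α_ _ _ _).hom ≫ D.obj (X⟦(1 : ℤ)⟧) ◁ D.add Δ ≫ D.add Δ' =
        (β_ _ _).hom ▷ D.obj X ≫ (α_ _ _ _).hom ≫ D.obj Z ◁ e ≫ (ρ_ _).hom := by
  obtain ⟨i, hi⟩ := D.exists_unit
  -- The pairing is the value on the triangle `X ⟶ 0 ⟶ ΣX`, followed by the trivialization of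
  -- `D(0)`. The sign is that of the rotation of `X ⟶ X ⟶ 0`.
  have hX : Triangle.mk (0 : X ⟶ 0) (0 : 0 ⟶ X⟦(1 : ℤ)⟧) (-𝟙 _) ∈ distTriang C := by
    have := rot_of_distTriang _ (contractible_distinguished X)
    change Triangle.mk (0 : X ⟶ 0) (0 : 0 ⟶ X⟦(1 : ℤ)⟧) (-(𝟙 X)⟦(1 : ℤ)⟧') ∈ distTriang C at this
    rwa [CategoryTheory.Functor.map_id] at this
  refine ⟨D.add hX ≫ i, fun {Y Z f g h} Δ Δ' => ?_⟩
  -- The composition `X ⟶ Y ⟶ Z` vanishes, so its cone is this sum. The maps `m` and `m'` are those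
  -- required by the octahedron over `f` and `g`, and `n`, `n'` form the complementary splitting;
  -- the sign of `n` matches the one in `hX`.
  let W := Z ⊞ X⟦(1 : ℤ)⟧
  let m : Z ⟶ W := biprod.inl + h ≫ biprod.inr
  let m' : W ⟶ X⟦(1 : ℤ)⟧ := biprod.fst ≫ h - biprod.snd
  let n : X⟦(1 : ℤ)⟧ ⟶ W := -biprod.inr
  let n' : W ⟶ Z := biprod.fst
  have h₁ : m ≫ n' = 𝟙 _ := by simp [m, n']
  have h₂ : n ≫ m' = 𝟙 _ := by simp [m', n]
  have h₃ : m ≫ m' = 0 := by simp [m, m']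
  have h₄ : n ≫ n' = 0 := by simp [n, n']
  have h₅ : n' ≫ m + m' ≫ n = 𝟙 _ := by
    simp only [m, m', n, n', W]
    rw [← biprod.total]
    simp
  have Δ₄ : Triangle.mk m m' 0 ∈ distTriang C := distinguished_of_split m m' n n' h₁ h₂ h₃ h₄ h₅
  have Δ₄' : Triangle.mk n n' 0 ∈ distTriang C :=
    distinguished_of_split n n' m m' h₂ h₁ h₄ h₃ (by rw [add_comm, h₅])
  have Δ₂ : Triangle.mk (0 : X ⟶ Z) biprod.inl (biprod.snd : W ⟶ _) ∈ distTriang C := by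
    rw [rotate_distinguished_triangle]
    have := binaryBiproductTriangle_distinguished Z (X⟦(1 : ℤ)⟧)
    change Triangle.mk biprod.inl biprod.snd (-(0 : X ⟶ Z)⟦(1 : ℤ)⟧') ∈ distTriang C
    rwa [Functor.map_zero, neg_zero]
  have fg : f ≫ g = 0 := comp_distTriang_mor_zero₁₂ _ Δ
  have gh : g ≫ h = 0 := comp_distTriang_mor_zero₂₃ _ Δ
  have hf : h ≫ f⟦(1 : ℤ)⟧' = 0 := comp_distTriang_mor_zero₃₁ _ Δ
  -- The zero map `X ⟶ Z` is factored in two ways, through `Y` here and through `0` in `o₂`. The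
  -- fourth triangles of the two octahedra are the two triangles of the splitting of `W`, so the
  -- commutativity axiom relates them and produces the braiding.
  have o₁ := D.octahedron Δ Δ₂ Δ' Δ₄ fg (by simp [m, reassoc_of% gh]) (by simp [m]) (by simp [m'])
    (by simp [m', hf]) (by simp [← Functor.map_comp, fg])
  have o₂ := D.octahedron hX Δ₂ (contractible_distinguished₁ Z) Δ₄' (by simp) (by simp)
    (by simp [n]) (by simp [n']) (by simp) (by simp)
  rw [← o₁, ← D.commutativity Δ₄' Δ₄ h₂ h₁ (by rw [add_comm, h₅]), comp_whiskerRight,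
    Category.assoc, o₂, hi, MonoidalCategory.whiskerLeft_comp, Category.assoc]

/-- The two ways to compute the value at the centre of a nine-term diagram with a Verdier structure
coincide. -/
theorem twoTriangles {d : NineDiagram C} (s : VerdierStructure d) :
    (D.add d.row'' ⊗ₘ D.add d.row') ≫ D.add d.coly =
      tensorμ _ _ _ _ ≫ (D.add d.colz ⊗ₘ D.add d.colx) ≫ D.add d.row := by
  -- The third octahedron contains the rotations of the triangles on `β` and on `r'`. Both of these
  -- start at `z'`, so a single pairing handles both rotations.
  obtain ⟨e, he⟩ := D.exists_rotate d.z'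
  have o₁ := D.octahedron d.colx s.dist d.row s.o₁.mem rfl s.o₁.comm₁ s.o₁.comm₂.symm s.o₁.comm₃
    s.o₁.comm₄.symm rfl
  have o₂ := D.octahedron d.row' s.dist d.coly s.o₂.mem d.comm_f' s.o₂.comm₁ s.o₂.comm₂.symm
    s.o₂.comm₃ s.o₂.comm₄.symm rfl
  -- The condition `ηβ = r'` ensures that the fourth triangle of the third octahedron is exactly the
  -- rotation of the column on `r'`.
  have hz : (-s.o₂.m₁⟦(1 : ℤ)⟧') ≫ s.o₁.m₃⟦(1 : ℤ)⟧' = -d.r'⟦(1 : ℤ)⟧' := by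
    rw [Preadditive.neg_comp, ← Functor.map_comp, s.βη]
  have o₃ := D.octahedron s.o₁.mem d.row'' (rot_of_distTriang _ s.o₂.mem)
    (rot_of_distTriang _ d.colz) s.εγ (by rw [← s.o₃_m₁]; exact s.o₃.comm₁)
    (by rw [← s.o₃_m₁]; exact s.o₃.comm₂.symm) (by rw [← s.o₃_m₃]; exact s.o₃.comm₃)
    (by rw [← s.o₃_m₃]; exact s.o₃.comm₄.symm) hz
  exact twoTriangles_of_whiskerRight_comp_eq
    (whiskerRight_comp_eq_of_rotate (he s.o₂.mem (rot_of_distTriang _ s.o₂.mem))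
      (he d.colz (rot_of_distTriang _ d.colz)) o₃) o₁ o₂

end OneDet

end OneVariable

noncomputable section

/-! ### Varying a single entry of a family of objects. -/

section Insert

variable {ι : Type} {T : ι → TriCat.{u}} (B : ∀ j, T j) (l : ι)

open scoped Classical in
/-- The family of objects obtained from `B` by replacing its `l`-th entry. -/
def insertObj (a : T l) : ∀ j, T j := Function.update B l a

variable {B l}

theorem insertObj_self (a : T l) : insertObj B l a l = a := by simp [insertObj]

theorem insertObj_off (a : T l) {j : ι} (hj : j ≠ l) : insertObj B l a j = B j := by
  simp [insertObj, hj]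

open scoped Classical in
/-- The morphism between families of objects which differ only in their `l`-th entry, given by a
morphism between these entries. -/
def vertHom {X Y : ∀ j, T j} (h : ∀ j, j ≠ l → X j = Y j) (t : X l ⟶ Y l) : X ⟶ Y :=
  fun j => if hj : j = l then Eq.rec (motive := fun a _ => X a ⟶ Y a) t hj.symm
    else eqToHom (h j hj)

@[simp]
theorem vertHom_self {X Y : ∀ j, T j} (h : ∀ j, j ≠ l → X j = Y j) (t : X l ⟶ Y l) :
    vertHom h t l = t := by simp [vertHom]

theorem vertHom_off {X Y : ∀ j, T j} (h : ∀ j, j ≠ l → X j = Y j) (t : X l ⟶ Y l) (j : ι)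
    (hj : j ≠ l) : ∃ e : X j = Y j, vertHom h t j = eqToHom e :=
  ⟨h j hj, by simp [vertHom, hj]⟩

/-- The isomorphism between families of objects which differ only in their `l`-th entry, given by
an isomorphism between these entries. -/
@[simps]
def vertIso {X Y : ∀ j, T j} (h : ∀ j, j ≠ l → X j = Y j) (t : X l ≅ Y l) : X ≅ Y where
  hom := vertHom h t.hom
  inv := vertHom (fun j hj => (h j hj).symm) t.inv
  hom_inv_id := hom_ext_off (l := l) (by simp)
    (fun j hj => exists_eqToHom_comp (vertHom_off _ _ j hj) (vertHom_off _ _ j hj))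
    (fun j _ => ⟨rfl, rfl⟩)
  inv_hom_id := hom_ext_off (l := l) (by simp)
    (fun j hj => exists_eqToHom_comp (vertHom_off _ _ j hj) (vertHom_off _ _ j hj))
    (fun j _ => ⟨rfl, rfl⟩)

variable (B l)

/-- The morphism of families given by a morphism of the `l`-th entries. -/
def insertHom {a b : T l} (t : a ⟶ b) : insertObj B l a ⟶ insertObj B l b :=
  vertHom (fun _ hj => (insertObj_off a hj).trans (insertObj_off b hj).symm)
    (eqToHom (insertObj_self a) ≫ t ≫ eqToHom (insertObj_self b).symm)

/-- The translating morphism of families given by a translating morphism of the `l`-th entries. -/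
@[simps]
def insertShift {c a : T l} (t : c ⟶ a⟦(1 : ℤ)⟧) :
    ShiftHom l (insertObj B l c) (insertObj B l a) where
  self := eqToHom (insertObj_self c) ≫ t ≫ (eqToHom (insertObj_self a).symm)⟦(1 : ℤ)⟧'
  off _ hj := eqToHom ((insertObj_off c hj).trans (insertObj_off a hj).symm)

@[simp]
theorem insertHom_self {a b : T l} (t : a ⟶ b) : insertHom B l t l =
    eqToHom (insertObj_self a) ≫ t ≫ eqToHom (insertObj_self b).symm := vertHom_self _ _

theorem insertHom_off {a b : T l} (t : a ⟶ b) (j : ι) (hj : j ≠ l) :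
    ∃ e : insertObj B l a j = insertObj B l b j, insertHom B l t j = eqToHom e :=
  vertHom_off _ _ j hj

theorem insertShift_off' {c a : T l} (t : c ⟶ a⟦(1 : ℤ)⟧) (j : ι) (hj : j ≠ l) :
    ∃ e : insertObj B l c j = insertObj B l a j, (insertShift B l t).off j hj = eqToHom e :=
  ⟨(insertObj_off c hj).trans (insertObj_off a hj).symm, rfl⟩

/-- The `l`-th entry of `insertObj B l a` equals `a` only propositionally, so the triangle is
transported along identifications given by `eqToIso`. -/
theorem insert_dist {a b c : T l} {f : a ⟶ b} {g : b ⟶ c} {h : c ⟶ a⟦(1 : ℤ)⟧}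
    (Δ : Triangle.mk f g h ∈ distTriang (T l)) :
    IsDistTri l (insertHom B l f) (insertHom B l g) (insertShift B l h) where
  dist := by
    have h₁ : insertHom B l f l ≫ eqToHom (insertObj_self b) = eqToHom (insertObj_self a) ≫ f := by
      simp
    have h₂ : insertHom B l g l ≫ eqToHom (insertObj_self c) = eqToHom (insertObj_self b) ≫ g := by
      simp
    have h₃ : (insertShift B l h).self ≫ (eqToHom (insertObj_self a))⟦(1 : ℤ)⟧' =
        eqToHom (insertObj_self c) ≫ h := by
      rw [insertShift_self, Category.assoc, Category.assoc, ← Functor.map_comp, eqToHom_trans,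
        eqToHom_refl, CategoryTheory.Functor.map_id, Category.comp_id]
    exact isomorphic_distinguished _ Δ _ (Triangle.isoMk _ _ (eqToIso (insertObj_self a))
      (eqToIso (insertObj_self b)) (eqToIso (insertObj_self c)) h₁ h₂ h₃)
  f_off := insertHom_off B l f
  g_off := insertHom_off B l g
  h_off := insertShift_off' B l h

theorem insertHom_comp {a b c : T l} (f : a ⟶ b) (g : b ⟶ c) :
    insertHom B l (f ≫ g) = insertHom B l f ≫ insertHom B l g :=
  hom_ext_off (l := l) (by simp) (insertHom_off B l _)
    (fun j hj => exists_eqToHom_comp (insertHom_off B l f j hj) (insertHom_off B l g j hj))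

theorem insertShift_precomp {a b c : T l} (f : a ⟶ b) (g : b ⟶ c⟦(1 : ℤ)⟧) :
    insertShift B l (f ≫ g) = (insertShift B l g).precomp (insertHom B l f) :=
  shiftHom_ext_off (by simp) (insertShift_off' B l _)
    (fun j hj => exists_eqToHom_comp (insertHom_off B l f j hj) (insertShift_off' B l g j hj))

theorem insertShift_postcomp {a b c : T l} (f : a ⟶ b⟦(1 : ℤ)⟧) (g : b ⟶ c) :
    insertShift B l (f ≫ g⟦(1 : ℤ)⟧') = (insertShift B l f).postcomp (insertHom B l g) :=
  shiftHom_ext_off (by simp [← Functor.map_comp]) (insertShift_off' B l _)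
    (fun j hj => exists_eqToHom_comp (insertShift_off' B l f j hj) (insertHom_off B l g j hj))

end Insert

/-! ### From several variables to one. -/

section OneVariableOf

variable {ι : Type} {T : ι → TriCat.{u}} {P : PicGpd.{v, w}} {D : PreDet T P}

/-- The determinant functor in the `l`-th variable given by a multi-determinant functor and by fixed
objects in all the other variables. -/
def PreDet.IsMultiDet.oneDet (hD : D.IsMultiDet) (B : ∀ j, T j) (l : ι) : OneDet (T l) P where
  obj a := D.functor.obj ⟨insertObj B l a⟩
  add Δ := D.add (insert_dist B l Δ)
  commutativity Δ₁ Δ₂ h₁ h₂ h₃ := by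
    refine hD.commutativity _ _ ?_ ?_ ?_
    · simp [reassoc_of% h₁]
    · simp [reassoc_of% h₂]
    -- The identity for the direct sum is conjugated by the identification of the inserted entry
    -- with the given object.
    · have := congrArg (fun t => eqToHom (insertObj_self (B := B) _) ≫ t ≫
        eqToHom (insertObj_self (B := B) _).symm) h₃
      simpa using this
  octahedron Δ₁ Δ₂ Δ₃ Δ₄ h₁ h₂ h₃ h₄ h₅ h₆ := by
    refine hD.octahedron _ _ _ _ ?_ ?_ ?_ ?_ ?_ ?_
    · rw [← insertHom_comp, h₁]
    · rw [← insertHom_comp, ← insertHom_comp, h₂]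
    · rw [← insertShift_precomp, h₃]
    · rw [← insertHom_comp, h₄]
    · rw [← insertShift_precomp, ← insertShift_postcomp, h₅]
    · rw [← insertShift_postcomp, h₆]

/-- A family of objects is isomorphic to any one which only differs from it in the `l`-th entry,
once this entry has been replaced. -/
def insertIso {B X : ∀ j, T j} {l : ι} (h : ∀ j, j ≠ l → X j = B j) : X ≅ insertObj B l (X l) :=
  vertIso (fun j hj => (h j hj).trans (insertObj_off _ hj).symm) (eqToIso (insertObj_self _).symm)

/-- The identifications `insertIso` form an isomorphism of triangles, so this is the naturality
axiom. It allows an arbitrary triangle in the `l`-th variable to be replaced by one which comes from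
`oneDet`. -/
theorem PreDet.IsMultiDet.add_comp_insertIso (hD : D.IsMultiDet) {B : ∀ j, T j} {l : ι}
    {X Y Z : ∀ j, T j} {f : X ⟶ Y} {g : Y ⟶ Z} {h : ShiftHom l Z X} (Δ : IsDistTri l f g h)
    (hX : ∀ j, j ≠ l → X j = B j) (hY : ∀ j, j ≠ l → Y j = B j) (hZ : ∀ j, j ≠ l → Z j = B j) :
    D.add Δ ≫ D.mapIso (insertIso hY) =
      (D.mapIso (insertIso hZ) ⊗ₘ D.mapIso (insertIso hX)) ≫ D.add (insert_dist B l Δ.dist) := by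
  refine hD.naturality _ _ _ _ _ ?_ ?_ ?_
  · exact hom_ext_off (l := l) (by simp [insertIso])
      (fun j hj => exists_eqToHom_comp (Δ.f_off j hj) (vertHom_off _ _ j hj))
      (fun j hj => exists_eqToHom_comp (vertHom_off _ _ j hj) (insertHom_off B l _ j hj))
  · exact hom_ext_off (l := l) (by simp [insertIso])
      (fun j hj => exists_eqToHom_comp (Δ.g_off j hj) (vertHom_off _ _ j hj))
      (fun j hj => exists_eqToHom_comp (vertHom_off _ _ j hj) (insertHom_off B l _ j hj))
  · exact shiftHom_ext_off (by simp [insertIso])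
      (fun j hj => exists_eqToHom_comp (Δ.h_off j hj) (vertHom_off _ _ j hj))
      (fun j hj => exists_eqToHom_comp (vertHom_off _ _ j hj) (insertShift_off' B l _ j hj))

/-- The two triangles axiom for a nine-term diagram with a Verdier structure in one variable. -/
theorem PreDet.IsMultiDet.twoTriangles_nineAt (hD : D.IsMultiDet) {l : ι} (d : NineAt T l)
    (s : VerdierStructure d.eval) :
    (D.add d.row'' ⊗ₘ D.add d.row') ≫ D.add d.coly =
      tensorμ _ _ _ _ ≫ (D.add d.colz ⊗ₘ D.add d.colx) ≫ D.add d.row := by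
  have x : ∀ j, j ≠ l → d.x j = d.y j := fun j hj => (d.row.f_off j hj).1
  have y : ∀ j, j ≠ l → d.y j = d.y j := fun j hj => rfl
  have z : ∀ j, j ≠ l → d.z j = d.y j := fun j hj => (d.row.g_off j hj).1.symm
  have x' : ∀ j, j ≠ l → d.x' j = d.y j := fun j hj => (d.colx.f_off j hj).1.trans (x j hj)
  have x'' : ∀ j, j ≠ l → d.x'' j = d.y j := fun j hj => (d.colx.g_off j hj).1.symm.trans (x j hj)
  have y' : ∀ j, j ≠ l → d.y' j = d.y j := fun j hj => (d.coly.f_off j hj).1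
  have y'' : ∀ j, j ≠ l → d.y'' j = d.y j := fun j hj => (d.coly.g_off j hj).1.symm
  have z' : ∀ j, j ≠ l → d.z' j = d.y j := fun j hj => (d.colz.f_off j hj).1.trans (z j hj)
  have z'' : ∀ j, j ≠ l → d.z'' j = d.y j := fun j hj => (d.colz.g_off j hj).1.symm.trans (z j hj)
  -- All nine objects agree with `d.y` outside `l`, so `d.y` can serve as the common family of fixed
  -- entries; the equation is then transported along the identifications.
  have key := (hD.oneDet d.y l).twoTriangles s
  rw [← cancel_mono (D.mapIso (insertIso y)), Category.assoc, Category.assoc, Category.assoc,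
    hD.add_comp_insertIso d.coly y' y y'', hD.add_comp_insertIso d.row x y z,
    tensorHom_comp_tensorHom_assoc, tensorHom_comp_tensorHom_assoc,
    hD.add_comp_insertIso d.row'' x'' y'' z'', hD.add_comp_insertIso d.row' x' y' z',
    hD.add_comp_insertIso d.colz z' z z'', hD.add_comp_insertIso d.colx x' x x'',
    ← tensorHom_comp_tensorHom_assoc, ← tensorHom_comp_tensorHom_assoc, ← tensorμ_natural_assoc]
  exact congrArg (_ ≫ ·) key

end OneVariableOf

end

noncomputable section

/-! ### Images of triangles and grids under a 1-morphism. -/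

section Image

variable {S T : TriTuple.{u}} (f : TupleHom S T)

/-- Restriction to the fibre of `f.φ` over `l`. -/
abbrev TupleHom.resHom {X Y : ∀ i, S.T i} (a : X ⟶ Y) (l : Fin T.n) :
    (show ∀ i : {i // f.φ i = l}, S.T i.1 from fun i => X i.1) ⟶ fun i => Y i.1 :=
  fun i => a i.1

/-- Restriction of a morphism which translates the `i`-th variable to the fibre of `f.φ` over the
image `l` of `i`. -/
abbrev TupleHom.resShift {i : Fin S.n} {Z X : ∀ i, S.T i} (a : ShiftHom i Z X) (l : Fin T.n)
    (hl : f.φ i = l) : ShiftHom (T := fun i : {i // f.φ i = l} => S.T i.1) ⟨i, hl⟩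
      (fun i => Z i.1) (fun i => X i.1) where
  self := a.self
  off i' hi' := a.off i'.1 (fun h => hi' (Subtype.ext h))

/-- Variant of `TupleHom.imageShift` where the index `l = f.φ i` is a variable. -/
def TupleHom.imageShiftAt {i : Fin S.n} {Z X : ∀ i, S.T i} (a : ShiftHom i Z X) (l : Fin T.n)
    (hl : f.φ i = l) : ShiftHom l (f.image.obj Z) (f.image.obj X) where
  self := (f.F l).shiftMap (f.resShift a l hl)
  off j hj := (f.F j).functor.map (fun i' => a.off i'.1
    (fun h => hj (i'.2.symm.trans ((congrArg f.φ h).trans hl))))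

theorem TupleHom.imageShiftAt_precomp {i : Fin S.n} {W Z X : ∀ i, S.T i} (a : W ⟶ Z)
    (b : ShiftHom i Z X) (l : Fin T.n) (hl : f.φ i = l) :
    f.imageShiftAt (b.precomp a) l hl = (f.imageShiftAt b l hl).precomp (f.image.map a) := by
  apply ShiftHom.ext
  · exact (f.F l).shiftMap_precomp (f.resHom a l) (f.resShift b l hl)
  · funext j hj
    exact (f.F j).functor.map_comp _ _

theorem TupleHom.imageShiftAt_postcomp {i : Fin S.n} {Z X Y : ∀ i, S.T i} (b : ShiftHom i Z X)
    (a : X ⟶ Y) (l : Fin T.n) (hl : f.φ i = l) :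
    f.imageShiftAt (b.postcomp a) l hl = (f.imageShiftAt b l hl).postcomp (f.image.map a) := by
  apply ShiftHom.ext
  · exact (f.F l).shiftMap_postcomp (f.resShift b l hl) (f.resHom a l)
  · funext j hj
    exact (f.F j).functor.map_comp _ _

theorem TupleHom.imageShift_precomp {i : Fin S.n} {W Z X : ∀ i, S.T i} (a : W ⟶ Z)
    (b : ShiftHom i Z X) :
    f.imageShift (b.precomp a) = (f.imageShift b).precomp (f.image.map a) :=
  f.imageShiftAt_precomp a b _ rfl

theorem TupleHom.imageShift_postcomp {i : Fin S.n} {Z X Y : ∀ i, S.T i} (b : ShiftHom i Z X)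
    (a : X ⟶ Y) :
    f.imageShift (b.postcomp a) = (f.imageShift b).postcomp (f.image.map a) :=
  f.imageShiftAt_postcomp b a _ rfl

theorem TupleHom.res_dist {i : Fin S.n} {X Y Z : ∀ i, S.T i} {a : X ⟶ Y} {b : Y ⟶ Z}
    {c : ShiftHom i Z X} (Δ : IsDistTri i a b c) (l : Fin T.n) (hl : f.φ i = l) :
    IsDistTri ⟨i, hl⟩ (f.resHom a l) (f.resHom b l) (f.resShift c l hl) where
  dist := Δ.dist
  f_off i' hi' := Δ.f_off i'.1 (fun h => hi' (Subtype.ext h))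
  g_off i' hi' := Δ.g_off i'.1 (fun h => hi' (Subtype.ext h))
  h_off _ _ := Δ.h_off _ _

theorem TupleHom.image_distAt {i : Fin S.n} {X Y Z : ∀ i, S.T i} {a : X ⟶ Y} {b : Y ⟶ Z}
    {c : ShiftHom i Z X} (Δ : IsDistTri i a b c) (l : Fin T.n) (hl : f.φ i = l) :
    IsDistTri l (f.image.map a) (f.image.map b) (f.imageShiftAt c l hl) := by
  subst hl
  exact f.image_dist Δ

/-- When two variables `i` and `j` have the same image, `f.φ i` and `f.φ j` are equal but not
definitionally so; this puts their triangles over one index `l`. -/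
theorem PreDet.add_image_dist {P : PicGpd.{v, w}} (D : PreDet T.T P) {i : Fin S.n}
    {X Y Z : ∀ i, S.T i} {a : X ⟶ Y} {b : Y ⟶ Z} {c : ShiftHom i Z X} (Δ : IsDistTri i a b c)
    (l : Fin T.n) (hl : f.φ i = l) : D.add (f.image_dist Δ) = D.add (f.image_distAt Δ l hl) := by
  subst hl
  rfl

/-- The image of a grid whose two variables go to different ones. -/
def TupleHom.imageGrid {i j : Fin S.n} {hij : i ≠ j} (d : Grid S.T i j hij) (hφ : f.φ i ≠ f.φ j) :
    Grid T.T (f.φ i) (f.φ j) hφ where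
  f' := f.image.map d.f'
  g' := f.image.map d.g'
  h' := f.imageShift d.h'
  f := f.image.map d.f
  g := f.image.map d.g
  h := f.imageShift d.h
  f'' := f.image.map d.f''
  g'' := f.image.map d.g''
  h'' := f.imageShift d.h''
  p' := f.image.map d.p'
  p := f.image.map d.p
  p'' := f.imageShift d.p''
  q' := f.image.map d.q'
  q := f.image.map d.q
  q'' := f.imageShift d.q''
  r' := f.image.map d.r'
  r := f.image.map d.r
  r'' := f.imageShift d.r''
  row' := f.image_dist d.row'
  row := f.image_dist d.row
  row'' := f.image_dist d.row''
  colx := f.image_dist d.colx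
  coly := f.image_dist d.coly
  colz := f.image_dist d.colz
  comm_f' := by rw [← Functor.map_comp, ← Functor.map_comp, d.comm_f']
  comm_g' := by rw [← Functor.map_comp, ← Functor.map_comp, d.comm_g']
  comm_h' := by rw [← f.imageShift_postcomp, ← f.imageShift_precomp, d.comm_h']
  comm_f := by rw [← Functor.map_comp, ← Functor.map_comp, d.comm_f]
  comm_g := by rw [← Functor.map_comp, ← Functor.map_comp, d.comm_g]
  comm_h := by rw [← f.imageShift_postcomp, ← f.imageShift_precomp, d.comm_h]
  comm_f'' := by rw [← f.imageShift_postcomp, ← f.imageShift_precomp, d.comm_f'']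
  comm_g'' := by rw [← f.imageShift_postcomp, ← f.imageShift_precomp, d.comm_g'']
  -- In the coordinate `f.φ i` the column acts by an ordinary morphism, as `f.φ i ≠ f.φ j`. Hence
  -- naturality of the translation map suffices and no sign appears.
  comm_h''_i := by
    change (f.F (f.φ i)).shiftMap _ ≫ ((f.F (f.φ i)).functor.map _)⟦(1 : ℤ)⟧' =
      (f.F (f.φ i)).functor.map _ ≫ (f.F (f.φ i)).shiftMap _
    rw [← MultiExact.shiftMap_postcomp, ← MultiExact.shiftMap_precomp]
    congr 1
    apply ShiftHom.ext
    · exact d.comm_h''_i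
    · funext k hk'
      exact d.comm_h''_off _ _ _
  comm_h''_j := by
    change (f.F (f.φ j)).functor.map _ ≫ (f.F (f.φ j)).shiftMap _ =
      (f.F (f.φ j)).shiftMap _ ≫ ((f.F (f.φ j)).functor.map _)⟦(1 : ℤ)⟧'
    rw [← MultiExact.shiftMap_postcomp, ← MultiExact.shiftMap_precomp]
    congr 1
    apply ShiftHom.ext
    · exact d.comm_h''_j
    · funext k hk'
      exact d.comm_h''_off _ _ _
  comm_h''_off k h₁ h₂ := by
    change (f.F k).functor.map _ ≫ (f.F k).functor.map _ =
      (f.F k).functor.map _ ≫ (f.F k).functor.map _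
    rw [← Functor.map_comp, ← Functor.map_comp]
    exact congrArg (f.F k).functor.map (funext fun i' => d.comm_h''_off i'.1 _ _)

/-- The restriction of a grid to a fibre of `f.φ` containing both of its variables. -/
def TupleHom.resGrid {i j : Fin S.n} {hij : i ≠ j} (d : Grid S.T i j hij) (l : Fin T.n)
    (hi : f.φ i = l) (hj : f.φ j = l) :
    Grid (fun i : {i // f.φ i = l} => S.T i.1) ⟨i, hi⟩ ⟨j, hj⟩
      (fun h => hij (congrArg (·.1) h)) where
  f' := f.resHom d.f' l
  g' := f.resHom d.g' l
  h' := f.resShift d.h' l hi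
  f := f.resHom d.f l
  g := f.resHom d.g l
  h := f.resShift d.h l hi
  f'' := f.resHom d.f'' l
  g'' := f.resHom d.g'' l
  h'' := f.resShift d.h'' l hi
  p' := f.resHom d.p' l
  p := f.resHom d.p l
  p'' := f.resShift d.p'' l hj
  q' := f.resHom d.q' l
  q := f.resHom d.q l
  q'' := f.resShift d.q'' l hj
  r' := f.resHom d.r' l
  r := f.resHom d.r l
  r'' := f.resShift d.r'' l hj
  row' := f.res_dist d.row' l hi
  row := f.res_dist d.row l hi
  row'' := f.res_dist d.row'' l hi
  colx := f.res_dist d.colx l hj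
  coly := f.res_dist d.coly l hj
  colz := f.res_dist d.colz l hj
  comm_f' := congrArg (f.resHom · l) d.comm_f'
  comm_g' := congrArg (f.resHom · l) d.comm_g'
  comm_h' := congrArg (f.resShift · l hi) d.comm_h'
  comm_f := congrArg (f.resHom · l) d.comm_f
  comm_g := congrArg (f.resHom · l) d.comm_g
  comm_h := congrArg (f.resShift · l hi) d.comm_h
  comm_f'' := congrArg (f.resShift · l hj) d.comm_f''
  comm_g'' := congrArg (f.resShift · l hj) d.comm_g''
  comm_h''_i := d.comm_h''_i
  comm_h''_j := d.comm_h''_j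
  comm_h''_off _ _ _ := d.comm_h''_off _ _ _

/-- The image of a grid whose two variables go to the same one. -/
def TupleHom.imageNineAt {i j : Fin S.n} {hij : i ≠ j} (d : Grid S.T i j hij) (l : Fin T.n)
    (hi : f.φ i = l) (hj : f.φ j = l) : NineAt T.T l where
  f' := f.image.map d.f'
  g' := f.image.map d.g'
  h' := f.imageShiftAt d.h' l hi
  f := f.image.map d.f
  g := f.image.map d.g
  h := f.imageShiftAt d.h l hi
  f'' := f.image.map d.f''
  g'' := f.image.map d.g''
  h'' := f.imageShiftAt d.h'' l hi
  p' := f.image.map d.p'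
  p := f.image.map d.p
  p'' := f.imageShiftAt d.p'' l hj
  q' := f.image.map d.q'
  q := f.image.map d.q
  q'' := f.imageShiftAt d.q'' l hj
  r' := f.image.map d.r'
  r := f.image.map d.r
  r'' := f.imageShiftAt d.r'' l hj
  row' := f.image_distAt d.row' l hi
  row := f.image_distAt d.row l hi
  row'' := f.image_distAt d.row'' l hi
  colx := f.image_distAt d.colx l hj
  coly := f.image_distAt d.coly l hj
  colz := f.image_distAt d.colz l hj
  comm_f' := by rw [← Functor.map_comp, ← Functor.map_comp, d.comm_f']
  comm_g' := by rw [← Functor.map_comp, ← Functor.map_comp, d.comm_g']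
  comm_h' := by rw [← f.imageShiftAt_postcomp, ← f.imageShiftAt_precomp, d.comm_h']
  comm_f := by rw [← Functor.map_comp, ← Functor.map_comp, d.comm_f]
  comm_g := by rw [← Functor.map_comp, ← Functor.map_comp, d.comm_g]
  comm_h := by rw [← f.imageShiftAt_postcomp, ← f.imageShiftAt_precomp, d.comm_h]
  comm_f'' := by rw [← f.imageShiftAt_postcomp, ← f.imageShiftAt_precomp, d.comm_f'']
  comm_g'' := by rw [← f.imageShiftAt_postcomp, ← f.imageShiftAt_precomp, d.comm_g'']
  -- Now both translations occur inside the one multiexact functor `f.F l`, whose anticommutativity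
  -- produces the sign.
  anticomm_h'' := ((f.F l).nine (f.resGrid d l hi hj)).anticomm_h''
  comm_h''_off k hk := by
    change (f.F k).functor.map _ ≫ (f.F k).functor.map _ =
      (f.F k).functor.map _ ≫ (f.F k).functor.map _
    rw [← Functor.map_comp, ← Functor.map_comp]
    exact congrArg (f.F k).functor.map (funext fun i' => d.comm_h''_off i'.1 _ _)

end Image

/-! ### Composition of multi-determinant functors with 1-morphisms and 2-cells. -/

section Precomp

variable {S T : TriTuple.{u}} (f : TupleHom S T) {P : PicGpd.{v, w}} {D : PreDet T.T P}

/-- The composite of a multi-determinant functor with a morphism of lists of triangulated categories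
is a multi-determinant functor. -/
theorem PreDet.IsMultiDet.precomp (hD : D.IsMultiDet) : (D.precomp f).IsMultiDet where
  naturality Δ Δ' a b c h₁ h₂ h₃ := by
    refine hD.naturality (f.image_dist Δ) (f.image_dist Δ') (f.image.mapIso a) (f.image.mapIso b)
      (f.image.mapIso c) ?_ ?_ ?_
    · rw [Functor.mapIso_hom, Functor.mapIso_hom, ← Functor.map_comp, h₁, Functor.map_comp]
    · rw [Functor.mapIso_hom, Functor.mapIso_hom, ← Functor.map_comp, h₂, Functor.map_comp]
    · rw [Functor.mapIso_hom, Functor.mapIso_hom, ← f.imageShift_postcomp, h₃, f.imageShift_precomp]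
  commutativity {i X W Y a b c a' b' c'} Δ₁ Δ₂ h₁ h₂ h₃ := by
    -- The hypotheses concern the `i`-th entry only, but the other entries are identifications, so
    -- whole families compose to identities and `f.image` can be applied.
    have e₁ : a ≫ b' = 𝟙 X := hom_ext_off (l := i) h₁
      (fun j hj => exists_eqToHom_comp (Δ₁.f_off j hj) (Δ₂.g_off j hj)) (fun _ _ => ⟨rfl, rfl⟩)
    have e₂ : a' ≫ b = 𝟙 Y := hom_ext_off (l := i) h₂
      (fun j hj => exists_eqToHom_comp (Δ₂.f_off j hj) (Δ₁.g_off j hj)) (fun _ _ => ⟨rfl, rfl⟩)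
    refine hD.commutativity _ _ ?_ ?_ ?_
    · exact congrFun ((f.image.map_comp a b').symm.trans
        ((congrArg f.image.map e₁).trans (f.image.map_id X))) _
    · exact congrFun ((f.image.map_comp a' b).symm.trans
        ((congrArg f.image.map e₂).trans (f.image.map_id Y))) _
    -- A sum of morphisms makes sense in one entry only; it is preserved by additivity of the
    -- functor in that variable, the other entries of all three families being identities.
    · have h := (f.F (f.φ i)).map_add ⟨i, rfl⟩ (f.resHom (b' ≫ a) _) (f.resHom (b ≫ a') _)
        (f.resHom (𝟙 W) _) h₃.symm (fun j hj => ?_)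
      · refine (congrArg₂ (· + ·) (congrFun (f.image.map_comp b' a) _)
          (congrFun (f.image.map_comp b a') _)).symm.trans (h.symm.trans ?_)
        exact congrFun (f.image.map_id W) _
      · have hj' : j.1 ≠ i := fun h => hj (Subtype.ext h)
        obtain ⟨_, h₄⟩ := exists_eqToHom_comp (Δ₂.g_off j.1 hj') (Δ₁.f_off j.1 hj')
        obtain ⟨_, h₅⟩ := exists_eqToHom_comp (Δ₁.g_off j.1 hj') (Δ₂.f_off j.1 hj')
        exact ⟨h₄, h₅⟩
  octahedron Δ₁ Δ₂ Δ₃ Δ₄ h₁ h₂ h₃ h₄ h₅ h₆ := by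
    refine hD.octahedron (f.image_dist Δ₁) (f.image_dist Δ₂) (f.image_dist Δ₃)
      (f.image_dist Δ₄) ?_ ?_ ?_ ?_ ?_ ?_
    · exact (f.image.map_comp _ _).symm.trans (congrArg f.image.map h₁)
    · exact (f.image.map_comp _ _).symm.trans
        ((congrArg f.image.map h₂).trans (f.image.map_comp _ _))
    · exact (congrArg f.imageShift h₃).trans (f.imageShift_precomp _ _)
    · exact (f.image.map_comp _ _).symm.trans (congrArg f.image.map h₄)
    · exact (f.imageShift_precomp _ _).symm.trans
        ((congrArg f.imageShift h₅).trans (f.imageShift_postcomp _ _))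
    · exact (f.imageShift_postcomp _ _).symm.trans (congrArg f.imageShift h₆)
  twoTriangles {i j hij} d := by
    by_cases hφ : f.φ i = f.φ j
    -- This case is where Verdier structures are needed. The entry at `f.φ i` of the image diagram
    -- is by definition the nine-term diagram of the restricted grid, so `s` applies to it.
    · obtain ⟨s⟩ := (f.verdier (f.φ i)).of_ne _ (f.resGrid d (f.φ i) rfl hφ.symm)
      have := hD.twoTriangles_nineAt (f.imageNineAt d (f.φ i) rfl hφ.symm) s
      have ey := D.add_image_dist f d.coly _ hφ.symm
      have ez := D.add_image_dist f d.colz _ hφ.symm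
      have ex := D.add_image_dist f d.colx _ hφ.symm
      exact (congrArg ((D.add (f.image_dist d.row'') ⊗ₘ D.add (f.image_dist d.row')) ≫ ·) ey).trans
        (this.trans (congrArg₂ (fun a b => tensorμ _ _ _ _ ≫ (a ⊗ₘ b) ≫ D.add (f.image_dist d.row))
          ez ex).symm)
    · exact hD.twoTriangles (f.imageGrid d hφ)

variable {f}

/-- Whiskering a multi-determinant functor with a 2-cell gives a morphism of multi-determinant
functors. -/
theorem PreDet.IsMultiDet.add_comp_whisker (hD : D.IsMultiDet) {f g : TupleHom S T} (a : f ⟶ g)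
    {i : Fin S.n} {X Y Z : ∀ j, S.T j} {p : X ⟶ Y} {q : Y ⟶ Z} {r : ShiftHom i Z X}
    (Δ : IsDistTri i p q r) :
    (D.precomp f).add Δ ≫ (D.whisker a).app ⟨Y⟩ =
      ((D.whisker a).app ⟨Z⟩ ⊗ₘ (D.whisker a).app ⟨X⟩) ≫ (D.precomp g).add Δ := by
  obtain ⟨a⟩ := a
  rename_i φ F F' h h'
  let e : (TupleHom.mk φ F h).image ≅ (TupleHom.mk φ F' h').image := TupleHom₂.image (.mk a)
  -- The components of the 2-cell form an isomorphism between the two image triangles; its third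
  -- square is the compatibility with translations.
  refine hD.naturality _ _ (e.app X) (e.app Y) (e.app Z) (e.hom.naturality p)
    (e.hom.naturality q) ?_
  apply ShiftHom.ext
  · exact (a _).shift _
  · funext j hj
    exact (a j).iso.hom.naturality _

end Precomp

theorem detWellDefined (P : PicGpd.{v, w}) : DetWellDefined.{u} P where
  isMonoidal _ := inferInstance
  isEquivalence T D := isEquivalence_tensorLeft_isMultiDet P T D
  precomp f _ hD := hD.precomp f
  whisker a _ hD _ _ _ _ _ _ _ Δ := hD.add_comp_whisker a Δ

end

/-! ### Strict 2-functoriality. -/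

section Pseudofunctor

variable {P : PicGpd.{v, w}}

/-- A single functor `F` is enough because the underlying functors compared below agree
definitionally; only their monoidal structures have to be compared. -/
theorem PicHom.ext' {P Q : PicGpd.{v, w}} (F : P ⥤ Q) (a b : F.Braided)
    (h₁ : a.ε = b.ε) (h₂ : ∀ X Y, a.μ X Y = b.μ X Y) :
    (PicHom.mk F (braided := a)) = PicHom.mk F (braided := b) := by
  congr 1
  apply Functor.Braided.toMonoidal_injective
  apply Functor.Monoidal.toLaxMonoidal_injective
  apply Functor.LaxMonoidal.ext
  · exact h₁
  · funext X Y; exact h₂ X Y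

theorem detMap_id (H : DetWellDefined.{u} P) (T : TriTuple.{u}) :
    detMap H (𝟙 T) = 𝟙 (detObj H T) := by
  exact PicHom.ext' (detFunctor H (𝟙 T)) _ _ rfl (fun _ _ => rfl)

theorem detMap_comp (H : DetWellDefined.{u} P) {S T U : TriTuple.{u}} (f : S ⟶ T) (g : T ⟶ U) :
    detMap H (f ≫ g) = detMap H g ≫ detMap H f := by
  refine PicHom.ext' (detFunctor H (f ≫ g)) _ _ ?_ (fun D E => ?_)
  · refine detObj_hom_ext H fun X => ?_
    exact (Category.id_comp _).symm
  · refine detObj_hom_ext H fun X => ?_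
    exact (Category.id_comp _).symm

/-- The components of a 2-morphism between composites with morphisms of lists. -/
theorem detMap_hom_ext (H : DetWellDefined.{u} P) {S T : TriTuple.{u}}
    {F G : detObj H T ⟶ detObj H S} {a b : F ⟶ G}
    (h : ∀ D X, (a.natTrans.app D).hom.natTrans.app X = (b.natTrans.app D).hom.natTrans.app X) :
    a = b :=
  PicHom₂.ext (NatTrans.ext (funext fun D => detObj_hom_ext H (h D)))

theorem eqToHom_natTrans_app {P Q : PicGpd.{v, w}} {F G : P ⟶ Q} (e : F = G) (D : P) :
    (eqToHom e).natTrans.app D = eqToHom (by rw [e]) := by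
  subst e
  rfl

/-- Two isomorphisms in a product of categories with the same components have the same image. -/
theorem map_core_congr {ι : Type} {T : ι → TriCat.{u}} (D : Core (∀ i, T i) ⥤ P)
    {X Y : Core (∀ i, T i)} {a b : X ⟶ Y} (h : ∀ j, a.iso.hom j = b.iso.hom j) :
    D.map a = D.map b := by
  congr 1
  ext j
  exact h j

theorem map_core_eq_id {ι : Type} {T : ι → TriCat.{u}} (D : Core (∀ i, T i) ⥤ P)
    {X : Core (∀ i, T i)} {a : X ⟶ X} (h : ∀ j, a.iso.hom j = 𝟙 _) : D.map a = 𝟙 _ :=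
  (map_core_congr D (b := 𝟙 X) h).trans (D.map_id X)

theorem map_core_eq_comp {ι : Type} {T : ι → TriCat.{u}} (D : Core (∀ i, T i) ⥤ P)
    {X Y Z : Core (∀ i, T i)} {a : X ⟶ Z} {b : X ⟶ Y} {c : Y ⟶ Z}
    (h : ∀ j, a.iso.hom j = b.iso.hom j ≫ c.iso.hom j) : D.map a = D.map b ≫ D.map c :=
  (map_core_congr D (b := b ≫ c) h).trans (D.map_comp b c)

/-- The prelax functor given by the Picard groupoids of multi-determinant functors. -/
def detPrelax (H : DetWellDefined.{u} P) :
    PrelaxFunctor TriTuple.{u}ᵒᵖ PicGpd.{max u v, max u v w} where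
  toPrelaxFunctorStruct := detStruct H
  map₂_id f := detMap_hom_ext H fun D X => map_core_eq_id _ fun j => rfl
  map₂_comp := by
    rintro S T ⟨f⟩ ⟨g⟩ ⟨h⟩ ⟨a⟩ ⟨b⟩
    obtain ⟨a⟩ := a
    obtain ⟨b⟩ := b
    exact detMap_hom_ext H fun D X => map_core_eq_comp _ fun j => rfl

open scoped Bicategory

/-- Together with the two unit laws, this makes composition of Picard functors strict. It allows
associators and unitors to be identified with `eqToHom`, which makes the coherence laws of the final
functor automatic. -/
theorem PicHom.assoc {P Q R S : PicGpd.{v, w}} (F : P ⟶ Q) (G : Q ⟶ R) (K : R ⟶ S) :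
    (F ≫ G) ≫ K = F ≫ G ≫ K := by
  refine PicHom.ext' (F.functor ⋙ G.functor ⋙ K.functor) _ _ ?_ (fun X Y => ?_)
  · change _ ≫ K.functor.map (_ ≫ G.functor.map _) =
      (_ ≫ K.functor.map _) ≫ K.functor.map (G.functor.map _)
    simp
  · change _ ≫ K.functor.map (_ ≫ G.functor.map _) =
      (_ ≫ K.functor.map _) ≫ K.functor.map (G.functor.map _)
    simp

theorem PicHom.id_comp {P Q : PicGpd.{v, w}} (F : P ⟶ Q) : 𝟙 P ≫ F = F := by
  refine PicHom.ext' F.functor _ _ ?_ (fun X Y => ?_)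
  · change _ ≫ F.functor.map (𝟙 _) = _
    simp
  · change _ ≫ F.functor.map (𝟙 _) = _
    simp

theorem PicHom.comp_id {P Q : PicGpd.{v, w}} (F : P ⟶ Q) : F ≫ 𝟙 Q = F := by
  refine PicHom.ext' F.functor _ _ ?_ (fun X Y => ?_)
  · exact Category.id_comp _
  · exact Category.id_comp _

theorem PicHom.leftUnitor_hom {P Q : PicGpd.{v, w}} (F : P ⟶ Q) :
    (Bicategory.leftUnitor F).hom = eqToHom (PicHom.id_comp F) := by
  refine PicHom₂.ext (NatTrans.ext (funext fun D => ?_))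
  rw [eqToHom_natTrans_app]
  rfl

theorem PicHom.rightUnitor_hom {P Q : PicGpd.{v, w}} (F : P ⟶ Q) :
    (Bicategory.rightUnitor F).hom = eqToHom (PicHom.comp_id F) := by
  refine PicHom₂.ext (NatTrans.ext (funext fun D => ?_))
  rw [eqToHom_natTrans_app]
  rfl

theorem PicHom.associator_hom {P Q R S : PicGpd.{v, w}} (F : P ⟶ Q) (G : Q ⟶ R) (K : R ⟶ S) :
    (α_ F G K).hom = eqToHom (PicHom.assoc F G K) := by
  refine PicHom₂.ext (NatTrans.ext (funext fun D => ?_))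
  rw [eqToHom_natTrans_app]
  rfl

section

variable {B C : Type*} [Bicategory B] [Bicategory C] (Φ : PrelaxFunctor B C)
  (comp : ∀ {a b c : B} (f : a ⟶ b) (g : b ⟶ c), Φ.map (f ≫ g) = Φ.map f ≫ Φ.map g)

/-- Every 2-cell in the coherence equation is an `eqToHom`, and any two of these with the same ends
coincide. The next two lemmas rest on the same remark. -/
theorem map₂_leftUnitor_of_eqToHom (id : ∀ a, Φ.map (𝟙 a) = 𝟙 (Φ.obj a)) {a b : B} (f : a ⟶ b)
    (e : 𝟙 (Φ.obj a) ≫ Φ.map f = Φ.map f) (he : (Bicategory.leftUnitor (Φ.map f)).hom = eqToHom e)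
    (e' : Φ.map (𝟙 a ≫ f) = Φ.map f) (he' : Φ.map₂ (Bicategory.leftUnitor f).hom = eqToHom e') :
    Φ.map₂ (Bicategory.leftUnitor f).hom = (eqToIso (comp (𝟙 a) f)).hom ≫
      (eqToIso (id a)).hom ▷ Φ.map f ≫ (Bicategory.leftUnitor (Φ.map f)).hom := by
  rw [he, he']
  simp

theorem map₂_rightUnitor_of_eqToHom (id : ∀ a, Φ.map (𝟙 a) = 𝟙 (Φ.obj a)) {a b : B} (f : a ⟶ b)
    (e : Φ.map f ≫ 𝟙 (Φ.obj b) = Φ.map f) (he : (Bicategory.rightUnitor (Φ.map f)).hom = eqToHom e)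
    (e' : Φ.map (f ≫ 𝟙 b) = Φ.map f) (he' : Φ.map₂ (Bicategory.rightUnitor f).hom = eqToHom e') :
    Φ.map₂ (Bicategory.rightUnitor f).hom = (eqToIso (comp f (𝟙 b))).hom ≫
      Φ.map f ◁ (eqToIso (id b)).hom ≫ (Bicategory.rightUnitor (Φ.map f)).hom := by
  rw [he, he']
  simp

theorem map₂_associator_of_eqToHom {a b c d : B} (f : a ⟶ b) (g : b ⟶ c) (h : c ⟶ d)
    (e : (Φ.map f ≫ Φ.map g) ≫ Φ.map h = Φ.map f ≫ Φ.map g ≫ Φ.map h)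
    (he : (α_ (Φ.map f) (Φ.map g) (Φ.map h)).hom = eqToHom e)
    (e' : Φ.map ((f ≫ g) ≫ h) = Φ.map (f ≫ g ≫ h))
    (he' : Φ.map₂ (α_ f g h).hom = eqToHom e') :
    Φ.map₂ (α_ f g h).hom = (eqToIso (comp (f ≫ g) h)).hom ≫
      (eqToIso (comp f g)).hom ▷ Φ.map h ≫ (α_ (Φ.map f) (Φ.map g) (Φ.map h)).hom ≫
      Φ.map f ◁ (eqToIso (comp g h)).inv ≫ (eqToIso (comp f (g ≫ h))).inv := by
  rw [he, he']
  simp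

end

/-- The right unitor of `f` is not a reflexivity isomorphism, yet composition with `f ≫ 𝟙 T`
evaluates translation maps only at the index `f.φ i` with a reflexivity proof, where they unfold to
those of `f`. -/
theorem detMap_comp_id (H : DetWellDefined.{u} P) {S T : TriTuple.{u}} (f : S ⟶ T) :
    detMap H (f ≫ 𝟙 T) = detMap H f := rfl

theorem detMap_id_comp (H : DetWellDefined.{u} P) {S T : TriTuple.{u}} (f : S ⟶ T) :
    detMap H (𝟙 S ≫ f) = detMap H f := rfl

theorem detMap_assoc (H : DetWellDefined.{u} P) {Q R S T : TriTuple.{u}}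
    (f : R ⟶ Q) (g : S ⟶ R) (h : T ⟶ S) :
    detMap H ((h ≫ g) ≫ f) = detMap H (h ≫ g ≫ f) := rfl

theorem detMap₂_associator (H : DetWellDefined.{u} P) {Q R S T : TriTuple.{u}}
    (f : R ⟶ Q) (g : S ⟶ R) (h : T ⟶ S) :
    detMap₂ H (α_ h g f).inv = eqToHom (detMap_assoc H f g h).symm := by
  refine detMap_hom_ext H fun D X => ?_
  exact map_core_eq_id D.obj.functor fun j => rfl

theorem detMap₂_rightUnitor (H : DetWellDefined.{u} P) {S T : TriTuple.{u}} (f : S ⟶ T) :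
    detMap₂ H (Bicategory.rightUnitor f).hom = eqToHom (detMap_comp_id H f) := by
  refine detMap_hom_ext H fun D X => ?_
  exact map_core_eq_id D.obj.functor fun j => rfl

theorem detMap₂_leftUnitor (H : DetWellDefined.{u} P) {S T : TriTuple.{u}} (f : S ⟶ T) :
    detMap₂ H (Bicategory.leftUnitor f).hom = eqToHom (detMap_id_comp H f) := by
  refine detMap_hom_ext H fun D X => ?_
  exact map_core_eq_id D.obj.functor fun j => rfl

/-- Comparing components up to `HEq` avoids evaluating an `eqToHom` between functors; in the
applications the ends of the components agree definitionally. -/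
theorem detMap_hom_eq_eqToHom_comp (H : DetWellDefined.{u} P) {S T : TriTuple.{u}}
    {F G F' G' : detObj H T ⟶ detObj H S} (e : F = G) (e' : G' = F') (a : F ⟶ F') (b : G ⟶ G')
    (h : ∀ D X, HEq ((a.natTrans.app D).hom.natTrans.app X)
      ((b.natTrans.app D).hom.natTrans.app X)) : a = eqToHom e ≫ b ≫ eqToHom e' := by
  subst e e'
  rw [eqToHom_refl, eqToHom_refl, Category.id_comp, Category.comp_id]
  exact detMap_hom_ext H fun D X => eq_of_heq (h D X)

theorem detMap₂_whiskerLeft (H : DetWellDefined.{u} P) {R S T : TriTuple.{u}} {f f' : S ⟶ T}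
    (a : f ⟶ f') (g : R ⟶ S) :
    detMap₂ H (g ◁ a) = eqToHom (detMap_comp H g f) ≫ detMap₂ H a ▷ detMap H g ≫
      eqToHom (detMap_comp H g f').symm := by
  obtain ⟨a⟩ := a
  exact detMap_hom_eq_eqToHom_comp H _ _ _ _ fun D X =>
    heq_of_eq (map_core_congr D.obj.functor fun j => rfl)

theorem detMap₂_whiskerRight (H : DetWellDefined.{u} P) {R S T : TriTuple.{u}} {f f' : R ⟶ S}
    (a : f ⟶ f') (g : S ⟶ T) :
    detMap₂ H (a ▷ g) = eqToHom (detMap_comp H f g) ≫ detMap H g ◁ detMap₂ H a ≫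
      eqToHom (detMap_comp H f' g).symm := by
  obtain ⟨a⟩ := a
  exact detMap_hom_eq_eqToHom_comp H _ _ _ _ fun D X =>
    heq_of_eq (map_core_congr D.obj.functor fun j => rfl)

/-- The strict pseudofunctor given by the Picard groupoids of multi-determinant functors. -/
def detPseudofunctor (H : DetWellDefined.{u} P) :
    StrictPseudofunctor TriTuple.{u}ᵒᵖ PicGpd.{max u v, max u v w} where
  toPrelaxFunctor := detPrelax H
  map_id T := detMap_id H T.unop
  map_comp f g := detMap_comp H g.unop f.unop
  mapId T := eqToIso (detMap_id H T.unop)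
  mapComp f g := eqToIso (detMap_comp H g.unop f.unop)
  mapId_eq_eqToIso _ := rfl
  mapComp_eq_eqToIso _ _ := rfl
  -- Passing to the opposite bicategory exchanges left and right, both for whiskerings and for
  -- unitors, and replaces the associator by its inverse.
  map₂_whisker_left f _ _ a := detMap₂_whiskerRight H a.unop2 f.unop
  map₂_whisker_right a f := detMap₂_whiskerLeft H a.unop2 f.unop
  map₂_left_unitor f := map₂_leftUnitor_of_eqToHom (detPrelax H)
    (fun f g => detMap_comp H g.unop f.unop) (fun T => detMap_id H T.unop) f
    (PicHom.id_comp _) (PicHom.leftUnitor_hom _) _ (detMap₂_rightUnitor H f.unop)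
  map₂_right_unitor f := map₂_rightUnitor_of_eqToHom (detPrelax H)
    (fun f g => detMap_comp H g.unop f.unop) (fun T => detMap_id H T.unop) f
    (PicHom.comp_id _) (PicHom.rightUnitor_hom _) _ (detMap₂_leftUnitor H f.unop)
  map₂_associator f g h := by
    exact map₂_associator_of_eqToHom (detPrelax H) (fun f g => detMap_comp H g.unop f.unop) f g h
      (PicHom.assoc _ _ _) (PicHom.associator_hom _ _ _)
      (detMap_assoc H f.unop g.unop h.unop).symm (detMap₂_associator H f.unop g.unop h.unop)

end Pseudofunctor

end DetFunctor

theorem mainTheorem6 (P : PicGpd.{v, w}) :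
    ∃ (H : DetWellDefined.{u} P)
      (Φ : StrictPseudofunctor TriTuple.{u}ᵒᵖ PicGpd.{max u v, max u v w}),
      Φ.toPrelaxFunctorStruct = detStruct H :=
  ⟨detWellDefined P, detPseudofunctor _, rfl⟩
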